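/- \textbf{Lemma.} Let $T_1,\dots,T_6$ be six lines in the complex projective plane $\mathbb P^2$ in general position, i.e. pairwise distinct with no three of them passing through a common point. For integers $b_1,\dots,b_6\ge 1$ let $(\mathbb P^2,\sum_i b_iT_i)$ denote the pair $(\mathbb P^2,\beta)$, where $\beta:\mathbb P^2\to\mathbb N$ is the function $\beta(p)=\prod_{i:\,p\in T_i}b_i$ (so $\beta=1$ off the lines with $b_i>1$, and at a node $p=T_i\cap T_j$ one has $\beta(p)=b_ib_j$); terms with $b_i=1$ are omitted from the notation. Say that $(\mathbb P^2,\beta)$ is \emph{uniformized} by a connected complex surface $M$ if there are a properly discontinuous group $G\subset\mathrm{Aut}(M)$ of holomorphic automorphisms of $M$ and a map $\varphi:M\to\mathbb P^2$ that identifies $\mathbb P^2$ with the quotient $M/G$ as complex analytic spaces, such that $\beta(\varphi(q))=|G_q|$ for every $q\in M$, where $G_q$ is the isotropy group of $q$ in $G$. A \emph{K3 surface} is a compact connected complex manifold $M$ of dimension $2$ with trivial canonical bundle and $H^1(M,\mathcal O_M)=0$. Then each of the orbifolds \begin{align*} \mathcal E_1&=(\mathbb P^2,\ 6T_1+6T_2+6T_3+2T_4),\\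 \mathcal E_2&=(\mathbb P^2,\ 4T_1+4T_2+4T_3+4T_4),\\ \mathcal E_3&=(\mathbb P^2,\ 2T_1+2T_2+2T_3+2T_4+2T_5+2T_6) \end{align*} is uniformized by a K3 surface. -/

import Mathlib

open scoped Manifold ContDiff

namespace K3Uniformization

universe u

/-! ### The complex projective plane -/

/-- The complex projective plane: the set of lines through the origin of `ℂ³`. -/
abbrev ProjectivePlane : Type := Projectivization ℂ (Fin 3 → ℂ)

/-- The usual topology of the projective plane: the quotient topology from `ℂ³ ∖ {0}`. -/
noncomputable instance instTopologicalSpaceProjectivePlane : TopologicalSpace ProjectivePlane :=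
  TopologicalSpace.coinduced
    (fun v : {v : Fin 3 → ℂ // v ≠ 0} => Projectivization.mk ℂ v.1 v.2) inferInstance

open Classical in
/-- The pullback to `ℂ³` of a function on the projective plane (the value at `0` is irrelevant). -/
noncomputable def coneFun (f : ProjectivePlane → ℂ) (v : Fin 3 → ℂ) : ℂ :=
  if h : v ≠ 0 then f (Projectivization.mk ℂ v h) else 0

/-- The cone (without its vertex) in `ℂ³` over a subset of the projective plane. -/
def coneSet (U : Set ProjectivePlane) : Set (Fin 3 → ℂ) :=
  {v | ∃ h : v ≠ 0, Projectivization.mk ℂ v h ∈ U}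

/-- Holomorphic functions on an open subset `U` of the projective plane, for its standard complex
structure as the quotient of `ℂ³ ∖ {0}` by `ℂˣ`: those whose pullback to the cone over `U` is
holomorphic. -/
def HolomorphicOnPlane (f : ProjectivePlane → ℂ) (U : Set ProjectivePlane) : Prop :=
  DifferentiableOn ℂ (coneFun f) (coneSet U)

/-- `L` is a line of the projective plane: the zero locus of a nonzero linear form. -/
def IsLine (L : Set ProjectivePlane) : Prop :=
  ∃ a : Fin 3 → ℂ, a ≠ 0 ∧ L = {p | ∑ m, a m * p.rep m = 0}

/-- A family of lines in general position: the lines are distinct and no three of them meet. -/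
def InGeneralPosition {ι : Type*} (T : ι → Set ProjectivePlane) : Prop :=
  Function.Injective T ∧
    ∀ i j k, i ≠ j → i ≠ k → j ≠ k → T i ∩ T j ∩ T k = ∅

open Classical in
/-- The function `β : ℙ² → ℕ` of the orbifold `(ℙ², ∑ bᵢ Tᵢ)` for lines `Tᵢ` in general position.
Such an arrangement has only simple nodes, so `β` is `1` off the lines, `bᵢ` at the smooth points
of the arrangement that lie on `Tᵢ`, and `bᵢ * bⱼ` at the node `Tᵢ ∩ Tⱼ`. A line with
coefficient `1` does not contribute. -/
noncomputable def orbifoldWeight {ι : Type*} [Fintype ι] (T : ι → Set ProjectivePlane) (b : ι → ℕ)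
    (p : ProjectivePlane) : ℕ :=
  ∏ i, if p ∈ T i then b i else 1

/-! ### K3 surfaces -/

section Surface

variable (M : Type u) [TopologicalSpace M] [ChartedSpace (Fin 2 → ℂ) M]

/-- A holomorphic `2`-form on a complex surface, i.e. a holomorphic section of the canonical
bundle: in each chart `(z₁, z₂)` of the atlas it is `coeff e (z) dz₁ ∧ dz₂`, with the coefficient
holomorphic, and the coefficients in two charts differ by the Jacobian determinant of the change
of coordinates. -/
structure HolomorphicTwoForm where
  coeff : OpenPartialHomeomorph M (Fin 2 → ℂ) → (Fin 2 → ℂ) → ℂ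
  holomorphic : ∀ e ∈ atlas (Fin 2 → ℂ) M, DifferentiableOn ℂ (coeff e) e.target
  change : ∀ e ∈ atlas (Fin 2 → ℂ) M, ∀ e' ∈ atlas (Fin 2 → ℂ) M, ∀ x ∈ e.source ∩ e'.source,
    coeff e (e x) = coeff e' (e' x) * (fderiv ℂ (fun z => e' (e.symm z)) (e x)).det

variable {M} in
/-- The form vanishes at no point. -/
def HolomorphicTwoForm.NowhereVanishing (w : HolomorphicTwoForm M) : Prop :=
  ∀ e ∈ atlas (Fin 2 → ℂ) M, ∀ z ∈ e.target, w.coeff e z ≠ 0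

/-- `H¹(M, 𝒪_M) = 0`, in Čech terms: each `1`-cocycle of holomorphic functions on an open cover
is a coboundary on that cover. (For every sheaf, `H¹` of the space is the union of the
Čech groups `H¹` of its open covers.) -/
def StructureSheafH1Vanishes : Prop :=
  ∀ (ι : Type u) (U : ι → Set M), (∀ i, IsOpen (U i)) → (⋃ i, U i) = Set.univ →
    ∀ f : ι → ι → M → ℂ,
      (∀ i j, MDifferentiableOn 𝓘(ℂ, Fin 2 → ℂ) 𝓘(ℂ, ℂ) (f i j) (U i ∩ U j)) →
      (∀ i j k, ∀ x ∈ U i ∩ U j ∩ U k, f i j x + f j k x = f i k x) →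
      ∃ g : ι → M → ℂ,
        (∀ i, MDifferentiableOn 𝓘(ℂ, Fin 2 → ℂ) 𝓘(ℂ, ℂ) (g i) (U i)) ∧
        ∀ i j, ∀ x ∈ U i ∩ U j, f i j x = g j x - g i x

/-- A K3 surface: a compact connected complex manifold of dimension two with trivial canonical
bundle and `H¹(M, 𝒪_M) = 0`. -/
structure IsK3Surface : Prop where
  t2 : T2Space M
  compact : CompactSpace M
  connected : ConnectedSpace M
  complexManifold : IsManifold 𝓘(ℂ, Fin 2 → ℂ) ω M
  canonical_trivial : ∃ w : HolomorphicTwoForm M, w.NowhereVanishing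
  irregularity_zero : StructureSheafH1Vanishes M

/-! ### Uniformizations -/

variable {M}

/-- `φ : M → ℙ²` is a uniformization of `(ℙ², β)` with group `G`: the group `G` acts faithfully
and properly discontinuously on the complex surface `M` by holomorphic automorphisms, `φ` identifies
the projective plane with the quotient `M/G` as a topological space and as an analytic space
(the holomorphic functions on an open set of `ℙ²` correspond to the `G`-invariant holomorphic
functions on its preimage), and `β (φ q)` is the order of the isotropy group of `q`. -/
structure IsUniformization (G : Type*) [Group G] [MulAction G M]
    (φ : M → ProjectivePlane) (β : ProjectivePlane → ℕ) : Prop where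
  faithful : FaithfulSMul G M
  properlyDiscontinuous : ProperlyDiscontinuousSMul G M
  holomorphic_smul : ∀ g : G,
    MDifferentiable 𝓘(ℂ, Fin 2 → ℂ) 𝓘(ℂ, Fin 2 → ℂ) (fun x : M => g • x)
  quotientMap : Topology.IsQuotientMap φ
  fiber_eq_orbit : ∀ x y : M, φ x = φ y ↔ x ∈ MulAction.orbit G y
  holomorphic_iff : ∀ (U : Set ProjectivePlane), IsOpen U → ∀ f : ProjectivePlane → ℂ,
    HolomorphicOnPlane f U ↔
      MDifferentiableOn 𝓘(ℂ, Fin 2 → ℂ) 𝓘(ℂ, ℂ) (fun x => f (φ x)) (φ ⁻¹' U)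
  isotropy : ∀ q : M, β (φ q) = Nat.card (MulAction.stabilizer G q)

end Surface

/-- The orbifold `(ℙ², β)` is uniformized by a K3 surface. -/
def UniformizedByK3 (β : ProjectivePlane → ℕ) : Prop :=
  ∃ (M : Type) (_ : TopologicalSpace M) (_ : ChartedSpace (Fin 2 → ℂ) M)
    (G : Type) (_ : Group G) (_ : MulAction G M) (φ : M → ProjectivePlane),
    IsK3Surface M ∧ IsUniformization G φ β

end K3Uniformization

/-!
Let `N` be the largest of the weights `bᵢ` and `dᵢ = N / bᵢ`, and let `Lᵢ` be linear forms defining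
the lines. The points `(v, y)` with `v ∈ ℂ³ ∖ 0` and `yᵢ ^ bᵢ = Lᵢ v` form a cone over `ℂ³ ∖ 0`, on
which `c ∈ ℂˣ` acts by `(c ^ N • v, c ^ dᵢ * yᵢ)`. The quotient is a compact surface, whose
projection to the plane is the quotient by the group `∏ μ_{bᵢ}` of changes of the roots, and the
isotropy at a point is generated by the factors whose root vanishes there.

Two of the roots, normalized by a third one of weight `dₖ = 1`, are local coordinates. In these the
form `∑ ± vᵢ dvⱼ ∧ dvₖ / ∏ yᵢ ^ (bᵢ - 1)` is holomorphic without zeros; it is invariant under `ℂˣ`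
exactly when `∑ dᵢ (bᵢ - 1) = 3 N`, which is the numerical condition on the weights.

For the irregularity, a cocycle can be refined so that it is subordinate to the pullback of a cover
of the plane. On the cone a function is a sum `∑ hₛ(v) yˢ` over the characters of the group of
changes of the roots, so the coefficients `hₛ` form homogeneous cocycles on `ℂ³ ∖ 0`. Such a cocycle
has a primitive of the same degree: a partition of unity gives a smooth one, whose `∂̄` is a global
`(0, 1)`-form, and the Cauchy transform along a line turns it into a primitive that is holomorphic
off a linear subspace of codimension two, across which it extends by Hartogs.
-/

namespace K3Uniformization

open Set Metric Filter Topology MeasureTheory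

local notation "ℂ²" => (Fin 2 → ℂ)
local notation "ℂ³" => (Fin 3 → ℂ)

/-! ### Removable singularities in several complex variables -/

section SeveralComplexVariables

variable {E : Type*} [NormedAddCommGroup E] [NormedSpace ℂ E] {U : Set E} {f : E → ℂ}

theorem norm_fderiv_le_of_norm_le_on_ball {p : E} {r C : ℝ} (hr : 0 < r)
    (hf : DifferentiableOn ℂ f (ball p r)) (hC : ∀ v ∈ ball p r, ‖f v‖ ≤ C) :
    ‖fderiv ℂ f p‖ ≤ 2 * C / r := by
  refine Complex.norm_fderiv_le_div_of_mapsTo_ball hf (fun v hv => ?_) hr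
  rw [mem_closedBall, dist_eq_norm]
  calc ‖f v - f p‖ ≤ ‖f v‖ + ‖f p‖ := norm_sub_le _ _
    _ ≤ C + C := add_le_add (hC v hv) (hC p (mem_ball_self hr))
    _ = 2 * C := by ring

theorem tendsto_add_smul_nhdsNE (q e : E) :
    Tendsto (fun t : ℂ => q + t • e) (𝓝[≠] 0) (𝓝 q) := by
  have : ContinuousAt (fun t : ℂ => q + t • e) 0 := by fun_prop
  simpa using this.tendsto.mono_left (nhdsWithin_le_nhds (s := {0}ᶜ))

theorem eq_of_eventuallyEq_line {g : E → ℂ} {q e : E} (hf : ContinuousAt f q)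
    (hg : ContinuousAt g q) (h : ∀ᶠ t : ℂ in 𝓝[≠] 0, f (q + t • e) = g (q + t • e)) :
    f q = g q :=
  tendsto_nhds_unique_of_eventuallyEq (hf.tendsto.comp (tendsto_add_smul_nhdsNE q e))
    (hg.tendsto.comp (tendsto_add_smul_nhdsNE q e)) h

theorem exists_uniform_disc (hU : IsOpen U) {p : E} (hp : p ∈ U) (e : E) :
    ∃ r > 0, ∃ δ > 0, ∀ v ∈ ball p δ, ∀ τ ∈ closedBall (0 : ℂ) r, v + τ • e ∈ U := by
  have hmem : ∀ᶠ x : ℂ × E in 𝓝 (0, p), x.2 + x.1 • e ∈ U :=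
    (by fun_prop : Continuous fun x : ℂ × E => x.2 + x.1 • e).continuousAt.eventually_mem
      (by simpa using hU.mem_nhds hp)
  obtain ⟨s, hs, t, ht, hst⟩ := mem_nhds_prod_iff.1 hmem
  obtain ⟨r, hr, hrs⟩ := nhds_basis_closedBall.mem_iff.1 hs
  obtain ⟨δ, hδ, hδt⟩ := Metric.mem_nhds_iff.1 ht
  exact ⟨r, hr, δ, hδ, fun v hv τ hτ => hst (mk_mem_prod (hrs hτ) (hδt hv))⟩

theorem exists_apply_eq_one {l : E →L[ℂ] ℂ} (hl : l ≠ 0) : ∃ e, l e = 1 := by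
  obtain ⟨x, hx⟩ := DFunLike.ne_iff.1 hl
  exact ⟨(l x)⁻¹ • x, by simpa using inv_mul_cancel₀ hx⟩

theorem exists_differentiableOn_extension {S : Set E} (hU : IsOpen U) (hS : IsClosed S)
    (hthin : ∀ q ∈ S, ∃ e : E, ∀ᶠ t : ℂ in 𝓝[≠] 0, q + t • e ∉ S)
    (hf : ∀ v ∈ U, v ∉ S → DifferentiableAt ℂ f v)
    (hloc : ∀ p ∈ U ∩ S, ∃ F : E → ℂ, ∃ W ∈ 𝓝 p, DifferentiableOn ℂ F W ∧
      ∀ v ∈ W, v ∉ S → F v = f v) :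
    ∃ F : E → ℂ, DifferentiableOn ℂ F U ∧ ∀ v ∈ U, v ∉ S → F v = f v := by
  classical
  choose! F W hW hF hFf using hloc
  have hFd : ∀ p ∈ U ∩ S, ∀ q, W p ∈ 𝓝 q → DifferentiableAt ℂ (F p) q := fun p hp q hq =>
    (hF p hp).differentiableAt hq
  have agree : ∀ p ∈ U ∩ S, ∀ q ∈ U ∩ S, W p ∈ 𝓝 q → F q q = F p q := by
    intro p hp q hq hqp
    obtain ⟨e, he⟩ := hthin q hq.2
    refine eq_of_eventuallyEq_line (e := e) (hFd q hq q (hW q hq)).continuousAt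
      (hFd p hp q hqp).continuousAt ?_
    filter_upwards [he, tendsto_add_smul_nhdsNE q e (hW q hq), tendsto_add_smul_nhdsNE q e hqp]
      with t hS hq' hp'
    rw [hFf q hq _ hq' hS, hFf p hp _ hp' hS]
  refine ⟨fun v => if v ∈ S then F v v else f v, fun p hp => ?_, fun v _ hv => if_neg hv⟩
  by_cases hpS : p ∈ S
  · refine ((hFd p ⟨hp, hpS⟩ p (hW p ⟨hp, hpS⟩)).congr_of_eventuallyEq
      ?_).differentiableWithinAt
    filter_upwards [hU.mem_nhds hp, eventually_mem_nhds_iff.2 (hW p ⟨hp, hpS⟩)] with q hqU hqW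
    split_ifs with hqS
    · exact agree p ⟨hp, hpS⟩ q ⟨hqU, hqS⟩ hqW
    · exact (hFf p ⟨hp, hpS⟩ q (mem_of_mem_nhds hqW) hqS).symm
  · refine ((hf p hp hpS).congr_of_eventuallyEq ?_).differentiableWithinAt
    filter_upwards [hS.isOpen_compl.mem_nhds hpS] with v hv
    exact if_neg hv

/-- The Cauchy mean value of `f` along the circle of radius `r` about `v` in the complex line
through `v` with direction `e`. A function of `v`, it is holomorphic as soon as `f` is holomorphic
along these circles, and so provides the extension of `f` across thin sets inside them. -/
noncomputable def circleMean (f : E → ℂ) (r : ℝ) (e v : E) : ℂ :=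
  ∮ τ in C(0, r), (2 * Real.pi * Complex.I)⁻¹ * τ⁻¹ * f (v + τ • e)

theorem circleMean_eq {r : ℝ} (hr : 0 < r) {e v : E} {k : ℂ → ℂ} {s : Set ℂ}
    (hs : s.Countable) (hk : ContinuousOn k (closedBall 0 r))
    (hd : ∀ τ ∈ ball (0 : ℂ) r \ s, DifferentiableAt ℂ k τ)
    (hkf : ∀ τ ∈ sphere (0 : ℂ) r, f (v + τ • e) = k τ) : circleMean f r e v = k 0 := by
  have cauchy := Complex.circleIntegral_sub_inv_smul_of_differentiable_on_off_countable hs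
    (mem_ball_self hr) hk hd
  rw [smul_eq_mul, ← inv_mul_eq_iff_eq_mul₀ Complex.two_pi_I_ne_zero,
    ← circleIntegral.integral_const_mul] at cauchy
  rw [← cauchy]
  refine circleIntegral.integral_congr hr.le fun τ hτ => ?_
  simp [hkf τ hτ, mul_assoc]

theorem circleMean_div_eq {H : E → ℂ} {l : E →L[ℂ] ℂ} {e v : E} {r : ℝ} (he : l e = 1)
    (hlv : l v ≠ 0) (hlr : ‖l v‖ < r)
    (hd : ∀ τ ∈ closedBall (0 : ℂ) r, DifferentiableAt ℂ H (v + τ • e))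
    (hzero : H (v - l v • e) = 0) :
    circleMean (fun v => H v / l v) r e v = H v / l v := by
  have hr : 0 < r := (norm_nonneg _).trans_lt hlr
  have hh : ∀ τ ∈ closedBall (0 : ℂ) r, DifferentiableAt ℂ (fun τ : ℂ => H (v + τ • e)) τ :=
    fun τ hτ => DifferentiableAt.comp (f := fun τ : ℂ => v + τ • e) τ (hd τ hτ) (by fun_prop)
  have hball : ball (0 : ℂ) r ∈ 𝓝 (-l v) := isOpen_ball.mem_nhds (by simpa using hlr)
  have hslope : ∀ τ : ℂ, τ ≠ -l v →
      dslope (fun τ : ℂ => H (v + τ • e)) (-l v) τ = H (v + τ • e) / l (v + τ • e) := by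
    intro τ hτ
    rw [dslope_of_ne _ hτ, slope_def_field, neg_smul, ← sub_eq_add_neg, hzero]
    simp [he, add_comm]
  have hslope_diff : DifferentiableOn ℂ (dslope (fun τ : ℂ => H (v + τ • e)) (-l v)) (ball 0 r) :=
    (Complex.differentiableOn_dslope hball).2 fun τ hτ =>
      (hh τ (ball_subset_closedBall hτ)).differentiableWithinAt
  rw [circleMean_eq hr (k := dslope (fun τ : ℂ => H (v + τ • e)) (-l v)) countable_empty
    ?_ ?_ ?_, hslope 0 (by simpa using hlv)]
  · simp
  · exact (continuousOn_dslope (mem_of_superset hball ball_subset_closedBall)).2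
      ⟨fun τ hτ => (hh τ hτ).continuousAt.continuousWithinAt,
        hh _ (ball_subset_closedBall (mem_of_mem_nhds hball))⟩
  · exact fun τ hτ => hslope_diff.differentiableAt (isOpen_ball.mem_nhds hτ.1)
  · rintro τ hτ
    refine (hslope τ ?_).symm
    rintro rfl
    rw [mem_sphere_zero_iff_norm, norm_neg] at hτ
    exact hlr.ne hτ

theorem continuousOn_inv_sphere {r : ℝ} (hr : 0 < r) :
    ContinuousOn (fun τ : ℂ => τ⁻¹) (sphere 0 r) :=
  continuousOn_id.inv₀ fun _ hτ => ne_of_mem_sphere hτ hr.ne'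

variable [FiniteDimensional ℂ E]

theorem exists_norm_fderiv_le_near_isCompact (hU : IsOpen U) (hf : DifferentiableOn ℂ f U)
    {K : Set E} (hK : IsCompact K) (hKU : K ⊆ U) :
    ∃ δ > 0, ∃ C, ∀ x ∈ K, ∀ y ∈ ball x δ, DifferentiableAt ℂ f y ∧ ‖fderiv ℂ f y‖ ≤ C := by
  have : ProperSpace E := FiniteDimensional.proper ℂ E
  obtain ⟨δ, hδ, hδU⟩ := hK.exists_cthickening_subset_open hU hKU
  obtain ⟨C, hC⟩ := hK.cthickening.exists_bound_of_continuousOn (hf.continuousOn.mono hδU)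
  have hball : ∀ x ∈ K, ∀ y ∈ ball x (δ / 2), ball y (δ / 2) ⊆ cthickening δ K :=
    fun x hx y hy => (ball_subset_ball' (by linarith [mem_ball.1 hy])).trans
      ((ball_subset_thickening hx δ).trans (thickening_subset_cthickening δ K))
  refine ⟨δ / 2, half_pos hδ, 2 * C / (δ / 2), fun x hx y hy => ⟨?_, ?_⟩⟩
  · exact hf.differentiableAt (hU.mem_nhds (hδU (hball x hx y hy (mem_ball_self (half_pos hδ)))))
  · exact norm_fderiv_le_of_norm_le_on_ball (half_pos hδ)
      (hf.mono ((hball x hx y hy).trans hδU)) fun z hz => hC z (hball x hx y hy hz)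

theorem differentiableAt_circleIntegral_translate (hU : IsOpen U) (hf : DifferentiableOn ℂ f U)
    {w : ℂ → ℂ} {r : ℝ} (hr : 0 ≤ r) (hw : ContinuousOn w (sphere 0 r)) {p e : E}
    (hp : ∀ τ ∈ sphere (0 : ℂ) r, p + τ • e ∈ U) :
    DifferentiableAt ℂ (fun v => ∮ τ in C(0, r), w τ * f (v + τ • e)) p := by
  borelize E
  have : ProperSpace E := FiniteDimensional.proper ℂ E
  have hsph (θ : ℝ) : circleMap 0 r θ ∈ sphere (0 : ℂ) r := circleMap_mem_sphere _ hr θ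
  obtain ⟨δ, hδ, C, hC⟩ := exists_norm_fderiv_le_near_isCompact hU hf
    ((isCompact_sphere (0 : ℂ) r).image (by fun_prop : Continuous fun τ : ℂ => p + τ • e))
    (image_subset_iff.2 hp)
  have hnear : ∀ v ∈ ball p δ, ∀ θ : ℝ, DifferentiableAt ℂ f (v + circleMap 0 r θ • e) ∧
      ‖fderiv ℂ f (v + circleMap 0 r θ • e)‖ ≤ C := fun v hv θ =>
    hC _ (mem_image_of_mem _ (hsph θ)) _ (by simpa using hv)
  set c : ℝ → ℂ := fun θ => deriv (circleMap 0 r) θ * w (circleMap 0 r θ)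
  have hderiv : Continuous fun θ => deriv (circleMap 0 r) θ := by
    simp only [deriv_circleMap]
    fun_prop
  have hc : Continuous c := hderiv.mul (hw.comp_continuous (continuous_circleMap 0 r) hsph)
  obtain ⟨B, hB⟩ : ∃ B, ∀ θ, ‖c θ‖ ≤ B := by
    obtain ⟨B, hB⟩ := (isCompact_sphere (0 : ℂ) r).exists_bound_of_continuousOn hw
    exact ⟨r * B, fun θ => by simpa [c, abs_of_nonneg hr] using
      mul_le_mul_of_nonneg_left (hB _ (hsph θ)) hr⟩
  have hcont : ∀ v ∈ ball p δ, Continuous fun θ => c θ * f (v + circleMap 0 r θ • e) :=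
    fun v hv => hc.mul <| continuous_iff_continuousAt.2 fun θ =>
      ContinuousAt.comp (f := fun θ : ℝ => v + circleMap 0 r θ • e)
        (hnear v hv θ).1.continuousAt (by fun_prop)
  simp only [circleIntegral, smul_eq_mul, ← mul_assoc]
  refine (intervalIntegral.hasFDerivAt_integral_of_dominated_of_fderiv_le (𝕜 := ℂ)
    (F' := fun v θ => c θ • fderiv ℂ f (v + circleMap 0 r θ • e)) (bound := fun _ => B * C)
    (ball_mem_nhds p hδ) ?_ ((hcont p (mem_ball_self hδ)).intervalIntegrable _ _) ?_ ?_
    intervalIntegrable_const ?_).differentiableAt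
  · filter_upwards [ball_mem_nhds p hδ] with v hv using (hcont v hv).aestronglyMeasurable
  · exact hc.aestronglyMeasurable.smul ((measurable_fderiv ℂ f).comp
      (by fun_prop : Measurable fun θ : ℝ => p + circleMap 0 r θ • e)).aestronglyMeasurable
  · refine Eventually.of_forall fun θ _ v hv => ?_
    rw [norm_smul]
    exact mul_le_mul (hB θ) (hnear v hv θ).2 (norm_nonneg _) ((norm_nonneg _).trans (hB θ))
  · exact Eventually.of_forall fun θ _ v hv =>
      ((hasFDerivAt_comp_add_right _).2 (hnear v hv θ).1.hasFDerivAt).const_mul (c θ)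

theorem differentiableOn_fderiv_apply (hU : IsOpen U) (hf : DifferentiableOn ℂ f U) (e : E) :
    DifferentiableOn ℂ (fun v => fderiv ℂ f v e) U := by
  intro p hp
  obtain ⟨r, hr, δ, hδ, hmem⟩ := exists_uniform_disc hU hp e
  have key : DifferentiableAt ℂ
      (fun v => ∮ τ in C(0, r), (2 * Real.pi * Complex.I)⁻¹ * τ⁻¹ ^ 2 * f (v + τ • e)) p :=
    differentiableAt_circleIntegral_translate hU hf hr.le
      (continuousOn_const.mul ((continuousOn_inv_sphere hr).pow 2))
      fun τ hτ => hmem p (mem_ball_self hδ) τ (sphere_subset_closedBall hτ)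
  refine (key.congr_of_eventuallyEq ?_).differentiableWithinAt
  filter_upwards [ball_mem_nhds p hδ] with v hv
  have hfd : ∀ τ ∈ closedBall (0 : ℂ) r, DifferentiableAt ℂ f (v + τ • e) := fun τ hτ =>
    hf.differentiableAt (hU.mem_nhds (hmem v hv τ hτ))
  have hline : DifferentiableOn ℂ (fun τ : ℂ => f (v + τ • e)) (closedBall 0 r) := fun τ hτ =>
    ((hfd τ hτ).comp τ
      (by fun_prop : DifferentiableAt ℂ (fun τ : ℂ => v + τ • e) τ)).differentiableWithinAt
  have hder : deriv (fun τ : ℂ => f (v + τ • e)) 0 = fderiv ℂ f v e := by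
    have hfv : DifferentiableAt ℂ f v := by simpa using hfd 0 (mem_closedBall_self hr.le)
    exact hfv.lineDeriv_eq_fderiv
  have cauchy := DifferentiableOn.deriv_eq_smul_circleIntegral hr hline
  rw [hder, smul_eq_mul, ← inv_mul_eq_iff_eq_mul₀ Complex.two_pi_I_ne_zero] at cauchy
  rw [← cauchy, ← circleIntegral.integral_const_mul]
  congr 1; ext τ; simp [mul_assoc]

theorem contDiffOn_of_differentiableOn (hU : IsOpen U) (hf : DifferentiableOn ℂ f U) (n : ℕ) :
    ContDiffOn ℂ n f U := by
  induction n generalizing f with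
  | zero => exact contDiffOn_zero.2 hf.continuousOn
  | succ n ih =>
    push_cast
    rw [contDiffOn_succ_iff_fderiv_of_isOpen hU]
    exact ⟨hf, by simp, contDiffOn_clm_apply.2 fun e => ih (differentiableOn_fderiv_apply hU hf e)⟩

theorem differentiableAt_circleMean (hU : IsOpen U) (hf : DifferentiableOn ℂ f U) {r : ℝ}
    (hr : 0 < r) {p e : E} (hp : ∀ τ ∈ sphere (0 : ℂ) r, p + τ • e ∈ U) :
    DifferentiableAt ℂ (circleMean f r e) p :=
  differentiableAt_circleIntegral_translate hU hf hr.le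
    (continuousOn_const.mul (continuousOn_inv_sphere hr)) hp

theorem exists_differentiableOn_circleMean (hU : IsOpen U) {l : E →L[ℂ] ℂ} {e p : E}
    (he : l e = 1) (hf : ∀ v ∈ U, l v ≠ 0 → DifferentiableAt ℂ f v) (hpU : p ∈ U) (hp : l p = 0) :
    ∃ r > 0, ∃ W, IsOpen W ∧ p ∈ W ∧ (∀ v ∈ W, ‖l v‖ < r) ∧
      (∀ v ∈ W, ∀ τ ∈ closedBall (0 : ℂ) r, v + τ • e ∈ U) ∧
      DifferentiableOn ℂ (circleMean f r e) W := by
  obtain ⟨r, hr, δ, hδ, hmem⟩ := exists_uniform_disc hU hpU e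
  have hV : IsOpen (U ∩ {v | l v ≠ 0}) := hU.inter (isOpen_ne_fun l.continuous continuous_const)
  refine ⟨r, hr, ball p δ ∩ {v | ‖l v‖ < r},
    isOpen_ball.inter (isOpen_lt l.continuous.norm continuous_const),
    ⟨mem_ball_self hδ, by simpa [hp] using hr⟩, fun v hv => hv.2, fun v hv => hmem v hv.1, ?_⟩
  rintro v ⟨hv, hlv⟩
  refine (differentiableAt_circleMean hV
    (fun w hw => (hf w hw.1 hw.2).differentiableWithinAt) hr fun τ hτ =>
      ⟨hmem v hv τ (sphere_subset_closedBall hτ), fun hzero => ?_⟩).differentiableWithinAt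
  have hτl : τ = -l v := eq_neg_of_add_eq_zero_right (by simpa [he] using hzero)
  rw [mem_sphere_zero_iff_norm, hτl, norm_neg] at hτ
  exact (mem_ofPred_eq ▸ hlv).ne hτ

theorem differentiableOn_of_continuousOn_off_hyperplane (hU : IsOpen U) {l : E →L[ℂ] ℂ}
    (hl : l ≠ 0) (hc : ContinuousOn f U) (hd : ∀ v ∈ U, l v ≠ 0 → DifferentiableAt ℂ f v) :
    DifferentiableOn ℂ f U := by
  intro p hp
  by_cases hlp : l p = 0
  swap
  · exact (hd p hp hlp).differentiableWithinAt
  obtain ⟨e, he⟩ := exists_apply_eq_one hl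
  obtain ⟨r, hr, W, hW, hpW, -, hWU, hmean⟩ := exists_differentiableOn_circleMean hU he hd hp hlp
  refine ((hmean.differentiableAt (hW.mem_nhds hpW)).congr_of_eventuallyEq
    ?_).differentiableWithinAt
  filter_upwards [hW.mem_nhds hpW] with v hv
  rw [circleMean_eq hr (k := fun τ => f (v + τ • e)) (countable_singleton (-l v)) ?_ ?_
    fun _ _ => rfl]
  · simp
  · exact hc.comp (by fun_prop) fun τ hτ => hWU v hv τ hτ
  · rintro τ ⟨hτ, hτl⟩
    refine DifferentiableAt.comp (f := fun τ : ℂ => v + τ • e) τ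
      (hd _ (hWU v hv τ (ball_subset_closedBall hτ)) fun hzero => hτl ?_) (by fun_prop)
    exact eq_neg_of_add_eq_zero_right (by simpa [he] using hzero)

theorem differentiableOn_of_continuousOn_off_hyperplanes {ι : Type*} (hU : IsOpen U)
    (L : ι → E →L[ℂ] ℂ) (s : Finset ι) (hL : ∀ i ∈ s, L i ≠ 0) (hc : ContinuousOn f U)
    (hd : ∀ v ∈ U, (∀ i ∈ s, L i v ≠ 0) → DifferentiableAt ℂ f v) : DifferentiableOn ℂ f U := by
  classical
  induction s using Finset.induction_on generalizing U with
  | empty => exact fun v hv => (hd v hv (by simp)).differentiableWithinAt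
  | insert i s _ ih =>
    rw [Finset.forall_mem_insert] at hL
    refine differentiableOn_of_continuousOn_off_hyperplane hU hL.1 hc fun v hv hiv => ?_
    have hV : IsOpen (U ∩ {v | L i v ≠ 0}) :=
      hU.inter (isOpen_ne_fun (L i).continuous continuous_const)
    refine (ih hV hL.2 (hc.mono inter_subset_left) fun w hw hs => hd w hw.1 ?_).differentiableAt
      (hV.mem_nhds ⟨hv, hiv⟩)
    exact Finset.forall_mem_insert _ _ _ |>.2 ⟨hw.2, hs⟩

theorem exists_extension_of_codim_two (hU : IsOpen U) {l l' : E →L[ℂ] ℂ} {e e' : E}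
    (he : l e = 1) (hl'e : l' e = 0) (hl'e' : l' e' = 1)
    (hf : ∀ v ∈ U, ¬ (l v = 0 ∧ l' v = 0) → DifferentiableAt ℂ f v) :
    ∃ F : E → ℂ, DifferentiableOn ℂ F U ∧ ∀ v ∈ U, ¬ (l v = 0 ∧ l' v = 0) → F v = f v := by
  refine exists_differentiableOn_extension (S := {v | l v = 0 ∧ l' v = 0}) hU
    ((isClosed_eq l.continuous continuous_const).inter
      (isClosed_eq l'.continuous continuous_const)) (fun q hq => ⟨e', ?_⟩) hf ?_
  · filter_upwards [self_mem_nhdsWithin] with t ht hmem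
    exact ht (by simpa [hq.2, hl'e'] using hmem.2)
  rintro p ⟨hpU, hlp, -⟩
  obtain ⟨r, hr, W, hW, hpW, -, hWU, hmean⟩ := exists_differentiableOn_circleMean hU he
    (fun v hv hlv => hf v hv fun h => hlv h.1) hpU hlp
  have heq : ∀ v ∈ W, l' v ≠ 0 → circleMean f r e v = f v := by
    intro v hv hl'v
    have hd : ∀ τ ∈ closedBall (0 : ℂ) r, DifferentiableAt ℂ (fun τ : ℂ => f (v + τ • e)) τ :=
      fun τ hτ => DifferentiableAt.comp (f := fun τ : ℂ => v + τ • e) τ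
        (hf _ (hWU v hv τ hτ) (by simp [hl'e, hl'v])) (by fun_prop)
    rw [circleMean_eq hr (k := fun τ => f (v + τ • e)) countable_empty
      (fun τ hτ => (hd τ hτ).continuousAt.continuousWithinAt)
      (fun τ hτ => hd τ (ball_subset_closedBall hτ.1)) fun _ _ => rfl]
    simp
  refine ⟨circleMean f r e, W, hW.mem_nhds hpW, hmean, fun v hv hvS => ?_⟩
  by_cases hl'v : l' v = 0
  · have hvU : v ∈ U := by simpa using hWU v hv 0 (mem_closedBall_self hr.le)
    refine eq_of_eventuallyEq_line (e := e')
      (hmean.differentiableAt (hW.mem_nhds hv)).continuousAt (hf v hvU hvS).continuousAt ?_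
    filter_upwards [tendsto_add_smul_nhdsNE v e' (hW.mem_nhds hv), self_mem_nhdsWithin]
      with t htW ht
    exact heq _ htW (by simpa [hl'v, hl'e'] using ht)
  · exact heq v hv hl'v

theorem exists_eq_mul_of_vanishing {H : E → ℂ} (hU : IsOpen U) (hH : DifferentiableOn ℂ H U)
    {l : E →L[ℂ] ℂ} (hl : l ≠ 0) (h0 : ∀ v ∈ U, l v = 0 → H v = 0) :
    ∃ K : E → ℂ, DifferentiableOn ℂ K U ∧ ∀ v ∈ U, H v = l v * K v := by
  obtain ⟨e, he⟩ := exists_apply_eq_one hl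
  have hHd : ∀ v ∈ U, DifferentiableAt ℂ H v := fun v hv => hH.differentiableAt (hU.mem_nhds hv)
  have hquot : ∀ v ∈ U, l v ≠ 0 → DifferentiableAt ℂ (fun v => H v / l v) v := fun v hv hlv => by
    simpa only [div_eq_mul_inv] using (hHd v hv).fun_mul (l.differentiableAt.fun_inv hlv)
  obtain ⟨K, hK, hKH⟩ : ∃ K : E → ℂ, DifferentiableOn ℂ K U ∧
      ∀ v ∈ U, v ∉ {v | l v = 0} → K v = H v / l v := by
    refine exists_differentiableOn_extension hU (isClosed_eq l.continuous continuous_const)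
      (fun q hq => ⟨e, ?_⟩) hquot ?_
    · filter_upwards [self_mem_nhdsWithin] with t ht hmem
      exact ht (by simpa [mem_ofPred_eq ▸ hq, he] using hmem)
    rintro p ⟨hpU, hlp⟩
    obtain ⟨r, -, W, hW, hpW, hlW, hWU, hmean⟩ :=
      exists_differentiableOn_circleMean hU he hquot hpU hlp
    refine ⟨_, W, hW.mem_nhds hpW, hmean, fun v hv hlv =>
      circleMean_div_eq he hlv (hlW v hv) (fun τ hτ => hHd _ (hWU v hv τ hτ)) ?_⟩
    rw [sub_eq_add_neg, ← neg_smul]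
    exact h0 _ (hWU v hv _ (by simpa using (hlW v hv).le)) (by simp [he])
  refine ⟨K, hK, fun v hv => ?_⟩
  by_cases hlv : l v = 0
  · simp [hlv, h0 v hv hlv]
  · rw [hKH v hv hlv, mul_div_cancel₀ _ hlv]

theorem exists_eq_prod_mul_of_vanishing {ι : Type*} (hU : IsOpen U) (L : ι → E →L[ℂ] ℂ)
    (s : Finset ι) (hL : ∀ i ∈ s, ∀ j ∈ s, i ≠ j → ∃ e, L j e = 0 ∧ L i e ≠ 0)
    (hL0 : ∀ i ∈ s, L i ≠ 0) {H : E → ℂ} (hH : DifferentiableOn ℂ H U)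
    (h0 : ∀ i ∈ s, ∀ v ∈ U, L i v = 0 → H v = 0) :
    ∃ K : E → ℂ, DifferentiableOn ℂ K U ∧ ∀ v ∈ U, H v = (∏ i ∈ s, L i v) * K v := by
  classical
  induction s using Finset.induction_on generalizing H with
  | empty => exact ⟨H, hH, by simp⟩
  | insert i s his ih =>
    rw [Finset.forall_mem_insert] at hL0 h0
    obtain ⟨K, hK, hHK⟩ := exists_eq_mul_of_vanishing hU hH hL0.1 h0.1
    have hK_off : ∀ j ∈ s, ∀ v ∈ U, L j v = 0 → L i v ≠ 0 → K v = 0 := by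
      intro j hj v hv hjv hiv
      have hprod : L i v * K v = 0 := (hHK v hv).symm.trans (h0.2 j hj v hv hjv)
      exact (mul_eq_zero.1 hprod).resolve_left hiv
    have hK0 : ∀ j ∈ s, ∀ v ∈ U, L j v = 0 → K v = 0 := by
      intro j hj v hv hjv
      by_cases hiv : L i v = 0
      swap
      · exact hK_off j hj v hv hjv hiv
      obtain ⟨e, hje, hie⟩ := hL i (Finset.mem_insert_self i s) j (Finset.mem_insert_of_mem hj)
        (by rintro rfl; exact his hj)
      refine eq_of_eventuallyEq_line (g := fun _ => 0) (e := e)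
        (hK.differentiableAt (hU.mem_nhds hv)).continuousAt continuousAt_const ?_
      filter_upwards [tendsto_add_smul_nhdsNE v e (hU.mem_nhds hv), self_mem_nhdsWithin]
        with t htU ht
      exact hK_off j hj _ htU (by simp [hjv, hje]) (by simpa [hiv, hie] using ht)
    obtain ⟨K', hK', hKK'⟩ := ih
      (fun j hj k hk => hL j (Finset.mem_insert_of_mem hj) k (Finset.mem_insert_of_mem hk))
      hL0.2 hK hK0
    refine ⟨K', hK', fun v hv => ?_⟩
    rw [hHK v hv, hKK' v hv, Finset.prod_insert his, mul_assoc]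

end SeveralComplexVariables

/-! ### The Cauchy transform along a complex line -/

section PompeiuFormula

open Complex (I exp)
open scoped Real

section Dbar

variable {E : Type*} [NormedAddCommGroup E] [NormedSpace ℂ E] [NormedSpace ℝ E]
  {f g : E → ℂ} {v : E}

/-- The antiholomorphic derivative of `f` at `v` in the direction `e`, normalized as `2 ∂f/∂ē`:
the form `∂̄f` is represented by the function `dbar f v`, which is conjugate-linear in `e`. -/
noncomputable def dbar (f : E → ℂ) (v e : E) : ℂ :=
  fderiv ℝ f v e + I * fderiv ℝ f v (I • e)

theorem dbar_congr (h : f =ᶠ[𝓝 v] g) (e : E) : dbar f v e = dbar g v e := by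
  rw [dbar, dbar, h.fderiv_eq]

theorem dbar_sub (hf : DifferentiableAt ℝ f v) (hg : DifferentiableAt ℝ g v) (e : E) :
    dbar (fun v => f v - g v) v e = dbar f v e - dbar g v e := by
  simp only [dbar, fderiv_fun_sub hf hg, sub_apply]
  ring

theorem contDiffAt_dbar (hf : ContDiffAt ℝ 2 f v) (e : E) :
    ContDiffAt ℝ 1 (fun v => dbar f v e) v := by
  have h : ContDiffAt ℝ 1 (fderiv ℝ f) v := hf.fderiv_right (by norm_num [one_add_one_eq_two])
  exact (h.clm_apply contDiffAt_const).add
    (contDiffAt_const.mul (h.clm_apply contDiffAt_const))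

theorem fderiv_dbar (hf : ContDiffAt ℝ 2 f v) (x y : E) :
    fderiv ℝ (fun v => dbar f v x) v y =
      fderiv ℝ (fderiv ℝ f) v y x + I * fderiv ℝ (fderiv ℝ f) v y (I • x) := by
  have hD : DifferentiableAt ℝ (fderiv ℝ f) v :=
    (hf.fderiv_right (m := 1) (by norm_num [one_add_one_eq_two])).differentiableAt one_ne_zero
  have happly : ∀ z : E,
      HasFDerivAt (fun v => fderiv ℝ f v z) ((fderiv ℝ (fderiv ℝ f) v).flip z) v := fun z =>
    (hD.hasFDerivAt.clm_apply (hasFDerivAt_const z v)).congr_fderiv (by ext; simp)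
  have hsum : HasFDerivAt (fun v => dbar f v x) _ v :=
    (happly x).add ((happly (I • x)).const_mul I)
  rw [hsum.fderiv]
  simp

theorem dbar_dbar_comm (hf : ContDiffAt ℝ 2 f v) (e e' : E) :
    dbar (fun v => dbar f v e) v e' = dbar (fun v => dbar f v e') v e := by
  have hsymm : IsSymmSndFDerivAt ℝ f v := hf.isSymmSndFDerivAt (by simp)
  rw [dbar, dbar, fderiv_dbar hf, fderiv_dbar hf, fderiv_dbar hf, fderiv_dbar hf, hsymm.eq e' e,
    hsymm.eq e' (I • e), hsymm.eq (I • e') e, hsymm.eq (I • e') (I • e)]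
  ring

variable [IsScalarTower ℝ ℂ E]

theorem fderiv_ofReal_smul (f : E → ℂ) (v x : E) (r : ℝ) :
    fderiv ℝ f v ((r : ℂ) • x) = r * fderiv ℝ f v x := by
  rw [← Complex.coe_algebraMap, algebraMap_smul, map_smul, Complex.real_smul,
    Complex.coe_algebraMap]

theorem dbar_eq_zero_of_differentiableAt (hf : DifferentiableAt ℂ f v) (e : E) :
    dbar f v e = 0 := by
  rw [dbar, (hf.hasFDerivAt.restrictScalars ℝ).fderiv]
  simp only [ContinuousLinearMap.coe_restrictScalars', map_smul, smul_eq_mul]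
  linear_combination (fderiv ℂ f v e) * Complex.I_sq

theorem differentiableAt_of_dbar_eq_zero (hf : DifferentiableAt ℝ f v)
    (h : ∀ e, dbar f v e = 0) : DifferentiableAt ℂ f v := by
  have hI : ∀ e, fderiv ℝ f v (I • e) = I * fderiv ℝ f v e := fun e => by
    have he : fderiv ℝ f v e + I * fderiv ℝ f v (I • e) = 0 := h e
    linear_combination (-I) * he + fderiv ℝ f v (I • e) * Complex.I_sq
  let D : E →L[ℂ] ℂ :=
    { toFun := fderiv ℝ f v
      map_add' := map_add _
      map_smul' := fun c e => by
        conv_lhs => rw [← Complex.re_add_im c, add_smul, mul_smul, map_add, fderiv_ofReal_smul,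
          fderiv_ofReal_smul, hI]
        rw [RingHom.id_apply, smul_eq_mul]
        linear_combination (fderiv ℝ f v e) * Complex.re_add_im c
      cont := (fderiv ℝ f v).continuous }
  exact (hasFDerivAt_of_restrictScalars ℝ (f' := D) hf.hasFDerivAt rfl).differentiableAt

theorem dbar_smul_right (f : E → ℂ) (v e : E) (c : ℂ) :
    dbar f v (c • e) = starRingEnd ℂ c * dbar f v e := by
  obtain ⟨a, b⟩ := c
  have hce : (⟨a, b⟩ : ℂ) • e = (a : ℂ) • e + (b : ℂ) • I • e := by
    rw [smul_smul, ← add_smul, Complex.mk_eq_add_mul_I]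
  have hIce : I • (⟨a, b⟩ : ℂ) • e = (a : ℂ) • I • e - (b : ℂ) • e := by
    rw [hce, smul_add, smul_comm I, smul_comm I (b : ℂ), smul_smul I I, Complex.I_mul_I,
      neg_one_smul, smul_neg, sub_eq_add_neg]
  rw [dbar, dbar, hIce, hce, map_add, map_sub, fderiv_ofReal_smul,
    fderiv_ofReal_smul, fderiv_ofReal_smul, fderiv_ofReal_smul, Complex.mk_eq_add_mul_I]
  simp only [map_add, map_mul, Complex.conj_ofReal, Complex.conj_I]
  linear_combination (b * fderiv ℝ f v (I • e)) * Complex.I_sq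

theorem dbar_of_homogeneous {μ c : ℂ} (hμ : μ ≠ 0) (hf : DifferentiableAt ℝ f (μ • v))
    (hfv : DifferentiableAt ℝ f v) (h : ∀ᶠ x in 𝓝 v, f (μ • x) = c * f x) (e : E) :
    dbar f (μ • v) e = c * (starRingEnd ℂ μ)⁻¹ * dbar f v e := by
  have hsmul : HasFDerivAt (fun x : E => μ • x) (μ • ContinuousLinearMap.id ℝ E) v :=
    (hasFDerivAt_id v).const_smul μ
  have hderiv := ((hf.hasFDerivAt.comp v hsmul).congr_of_eventuallyEq
    (h.mono fun x hx => hx.symm)).unique (hfv.hasFDerivAt.const_mul c)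
  have happly : ∀ x, fderiv ℝ f (μ • v) (μ • x) = c * fderiv ℝ f v x := fun x => by
    simpa using DFunLike.congr_fun hderiv x
  calc dbar f (μ • v) e = dbar f (μ • v) (μ • μ⁻¹ • e) := by rw [smul_inv_smul₀ hμ]
    _ = c * dbar f v (μ⁻¹ • e) := by
      rw [dbar, dbar, smul_comm I μ, happly, happly]
      ring
    _ = c * (starRingEnd ℂ μ)⁻¹ * dbar f v e := by rw [dbar_smul_right, map_inv₀, mul_assoc]

theorem dbar_comp_line (p e₀ : E) (ζ : ℂ) (hf : DifferentiableAt ℝ f (p + ζ • e₀)) :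
    dbar (fun ζ : ℂ => f (p + ζ • e₀)) ζ 1 = dbar f (p + ζ • e₀) e₀ := by
  have hline : HasFDerivAt (fun ζ : ℂ => p + ζ • e₀)
      ((ContinuousLinearMap.id ℝ ℂ).smulRight e₀) ζ :=
    ((hasFDerivAt_id ζ).smul_const e₀).const_add p
  have hcomp : HasFDerivAt (fun ζ : ℂ => f (p + ζ • e₀)) _ ζ := hf.hasFDerivAt.comp ζ hline
  rw [dbar, dbar, hcomp.fderiv]
  simp

end Dbar

theorem integral_fderiv_ray {F : Type*} [NormedAddCommGroup F] [NormedSpace ℝ F] {ψ : F → ℂ}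
    (hψ : ContDiff ℝ 1 ψ) (hs : HasCompactSupport ψ) {u : F} (hu : u ≠ 0) :
    ∫ r in Ioi (0 : ℝ), fderiv ℝ ψ (r • u) u = -ψ 0 := by
  have hderiv : deriv (fun r : ℝ => ψ (r • u)) = fun r => fderiv ℝ ψ (r • u) u := by
    ext r
    have hline : HasDerivAt (fun r : ℝ => r • u) u r := by
      simpa using (hasDerivAt_id r).smul_const u
    exact ((hψ.differentiable one_ne_zero _).hasFDerivAt.comp_hasDerivAt r hline).deriv
  have hsupp : HasCompactSupport fun r : ℝ => ψ (r • u) :=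
    hs.comp_isClosedEmbedding (isClosedEmbedding_smul_left hu)
  have hsmooth : ContDiff ℝ 1 fun r : ℝ => ψ (r • u) :=
    hψ.comp (contDiff_id.smul contDiff_const)
  simpa [hderiv] using hsupp.integral_Ioi_deriv_eq hsmooth 0

variable {ψ : ℂ → ℂ}

theorem continuous_fderiv_polar (hψ : ContDiff ℝ 1 ψ) (c : ℂ) :
    Continuous fun p : ℝ × ℝ => fderiv ℝ ψ (p.1 * exp (p.2 * I)) (c * exp (p.2 * I)) :=
  ((hψ.continuous_fderiv one_ne_zero).comp (by fun_prop)).clm_apply (by fun_prop)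

theorem integral_fderiv_circle (hψ : ContDiff ℝ 1 ψ) {r : ℝ} (hr : r ≠ 0) :
    ∫ θ in (-π)..π, fderiv ℝ ψ (r * exp (θ * I)) (I * exp (θ * I)) = 0 := by
  have hr' : (r : ℂ) ≠ 0 := by exact_mod_cast hr
  have hderiv : ∀ θ : ℝ, HasDerivAt (fun θ : ℝ => (r : ℂ)⁻¹ * ψ (r * exp (θ * I)))
      (fderiv ℝ ψ (r * exp (θ * I)) (I * exp (θ * I))) θ := fun θ => by
    have hcircle : HasDerivAt (fun θ : ℝ => (r : ℂ) * exp (θ * I)) (r • (I * exp (θ * I))) θ := by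
      refine (((hasDerivAt_id (θ : ℂ)).mul_const I).cexp.const_mul
        (r : ℂ)).comp_ofReal.congr_deriv ?_
      rw [id, Complex.real_smul, one_mul, mul_comm I]
    refine (((hψ.differentiable one_ne_zero _).hasFDerivAt.comp_hasDerivAt θ
      hcircle).const_mul (r : ℂ)⁻¹).congr_deriv ?_
    rw [map_smul, Complex.real_smul, inv_mul_cancel_left₀ hr']
  rw [intervalIntegral.integral_eq_sub_of_hasDerivAt (fun θ _ => hderiv θ)]
  · simp [Complex.exp_neg, Complex.exp_pi_mul_I]
  · exact ((continuous_fderiv_polar hψ I).comp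
      (by fun_prop : Continuous fun θ : ℝ => (r, θ))).intervalIntegrable _ _

theorem integrableOn_fderiv_polar (hψ : ContDiff ℝ 1 ψ) (hs : HasCompactSupport ψ) (c : ℂ) :
    IntegrableOn (fun p : ℝ × ℝ => fderiv ℝ ψ (p.1 * exp (p.2 * I)) (c * exp (p.2 * I)))
      (Ioi 0 ×ˢ Ioo (-π) π) := by
  obtain ⟨R, hR⟩ := (hs.fderiv (𝕜 := ℝ)).isCompact.isBounded.subset_closedBall 0
  have hcompact : IntegrableOn (fun p : ℝ × ℝ =>
      fderiv ℝ ψ (p.1 * exp (p.2 * I)) (c * exp (p.2 * I))) (Icc 0 R ×ˢ Icc (-π) π) :=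
    (continuous_fderiv_polar hψ c).continuousOn.integrableOn_compact
      (isCompact_Icc.prod isCompact_Icc)
  refine hcompact.of_forall_sdiff_eq_zero (measurableSet_Ioi.prod measurableSet_Ioo) ?_
  rintro ⟨r, θ⟩ ⟨⟨hr, hθ⟩, hout⟩
  have hr : 0 < r := hr
  have hfar : fderiv ℝ ψ (r * exp (θ * I)) = 0 := by
    refine image_eq_zero_of_notMem_tsupport fun hmem => hout ⟨⟨hr.le, ?_⟩, Ioo_subset_Icc_self hθ⟩
    simpa [Complex.norm_exp_ofReal_mul_I, abs_of_pos hr] using hR hmem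
  simp [hfar]

theorem integral_fderiv_polar_radial (hψ : ContDiff ℝ 1 ψ) (hs : HasCompactSupport ψ) :
    ∫ p in Ioi (0 : ℝ) ×ˢ Ioo (-π) π, fderiv ℝ ψ (p.1 * exp (p.2 * I)) (1 * exp (p.2 * I)) =
      -(2 * π) * ψ 0 := by
  have hradial : ∀ θ : ℝ,
      ∫ r in Ioi (0 : ℝ), fderiv ℝ ψ (r * exp (θ * I)) (1 * exp (θ * I)) = -ψ 0 := fun θ => by
    simpa [Complex.real_smul] using integral_fderiv_ray hψ hs (Complex.exp_ne_zero (θ * I))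
  rw [Measure.volume_eq_prod, ← setIntegral_prod_swap,
    setIntegral_prod (fun z : ℝ × ℝ => fderiv ℝ ψ (z.swap.1 * exp (z.swap.2 * I))
      (1 * exp (z.swap.2 * I))) (integrableOn_fderiv_polar hψ hs 1).swap]
  simp only [Prod.swap_prod_mk, hradial]
  rw [setIntegral_const, Measure.real, Real.volume_Ioo,
    ENNReal.toReal_ofReal (by linarith [Real.pi_pos]), Complex.real_smul]
  push_cast
  ring

theorem integral_fderiv_polar_angular (hψ : ContDiff ℝ 1 ψ) (hs : HasCompactSupport ψ) :
    ∫ p in Ioi (0 : ℝ) ×ˢ Ioo (-π) π, fderiv ℝ ψ (p.1 * exp (p.2 * I)) (I * exp (p.2 * I)) =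
      0 := by
  rw [Measure.volume_eq_prod, setIntegral_prod _ (integrableOn_fderiv_polar hψ hs I)]
  refine (setIntegral_congr_fun measurableSet_Ioi fun r hr => ?_).trans (integral_zero _ _)
  rw [← integral_Ioc_eq_integral_Ioo, ← intervalIntegral.integral_of_le
    (by linarith [Real.pi_pos] : -π ≤ π), integral_fderiv_circle hψ (mem_Ioi.1 hr).ne']

/-- On the ray `ζ = r e^{iθ}` the conjugate-linearity of `∂̄ψ` gives `ζ⁻¹ ∂̄ψ(1) = r⁻¹ ∂̄ψ(e^{iθ})`,
the sum of a radial and an angular derivative. -/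
theorem integral_inv_mul_dbar (hψ : ContDiff ℝ 1 ψ) (hs : HasCompactSupport ψ) :
    ∫ ζ : ℂ, ζ⁻¹ * dbar ψ ζ 1 = -(2 * π) * ψ 0 := by
  have hpolar : ∀ p ∈ Ioi (0 : ℝ) ×ˢ Ioo (-π) π,
      p.1 • ((Complex.polarCoord.symm p)⁻¹ * dbar ψ (Complex.polarCoord.symm p) 1) =
      fderiv ℝ ψ (p.1 * exp (p.2 * I)) (1 * exp (p.2 * I)) +
        I * fderiv ℝ ψ (p.1 * exp (p.2 * I)) (I * exp (p.2 * I)) := by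
    rintro ⟨r, θ⟩ ⟨hr, -⟩
    have hr0 : (r : ℂ) ≠ 0 := by exact_mod_cast (mem_Ioi.1 hr).ne'
    have hpt : Complex.polarCoord.symm (r, θ) = r * exp (θ * I) := by
      rw [Complex.polarCoord_symm_apply, Complex.exp_mul_I]
      push_cast
      rfl
    have hconj : (exp (θ * I))⁻¹ = starRingEnd ℂ (exp (θ * I)) := by
      rw [← Complex.exp_conj, ← Complex.exp_neg]
      simp
    have hdbar := dbar_smul_right ψ (r * exp (θ * I)) 1 (exp (θ * I))
    rw [smul_eq_mul, mul_one] at hdbar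
    rw [hpt, mul_inv, mul_assoc, hconj, ← hdbar, Complex.real_smul, mul_inv_cancel_left₀ hr0,
      one_mul, dbar, smul_eq_mul]
  rw [← Complex.integral_comp_polarCoord_symm, polarCoord_target,
    setIntegral_congr_fun (measurableSet_Ioi.prod measurableSet_Ioo) hpolar,
    integral_add (integrableOn_fderiv_polar hψ hs 1)
      ((integrableOn_fderiv_polar hψ hs I).const_mul _),
    integral_const_mul, integral_fderiv_polar_radial hψ hs, integral_fderiv_polar_angular hψ hs,
    mul_zero, add_zero]

end PompeiuFormula

section CauchyTransform

open scoped Real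

theorem locallyIntegrable_inv_norm : LocallyIntegrable fun ζ : ℂ => ‖ζ‖⁻¹ :=
  locallyIntegrable_of_norm_le_rpow (C := 1) (α := 1) (by simp) (by simp)
    (Eventually.of_forall fun ζ => by simp [Real.rpow_neg_one])
    measurable_norm.inv.aestronglyMeasurable

theorem integrable_indicator_const_mul_inv_norm (R C : ℝ) :
    Integrable ((closedBall (0 : ℂ) R).indicator fun ζ => C * ‖ζ‖⁻¹) :=
  IntegrableOn.integrable_indicator (Integrable.const_mul
    (locallyIntegrable_inv_norm.integrableOn_isCompact (isCompact_closedBall 0 R)) C)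
    measurableSet_closedBall

section

variable {F : Type*} [NormedAddCommGroup F] [NormedSpace ℂ F]

theorem norm_inv_smul_le_indicator {x : F} {ζ : ℂ} {R C : ℝ} (hC : ‖ζ‖ ≤ R → ‖x‖ ≤ C)
    (hR : R < ‖ζ‖ → x = 0) :
    ‖ζ⁻¹ • x‖ ≤ (closedBall (0 : ℂ) R).indicator (fun ζ => C * ‖ζ‖⁻¹) ζ := by
  by_cases hζ : ζ ∈ closedBall (0 : ℂ) R
  · rw [indicator_of_mem hζ, norm_smul, norm_inv, mul_comm]
    gcongr
    exact hC (by simpa using hζ)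
  · rw [indicator_of_notMem hζ, hR (by simpa using hζ), smul_zero, norm_zero]

theorem integrable_inv_smul {w : ℂ → F} (hw : Continuous w) {R : ℝ}
    (hR : ∀ ζ, R < ‖ζ‖ → w ζ = 0) : Integrable fun ζ : ℂ => ζ⁻¹ • w ζ := by
  obtain ⟨C, hC⟩ := (isCompact_closedBall (0 : ℂ) R).exists_bound_of_continuousOn hw.continuousOn
  exact (integrable_indicator_const_mul_inv_norm R C).mono'
    (measurable_inv.aestronglyMeasurable.smul hw.aestronglyMeasurable)
    (Eventually.of_forall fun ζ =>
      norm_inv_smul_le_indicator (fun hζ => hC ζ (by simpa using hζ)) (hR ζ))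

end

variable {E : Type*} [NormedAddCommGroup E] [NormedSpace ℂ E] {p e₀ : E} {δ R : ℝ}

/-- The Cauchy transform of `w` in the direction `e₀`: the solution of `∂̄u(e₀) = w`, in the
normalization of `dbar`, on every complex line of direction `e₀` on which `w` has compact
support. -/
noncomputable def cauchyTransform (w : E → ℂ) (e₀ v : E) : ℂ :=
  -(2 * π : ℂ)⁻¹ * ∫ ζ : ℂ, ζ⁻¹ * w (v + ζ • e₀)

theorem integral_comp_complex_mul (F : ℂ → ℂ) {μ : ℂ} (hμ : μ ≠ 0) :
    ∫ ζ, F (μ * ζ) = (Complex.normSq μ : ℂ)⁻¹ * ∫ ζ, F ζ := by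
  have hpolar : ∀ ζ, μ * ζ = ‖μ‖ • rotation (Circle.exp μ.arg) ζ := fun ζ => by
    rw [rotation_apply, Complex.real_smul, Circle.coe_exp, ← mul_assoc,
      Complex.norm_mul_exp_arg_mul_I]
  simp only [hpolar]
  rw [(rotation (Circle.exp μ.arg)).measurePreserving.integral_comp
      (rotation (Circle.exp μ.arg)).toHomeomorph.measurableEmbedding (fun z => F (‖μ‖ • z)),
    Measure.integral_comp_smul, Complex.finrank_real_complex, Complex.real_smul,
    Complex.normSq_eq_norm_sq, abs_of_nonneg (by positivity)]
  push_cast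
  rfl

theorem cauchyTransform_smul {w : E → ℂ} {v : E} {μ c : ℂ} (hμ : μ ≠ 0)
    (hw : ∀ ζ : ℂ, w (μ • (v + ζ • e₀)) = c * (starRingEnd ℂ μ)⁻¹ * w (v + ζ • e₀)) :
    cauchyTransform w e₀ (μ • v) = c * cauchyTransform w e₀ v := by
  have hsubst := integral_comp_complex_mul (fun ζ => ζ⁻¹ * w (μ • v + ζ • e₀)) hμ
  have hint : ∀ ζ : ℂ, (μ * ζ)⁻¹ * w (μ • v + (μ * ζ) • e₀) =
      (Complex.normSq μ : ℂ)⁻¹ * c * (ζ⁻¹ * w (v + ζ • e₀)) := fun ζ => by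
    rw [mul_smul, ← smul_add, hw, Complex.normSq_eq_conj_mul_self, mul_inv, mul_inv]
    ring
  simp only [hint, integral_const_mul, mul_assoc] at hsubst
  have hnorm : (Complex.normSq μ : ℂ)⁻¹ ≠ 0 := by simpa using hμ
  rw [cauchyTransform, cauchyTransform, ← mul_left_cancel₀ hnorm hsubst]
  ring

theorem continuous_comp_line {G : Type*} [TopologicalSpace G] {k : E → G} {v : E}
    (hk : ∀ ζ : ℂ, ContinuousAt k (v + ζ • e₀)) : Continuous fun ζ : ℂ => k (v + ζ • e₀) :=
  continuous_iff_continuousAt.2 fun ζ =>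
    ContinuousAt.comp (f := fun ζ : ℂ => v + ζ • e₀) (hk ζ) (by fun_prop)

variable [NormedSpace ℝ E]

theorem fderiv_eq_zero_of_eq_zero_outside {w : E → ℂ}
    (hR : ∀ v ∈ ball p δ, ∀ ζ : ℂ, R < ‖ζ‖ → w (v + ζ • e₀) = 0) :
    ∀ v ∈ ball p δ, ∀ ζ : ℂ, R < ‖ζ‖ → fderiv ℝ w (v + ζ • e₀) = 0 := by
  intro v hv ζ hζ
  have hmem : ∀ᶠ x in 𝓝 (v + ζ • e₀), x - ζ • e₀ ∈ ball p δ :=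
    ContinuousAt.preimage_mem_nhds (f := fun x : E => x - ζ • e₀) (by fun_prop)
      (by simpa using isOpen_ball.mem_nhds hv)
  have hzero : w =ᶠ[𝓝 (v + ζ • e₀)] fun _ => 0 := by
    filter_upwards [hmem] with x hx
    simpa using hR _ hx ζ hζ
  rw [hzero.fderiv_eq, fderiv_const_apply]

theorem hasFDerivAt_integral_inv_mul [ProperSpace E] {w : E → ℂ} (hδ : 0 < δ)
    (hw : ∀ v ∈ ball p δ, ∀ ζ : ℂ, ContDiffAt ℝ 1 w (v + ζ • e₀))
    (hR : ∀ v ∈ ball p δ, ∀ ζ : ℂ, R < ‖ζ‖ → w (v + ζ • e₀) = 0) :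
    HasFDerivAt (fun v => ∫ ζ : ℂ, ζ⁻¹ * w (v + ζ • e₀))
      (∫ ζ : ℂ, ζ⁻¹ • fderiv ℝ w (p + ζ • e₀)) p := by
  have hsub : closedBall p (δ / 2) ⊆ ball p δ := closedBall_subset_ball (by linarith)
  have hDw : ∀ v ∈ ball p δ, ∀ ζ : ℂ, ContinuousAt (fderiv ℝ w) (v + ζ • e₀) := fun v hv ζ =>
    ((hw v hv ζ).fderiv_right (m := 0) (by simp)).continuousAt
  have hcont : ContinuousOn (fun q : E × ℂ => fderiv ℝ w (q.1 + q.2 • e₀))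
      (closedBall p (δ / 2) ×ˢ closedBall 0 R) := by
    rintro ⟨v, ζ⟩ ⟨hv, -⟩
    exact (ContinuousAt.comp (f := fun q : E × ℂ => q.1 + q.2 • e₀) (x := (v, ζ))
      (hDw v (hsub hv) ζ) (by fun_prop)).continuousWithinAt
  obtain ⟨C, hC⟩ := ((isCompact_closedBall p (δ / 2)).prod
    (isCompact_closedBall (0 : ℂ) R)).exists_bound_of_continuousOn hcont
  have hbound : ∀ v ∈ ball p (δ / 2), ∀ ζ : ℂ, ‖ζ⁻¹ • fderiv ℝ w (v + ζ • e₀)‖ ≤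
      (closedBall (0 : ℂ) R).indicator (fun ζ => C * ‖ζ‖⁻¹) ζ := fun v hv ζ =>
    norm_inv_smul_le_indicator
      (fun hζ => hC (v, ζ) ⟨ball_subset_closedBall hv, by simpa using hζ⟩)
      (fderiv_eq_zero_of_eq_zero_outside hR v (hsub (ball_subset_closedBall hv)) ζ)
  refine hasFDerivAt_integral_of_dominated_of_fderiv_le (𝕜 := ℝ)
    (F := fun v ζ => ζ⁻¹ * w (v + ζ • e₀)) (F' := fun v ζ => ζ⁻¹ • fderiv ℝ w (v + ζ • e₀))
    (ball_mem_nhds p (half_pos hδ)) ?_ ?_ ?_ (Eventually.of_forall fun ζ v hv => hbound v hv ζ)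
    (integrable_indicator_const_mul_inv_norm R C) ?_
  · filter_upwards [ball_mem_nhds p hδ] with v hv
    exact measurable_inv.aestronglyMeasurable.mul
      (continuous_comp_line fun ζ => (hw v hv ζ).continuousAt).aestronglyMeasurable
  · exact integrable_inv_smul
      (continuous_comp_line fun ζ => (hw p (mem_ball_self hδ) ζ).continuousAt)
      (hR p (mem_ball_self hδ))
  · exact measurable_inv.aestronglyMeasurable.smul
      (continuous_comp_line (hDw p (mem_ball_self hδ))).aestronglyMeasurable
  · refine Eventually.of_forall fun ζ v hv => ?_
    have hwd : HasFDerivAt w (fderiv ℝ w (v + ζ • e₀)) (v + ζ • e₀) :=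
      ((hw v (hsub (ball_subset_closedBall hv)) ζ).differentiableAt one_ne_zero).hasFDerivAt
    exact ((hwd.comp v ((hasFDerivAt_id v).add_const (ζ • e₀))).const_mul ζ⁻¹).congr_fderiv
      (by ext; simp)

theorem integrable_inv_smul_fderiv {w : E → ℂ} (hδ : 0 < δ)
    (hw : ∀ v ∈ ball p δ, ∀ ζ : ℂ, ContDiffAt ℝ 1 w (v + ζ • e₀))
    (hR : ∀ v ∈ ball p δ, ∀ ζ : ℂ, R < ‖ζ‖ → w (v + ζ • e₀) = 0) :
    Integrable fun ζ : ℂ => ζ⁻¹ • fderiv ℝ w (p + ζ • e₀) :=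
  integrable_inv_smul
    (continuous_comp_line fun ζ =>
      ((hw p (mem_ball_self hδ) ζ).fderiv_right (m := 0) (by simp)).continuousAt)
    (fderiv_eq_zero_of_eq_zero_outside hR p (mem_ball_self hδ))

theorem dbar_cauchyTransform_eq_cauchyTransform_dbar [ProperSpace E] {w : E → ℂ} (hδ : 0 < δ)
    (hw : ∀ v ∈ ball p δ, ∀ ζ : ℂ, ContDiffAt ℝ 1 w (v + ζ • e₀))
    (hR : ∀ v ∈ ball p δ, ∀ ζ : ℂ, R < ‖ζ‖ → w (v + ζ • e₀) = 0) (e : E) :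
    dbar (cauchyTransform w e₀) p e = cauchyTransform (fun x => dbar w x e) e₀ p := by
  have hint := integrable_inv_smul_fderiv hδ hw hR
  have hint_apply : ∀ x : E, Integrable fun ζ : ℂ => ζ⁻¹ * fderiv ℝ w (p + ζ • e₀) x :=
    fun x => hint.apply_continuousLinearMap x
  have happly : ∀ x : E, (∫ ζ : ℂ, ζ⁻¹ • fderiv ℝ w (p + ζ • e₀)) x =
      ∫ ζ : ℂ, ζ⁻¹ * fderiv ℝ w (p + ζ • e₀) x :=
    fun x => ContinuousLinearMap.integral_apply hint x
  have hderiv : HasFDerivAt (cauchyTransform w e₀) _ p :=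
    (hasFDerivAt_integral_inv_mul hδ hw hR).const_mul (-(2 * π : ℂ)⁻¹)
  rw [dbar, hderiv.fderiv]
  simp only [smul_apply, smul_eq_mul, happly, cauchyTransform, dbar, mul_add]
  rw [integral_add (hint_apply e)
    (by simpa only [mul_left_comm] using (hint_apply (Complex.I • e)).const_mul Complex.I)]
  simp only [mul_left_comm _ Complex.I, integral_const_mul]
  ring

variable {η : E → E → ℂ}

theorem contDiffAt_of_locally_dbar {x : E}
    (hη : ∃ g : E → ℂ, ContDiffAt ℝ 2 g x ∧ ∀ᶠ y in 𝓝 x, ∀ e, η y e = dbar g y e) (e : E) :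
    ContDiffAt ℝ 1 (fun y => η y e) x := by
  obtain ⟨g, hg, hgη⟩ := hη
  exact (contDiffAt_dbar hg e).congr_of_eventuallyEq (hgη.mono fun y hy => hy e)

theorem differentiableAt_cauchyTransform [ProperSpace E] {w : E → ℂ} (hδ : 0 < δ)
    (hw : ∀ v ∈ ball p δ, ∀ ζ : ℂ, ContDiffAt ℝ 1 w (v + ζ • e₀))
    (hR : ∀ v ∈ ball p δ, ∀ ζ : ℂ, R < ‖ζ‖ → w (v + ζ • e₀) = 0) :
    DifferentiableAt ℝ (cauchyTransform w e₀) p :=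
  ((hasFDerivAt_integral_inv_mul hδ hw hR).const_mul _).differentiableAt

variable [IsScalarTower ℝ ℂ E]

theorem cauchyTransform_dbar {w : E → ℂ} (hw : ∀ ζ : ℂ, ContDiffAt ℝ 1 w (p + ζ • e₀))
    (hR : ∀ ζ : ℂ, R < ‖ζ‖ → w (p + ζ • e₀) = 0) :
    cauchyTransform (fun x => dbar w x e₀) e₀ p = w p := by
  have hsmooth : ContDiff ℝ 1 fun ζ : ℂ => w (p + ζ • e₀) := contDiff_iff_contDiffAt.2 fun ζ =>
    ContDiffAt.comp ζ (f := fun ζ : ℂ => p + ζ • e₀) (hw ζ)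
      (contDiffAt_const.add (contDiffAt_id.smul contDiffAt_const))
  have hsupp : HasCompactSupport fun ζ : ℂ => w (p + ζ • e₀) :=
    HasCompactSupport.intro (isCompact_closedBall (0 : ℂ) R) fun ζ hζ => hR ζ (by simpa using hζ)
  have hpompeiu := integral_inv_mul_dbar hsmooth hsupp
  simp only [dbar_comp_line p e₀ _ ((hw _).differentiableAt one_ne_zero), zero_smul,
    add_zero] at hpompeiu
  have hpi : (2 * π : ℂ) ≠ 0 := by simp [Real.pi_ne_zero]
  rw [cauchyTransform, hpompeiu, neg_mul, neg_mul, mul_neg, neg_neg, inv_mul_cancel_left₀ hpi]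

/-- Differentiation under the integral sign and the symmetry of second derivatives turn
`∂̄u(e)` into the Cauchy transform of the `e₀`-derivative of `η(e)`, which the Cauchy–Pompeiu
formula evaluates. -/
theorem dbar_cauchyTransform [ProperSpace E] (hδ : 0 < δ)
    (hη : ∀ v ∈ ball p δ, ∀ ζ : ℂ, ∃ g : E → ℂ, ContDiffAt ℝ 2 g (v + ζ • e₀) ∧
      ∀ᶠ x in 𝓝 (v + ζ • e₀), ∀ e, η x e = dbar g x e)
    (hR : ∀ v ∈ ball p δ, ∀ ζ : ℂ, R < ‖ζ‖ → ∀ e, η (v + ζ • e₀) e = 0) (e : E) :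
    dbar (cauchyTransform (fun x => η x e₀) e₀) p e = η p e := by
  have hcomm : ∀ ζ : ℂ, dbar (fun x => η x e₀) (p + ζ • e₀) e =
      dbar (fun x => η x e) (p + ζ • e₀) e₀ := fun ζ => by
    obtain ⟨g, hg, hgη⟩ := hη p (mem_ball_self hδ) ζ
    rw [dbar_congr (hgη.mono fun x hx => hx e₀), dbar_congr (hgη.mono fun x hx => hx e),
      dbar_dbar_comm hg]
  rw [dbar_cauchyTransform_eq_cauchyTransform_dbar hδ
      (fun v hv ζ => contDiffAt_of_locally_dbar (hη v hv ζ) e₀) (fun v hv ζ hζ => hR v hv ζ hζ e₀),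
    cauchyTransform]
  simp only [hcomm]
  exact cauchyTransform_dbar
    (fun ζ => contDiffAt_of_locally_dbar (hη p (mem_ball_self hδ) ζ) e)
    (fun ζ hζ => hR p (mem_ball_self hδ) ζ hζ e)

end CauchyTransform

/-! ### Conical covers of `ℂⁿ ∖ 0` and partitions of unity -/

section ConicalPartition

variable {n ι : Type*} {C : ι → Set (n → ℂ)}

/-- The sets `C a` are open cones that cover `ℂⁿ ∖ 0`: the pullback of an open cover of the
projective space. -/
structure IsConicalCover (C : ι → Set (n → ℂ)) : Prop where
  isOpen : ∀ a, IsOpen (C a)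
  zero_notMem : ∀ a, 0 ∉ C a
  smul_mem : ∀ {a} {μ : ℂ} {v}, μ ≠ 0 → v ∈ C a → μ • v ∈ C a
  exists_mem : ∀ {v}, v ≠ 0 → ∃ a, v ∈ C a

theorem IsConicalCover.ne_zero (hC : IsConicalCover C) {a : ι} {v : n → ℂ} (hv : v ∈ C a) :
    v ≠ 0 :=
  fun h => hC.zero_notMem a (h ▸ hv)

variable [Fintype n]

/-- A finite smooth partition of unity on `ℂⁿ ∖ 0` by functions which are constant on lines through
the origin, subordinate to the family `C`. -/
structure ConicalPartition (C : ι → Set (n → ℂ)) where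
  index : Finset ι
  toFun : ι → (n → ℂ) → ℂ
  contDiffAt : ∀ {a v}, v ≠ 0 → ContDiffAt ℝ ∞ (toFun a) v
  apply_smul : ∀ (a) {μ : ℂ} (v), μ ≠ 0 → toFun a (μ • v) = toFun a v
  sum_eq_one : ∀ {v}, v ≠ 0 → ∑ a ∈ index, toFun a v = 1
  eventually_eq_zero : ∀ {a v}, v ≠ 0 → v ∉ C a → ∀ᶠ x in 𝓝 v, toFun a x = 0

theorem ConicalPartition.mem_of_ne_zero (ρ : ConicalPartition C) {a : ι} {v : n → ℂ} (hv : v ≠ 0)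
    (hρ : ρ.toFun a v ≠ 0) : v ∈ C a :=
  not_not.1 fun hn => hρ (ρ.eventually_eq_zero hv hn).self_of_nhds

/-- The orthogonal projector `v v* / |v|²` onto the line spanned by `v`. It embeds the projective
space smoothly in a vector space, where Mathlib's partitions of unity are available. -/
noncomputable def lineProjector (v : n → ℂ) : n → n → ℂ :=
  fun j k => (v ⬝ᵥ star v)⁻¹ * (v j * star (v k))

open scoped ComplexOrder in
theorem contDiffAt_lineProjector {v : n → ℂ} (hv : v ≠ 0) {m : ℕ∞ω} :
    ContDiffAt ℝ m lineProjector v := by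
  have hcoord : ∀ j, ContDiff ℝ m fun v : n → ℂ => v j := fun j => contDiff_apply ℝ ℂ j
  have hstar : ∀ j, ContDiff ℝ m fun v : n → ℂ => star (v j) := fun j =>
    Complex.conjCLE.contDiff.comp (hcoord j)
  have hnorm : ContDiff ℝ m fun v : n → ℂ => v ⬝ᵥ star v :=
    ContDiff.sum fun j _ => (hcoord j).mul (hstar j)
  have hinv : ContDiffAt ℝ m (fun v : n → ℂ => (v ⬝ᵥ star v)⁻¹) v :=
    hnorm.contDiffAt.inv (dotProduct_self_star_eq_zero.not.2 hv)
  exact contDiffAt_pi.2 fun j => contDiffAt_pi.2 fun k =>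
    hinv.mul ((hcoord j).mul (hstar k)).contDiffAt

theorem lineProjector_smul {μ : ℂ} (hμ : μ ≠ 0) (v : n → ℂ) :
    lineProjector (μ • v) = lineProjector v := by
  ext j k
  have hstar : star μ ≠ 0 := star_ne_zero.2 hμ
  simp only [lineProjector, star_smul, smul_dotProduct, dotProduct_smul, Pi.smul_apply,
    smul_eq_mul, star_mul', mul_inv]
  field_simp

open scoped ComplexOrder in
theorem exists_eq_smul_of_lineProjector_eq {v w : n → ℂ} (hv : v ≠ 0) (hw : w ≠ 0)
    (h : lineProjector v = lineProjector w) : ∃ μ : ℂ, μ ≠ 0 ∧ v = μ • w := by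
  have hv' : v ⬝ᵥ star v ≠ 0 := dotProduct_self_star_eq_zero.not.2 hv
  have hw' : w ⬝ᵥ star w ≠ 0 := dotProduct_self_star_eq_zero.not.2 hw
  obtain ⟨k, hk⟩ := Function.ne_iff.1 hv
  have hk : star (v k) ≠ 0 := star_ne_zero.2 hk
  have hvw : v = ((star (v k))⁻¹ * (v ⬝ᵥ star v) * ((w ⬝ᵥ star w)⁻¹ * star (w k))) • w := by
    ext j
    have hjk : (v ⬝ᵥ star v)⁻¹ * (v j * star (v k)) = (w ⬝ᵥ star w)⁻¹ * (w j * star (w k)) :=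
      congrFun (congrFun h j) k
    rw [Pi.smul_apply, smul_eq_mul]
    field_simp at hjk ⊢
    linear_combination hjk
  exact ⟨_, fun hμ => hv (by rw [hvw, hμ, zero_smul]), hvw⟩

theorem exists_mem_sphere_lineProjector_eq {v : n → ℂ} (hv : v ≠ 0) :
    ∃ w ∈ sphere (0 : n → ℂ) 1, lineProjector w = lineProjector v :=
  ⟨(‖v‖ : ℂ)⁻¹ • v, by simp [norm_smul, norm_ne_zero_iff.2 hv],
    lineProjector_smul (by simpa using hv) v⟩

theorem continuousOn_lineProjector : ContinuousOn lineProjector (sphere (0 : n → ℂ) 1) :=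
  fun _ hv => (contDiffAt_lineProjector (m := 0)
    (ne_of_mem_sphere hv one_ne_zero)).continuousAt.continuousWithinAt

theorem IsConicalCover.isOpen_compl_lineProjector_image (hC : IsConicalCover C) (a : ι) :
    IsOpen (lineProjector '' (sphere 0 1 \ C a))ᶜ :=
  (((isCompact_sphere _ _).diff (hC.isOpen a)).image_of_continuousOn
    (continuousOn_lineProjector.mono sdiff_subset)).isClosed.isOpen_compl

theorem IsConicalCover.lineProjector_notMem (hC : IsConicalCover C) {a : ι} {v : n → ℂ}
    (hv : v ∈ C a) : lineProjector v ∉ lineProjector '' (sphere 0 1 \ C a) := by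
  rintro ⟨w, ⟨hw, hwC⟩, hwv⟩
  obtain ⟨μ, hμ, rfl⟩ := exists_eq_smul_of_lineProjector_eq (ne_of_mem_sphere hw one_ne_zero)
    (hC.ne_zero hv) hwv
  exact hwC (hC.smul_mem hμ hv)

theorem IsConicalCover.lineProjector_mem (hC : IsConicalCover C) {a : ι} {v : n → ℂ}
    (hv : v ≠ 0) (hva : v ∉ C a) : lineProjector v ∈ lineProjector '' (sphere 0 1 \ C a) := by
  have hnorm : (‖v‖ : ℂ) ≠ 0 := by simpa using hv
  refine ⟨(‖v‖ : ℂ)⁻¹ • v, ⟨by simp [norm_smul, norm_ne_zero_iff.2 hv], fun hmem => hva ?_⟩,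
    lineProjector_smul (inv_ne_zero hnorm) v⟩
  simpa only [smul_inv_smul₀ hnorm] using hC.smul_mem hnorm hmem

theorem exists_conicalPartition_of_subset_iUnion {U : ι → Set (n → n → ℂ)}
    (hU : ∀ a, IsOpen (U a)) (hcover : lineProjector '' sphere (0 : n → ℂ) 1 ⊆ ⋃ a, U a)
    (hUC : ∀ a v, v ≠ 0 → lineProjector v ∈ U a → v ∈ C a) :
    ∃ ρ : ConicalPartition C, ∀ a v, v ≠ 0 → lineProjector v ∉ U a →
      ∀ᶠ x in 𝓝 v, ρ.toFun a x = 0 := by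
  have hS : IsCompact (lineProjector '' sphere (0 : n → ℂ) 1) :=
    (isCompact_sphere _ _).image_of_continuousOn continuousOn_lineProjector
  obtain ⟨f, hf⟩ := SmoothPartitionOfUnity.exists_isSubordinate 𝓘(ℝ, n → n → ℂ) hS.isClosed U
    hU hcover
  have hfin := f.locallyFinite.finite_nonempty_inter_compact hS
  have hzero : ∀ a v, v ≠ 0 → lineProjector v ∉ U a →
      ∀ᶠ x in 𝓝 v, ((f a (lineProjector x) : ℝ) : ℂ) = 0 := by
    intro a v hv hva
    have hcont : ContinuousAt (lineProjector (n := n)) v :=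
      (contDiffAt_lineProjector (m := 0) hv).continuousAt
    filter_upwards [hcont.eventually (notMem_tsupport_iff_eventuallyEq.1 fun h => hva (hf a h))]
      with x hx
    rw [hx, Pi.zero_apply, Complex.ofReal_zero]
  refine ⟨{
    index := hfin.toFinset
    toFun := fun a v => ((f a (lineProjector v) : ℝ) : ℂ)
    contDiffAt := fun {a v} hv => Complex.ofRealCLM.contDiff.contDiffAt.comp v
      ((f a).contMDiff.contDiff.contDiffAt.comp v (contDiffAt_lineProjector hv))
    apply_smul := fun a μ v hμ => by rw [lineProjector_smul hμ]
    sum_eq_one := fun {v} hv => ?_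
    eventually_eq_zero := fun {a v} hv hva => hzero a v hv fun h => hva (hUC a v hv h) }, hzero⟩
  obtain ⟨w, hw, hwv⟩ := exists_mem_sphere_lineProjector_eq hv
  have hmem : lineProjector v ∈ lineProjector '' sphere (0 : n → ℂ) 1 := ⟨w, hw, hwv⟩
  have hsum := f.sum_eq_one hmem
  rw [finsum_eq_sum_of_support_subset _ fun a ha => hfin.mem_toFinset.2 ⟨_, ha, hmem⟩] at hsum
  exact_mod_cast hsum

/-- The members other than `a₀` are constrained to vanish at the line of `e₀`, by removing it from
the open sets to which they are subordinate. -/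
theorem IsConicalCover.exists_conicalPartition (hC : IsConicalCover C) {e₀ : n → ℂ}
    (he₀ : e₀ ≠ 0) : ∃ (ρ : ConicalPartition C) (a₀ : ι),
      ∀ᶠ x in 𝓝 e₀, ∀ a ∈ ρ.index, a ≠ a₀ → ρ.toFun a x = 0 := by
  obtain ⟨a₀, ha₀⟩ := hC.exists_mem he₀
  let U : ι → Set (n → n → ℂ) := fun a =>
    (lineProjector '' (sphere 0 1 \ C a))ᶜ ∩ {P | a ≠ a₀ → P ≠ lineProjector e₀}
  have hU : ∀ a, IsOpen (U a) := fun a => by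
    refine (hC.isOpen_compl_lineProjector_image a).inter ?_
    by_cases ha : a = a₀
    · simp only [ha, ne_eq, not_true_eq_false, false_imp_iff, ofPred_true, isOpen_univ]
    · simpa only [ha, ne_eq, not_false_eq_true, true_imp_iff] using
        isOpen_ne (x := lineProjector e₀)
  have hcover : lineProjector '' sphere (0 : n → ℂ) 1 ⊆ ⋃ a, U a := by
    rintro _ ⟨v, hv, rfl⟩
    have hv : v ≠ 0 := ne_of_mem_sphere hv one_ne_zero
    by_cases hve : lineProjector v = lineProjector e₀
    · exact mem_iUnion.2 ⟨a₀, hve ▸ hC.lineProjector_notMem ha₀, fun h => absurd rfl h⟩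
    · obtain ⟨a, ha⟩ := hC.exists_mem hv
      exact mem_iUnion.2 ⟨a, hC.lineProjector_notMem ha, fun _ => hve⟩
  obtain ⟨ρ, hρ⟩ := exists_conicalPartition_of_subset_iUnion hU hcover
    fun a v hv hmem => not_not.1 fun hn => hmem.1 (hC.lineProjector_mem hv hn)
  exact ⟨ρ, a₀, (Filter.eventually_all_finset _).2 fun a _ => Filter.eventually_imp_distrib_left.2
    fun ha => hρ a e₀ he₀ fun hmem => hmem.2 ha rfl⟩

end ConicalPartition

/-! ### Vanishing of cohomology for conical covers -/

section ConicalCousinProblem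

variable {n ι : Type*} {C : ι → Set (n → ℂ)} {h : ι → ι → (n → ℂ) → ℂ}

/-- A Čech 1-cocycle of holomorphic functions, subordinate to the family of sets `C`. -/
structure IsHolomorphicCocycle (C : ι → Set (n → ℂ)) (h : ι → ι → (n → ℂ) → ℂ) : Prop where
  differentiableOn : ∀ a b, DifferentiableOn ℂ (h a b) (C a ∩ C b)
  add_eq : ∀ {a b c v}, v ∈ C a → v ∈ C b → v ∈ C c → h a b v + h b c v = h a c v

theorem IsHolomorphicCocycle.self_eq_zero (hh : IsHolomorphicCocycle C h) {a : ι} {v : n → ℂ}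
    (hv : v ∈ C a) : h a a v = 0 := by
  simpa using hh.add_eq hv hv hv

theorem notMem_span_single [DecidableEq n] {i j k : n} (hij : i ≠ j) (hik : i ≠ k) {v : n → ℂ}
    (hv : ¬ (v j = 0 ∧ v k = 0)) : v ∉ Submodule.span ℂ {Pi.single i 1} := by
  intro hmem
  obtain ⟨t, rfl⟩ := Submodule.mem_span_singleton.1 hmem
  exact hv (by simp [hij.symm, hik.symm])

theorem eq_of_eq_off_codim_two [Finite n] {U : Set (n → ℂ)} (hU : IsOpen U) {j k : n}
    {f g : (n → ℂ) → ℂ} {v : n → ℂ} (hv : v ∈ U) (hf : ContinuousAt f v) (hg : ContinuousAt g v)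
    (hfg : ∀ x ∈ U, ¬ (x j = 0 ∧ x k = 0) → f x = g x) : f v = g v := by
  classical
  cases nonempty_fintype n
  by_cases hjk : v j = 0 ∧ v k = 0
  swap
  · exact hfg v hv hjk
  refine eq_of_eventuallyEq_line (e := Pi.single j 1) hf hg ?_
  filter_upwards [tendsto_add_smul_nhdsNE v (Pi.single j 1) (hU.mem_nhds hv),
    self_mem_nhdsWithin] with t ht ht0
  exact hfg _ ht fun hx => ht0 (by simpa [hjk.1] using hx.1)

variable [Fintype n]

namespace ConicalPartition

variable {ρ : ConicalPartition C}

theorem eventually_eq_zero_smul {s : ι → Prop} {v : n → ℂ} {μ : ℂ} (hμ : μ ≠ 0)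
    (hv : ∀ᶠ x in 𝓝 v, ∀ a ∈ ρ.index, s a → ρ.toFun a x = 0) :
    ∀ᶠ x in 𝓝 (μ • v), ∀ a ∈ ρ.index, s a → ρ.toFun a x = 0 := by
  have hinv : Tendsto (fun x : n → ℂ => μ⁻¹ • x) (𝓝 (μ • v)) (𝓝 v) := by
    simpa only [inv_smul_smul₀ hμ] using (continuous_const_smul μ⁻¹).tendsto (μ • v)
  filter_upwards [hinv.eventually hv] with x hx a ha has
  rw [← ρ.apply_smul a x (inv_ne_zero hμ), hx a ha has]

/-- The smooth cochain which a partition of unity provides as a primitive of the cocycle `h`. -/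
noncomputable def smoothPrimitive (ρ : ConicalPartition C) (h : ι → ι → (n → ℂ) → ℂ) (a : ι)
    (v : n → ℂ) : ℂ :=
  ∑ b ∈ ρ.index, ρ.toFun b v * h b a v

/-- The `(0, 1)`-form on `ℂⁿ ∖ 0` which restricts to `∂̄ g a` on `C a`, where `g` is the smooth
primitive of the cocycle `h`. -/
noncomputable def dbarForm (ρ : ConicalPartition C) (h : ι → ι → (n → ℂ) → ℂ) (v e : n → ℂ) : ℂ :=
  ∑ a ∈ ρ.index, ρ.toFun a v * dbar (ρ.smoothPrimitive h a) v e

theorem contDiffAt_smoothPrimitive (hC : IsConicalCover C) (hh : IsHolomorphicCocycle C h) {a : ι}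
    {v : n → ℂ} (hv : v ∈ C a) : ContDiffAt ℝ 2 (ρ.smoothPrimitive h a) v := by
  refine ContDiffAt.sum fun b _ => ?_
  by_cases hb : v ∈ C b
  · have hopen := (hC.isOpen b).inter (hC.isOpen a)
    exact ((ρ.contDiffAt (hC.ne_zero hv)).of_le (WithTop.coe_le_coe.2 (le_top (a := (2 : ℕ∞))))).mul
      (((contDiffOn_of_differentiableOn hopen (hh.differentiableOn b a) 2).contDiffAt
        (hopen.mem_nhds ⟨hb, hv⟩)).restrict_scalars ℝ)
  · refine (contDiffAt_const (c := (0 : ℂ))).congr_of_eventuallyEq ?_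
    filter_upwards [ρ.eventually_eq_zero (hC.ne_zero hv) hb] with x hx
    rw [hx, zero_mul]

theorem differentiableAt_smoothPrimitive (hC : IsConicalCover C) (hh : IsHolomorphicCocycle C h)
    {a : ι} {v : n → ℂ} (hv : v ∈ C a) : DifferentiableAt ℝ (ρ.smoothPrimitive h a) v :=
  (contDiffAt_smoothPrimitive hC hh hv).differentiableAt two_ne_zero

theorem smoothPrimitive_sub (hC : IsConicalCover C) (hh : IsHolomorphicCocycle C h) {a b : ι}
    {v : n → ℂ} (ha : v ∈ C a) (hb : v ∈ C b) :
    ρ.smoothPrimitive h b v - ρ.smoothPrimitive h a v = h a b v := by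
  have hterm : ∀ c ∈ ρ.index,
      ρ.toFun c v * h c b v - ρ.toFun c v * h c a v = ρ.toFun c v * h a b v := by
    intro c _
    by_cases hc : ρ.toFun c v = 0
    · simp only [hc, zero_mul, sub_zero]
    · rw [← hh.add_eq (ρ.mem_of_ne_zero (hC.ne_zero ha) hc) ha hb]
      ring
  rw [smoothPrimitive, smoothPrimitive, ← Finset.sum_sub_distrib, Finset.sum_congr rfl hterm,
    ← Finset.sum_mul, ρ.sum_eq_one (hC.ne_zero ha), one_mul]

theorem smoothPrimitive_smul (hC : IsConicalCover C) {μ c : ℂ} (hμ : μ ≠ 0)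
    (hhom : ∀ a b, ∀ v ∈ C a ∩ C b, h a b (μ • v) = c * h a b v) {a : ι} {v : n → ℂ}
    (hv : v ∈ C a) : ρ.smoothPrimitive h a (μ • v) = c * ρ.smoothPrimitive h a v := by
  rw [smoothPrimitive, smoothPrimitive, Finset.mul_sum]
  refine Finset.sum_congr rfl fun b _ => ?_
  rw [ρ.apply_smul b v hμ]
  by_cases hb : ρ.toFun b v = 0
  · simp only [hb, zero_mul, mul_zero]
  · rw [hhom _ _ v ⟨ρ.mem_of_ne_zero (hC.ne_zero hv) hb, hv⟩]
    ring

theorem dbar_smoothPrimitive_eq (hC : IsConicalCover C) (hh : IsHolomorphicCocycle C h) {a b : ι}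
    {v : n → ℂ} (ha : v ∈ C a) (hb : v ∈ C b) (e : n → ℂ) :
    dbar (ρ.smoothPrimitive h b) v e = dbar (ρ.smoothPrimitive h a) v e := by
  have hmem : C a ∩ C b ∈ 𝓝 v := ((hC.isOpen a).inter (hC.isOpen b)).mem_nhds ⟨ha, hb⟩
  have hsub : (fun x => ρ.smoothPrimitive h b x - ρ.smoothPrimitive h a x) =ᶠ[𝓝 v] h a b := by
    filter_upwards [hmem] with x hx using smoothPrimitive_sub hC hh hx.1 hx.2
  rw [← sub_eq_zero, ← dbar_sub (differentiableAt_smoothPrimitive hC hh hb)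
    (differentiableAt_smoothPrimitive hC hh ha), dbar_congr hsub,
    dbar_eq_zero_of_differentiableAt ((hh.differentiableOn a b).differentiableAt hmem)]

theorem dbarForm_eq (hC : IsConicalCover C) (hh : IsHolomorphicCocycle C h) {a : ι}
    {v : n → ℂ} (hv : v ∈ C a) (e : n → ℂ) :
    ρ.dbarForm h v e = dbar (ρ.smoothPrimitive h a) v e := by
  have hv0 : v ≠ 0 := hC.ne_zero hv
  have hterm : ∀ b ∈ ρ.index, ρ.toFun b v * dbar (ρ.smoothPrimitive h b) v e =
      ρ.toFun b v * dbar (ρ.smoothPrimitive h a) v e := by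
    intro b _
    by_cases hb : ρ.toFun b v = 0
    · rw [hb, zero_mul, zero_mul]
    · rw [dbar_smoothPrimitive_eq hC hh hv (ρ.mem_of_ne_zero hv0 hb)]
  rw [dbarForm, Finset.sum_congr rfl hterm, ← Finset.sum_mul, ρ.sum_eq_one hv0, one_mul]

theorem dbarForm_locally_dbar (hC : IsConicalCover C) (hh : IsHolomorphicCocycle C h) {v : n → ℂ}
    (hv : v ≠ 0) : ∃ g : (n → ℂ) → ℂ, ContDiffAt ℝ 2 g v ∧
      ∀ᶠ x in 𝓝 v, ∀ e, ρ.dbarForm h x e = dbar g x e := by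
  obtain ⟨a, ha⟩ := hC.exists_mem hv
  refine ⟨ρ.smoothPrimitive h a, contDiffAt_smoothPrimitive hC hh ha, ?_⟩
  filter_upwards [(hC.isOpen a).mem_nhds ha] with x hx using dbarForm_eq hC hh hx

theorem dbarForm_smul (hC : IsConicalCover C) (hh : IsHolomorphicCocycle C h) {μ c : ℂ}
    (hμ : μ ≠ 0) (hhom : ∀ a b, ∀ v ∈ C a ∩ C b, h a b (μ • v) = c * h a b v) {v : n → ℂ}
    (hv : v ≠ 0) (e : n → ℂ) :
    ρ.dbarForm h (μ • v) e = c * (starRingEnd ℂ μ)⁻¹ * ρ.dbarForm h v e := by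
  obtain ⟨a, ha⟩ := hC.exists_mem hv
  have hμa := hC.smul_mem hμ ha
  rw [dbarForm_eq hC hh hμa, dbarForm_eq hC hh ha]
  refine dbar_of_homogeneous hμ (differentiableAt_smoothPrimitive hC hh hμa)
    (differentiableAt_smoothPrimitive hC hh ha) ?_ e
  filter_upwards [(hC.isOpen a).mem_nhds ha] with x hx using smoothPrimitive_smul hC hμ hhom hx

theorem dbarForm_eq_zero (hC : IsConicalCover C) (hh : IsHolomorphicCocycle C h) {a₀ : ι}
    {v : n → ℂ} (hv : v ≠ 0)
    (hρ : ∀ᶠ x in 𝓝 v, ∀ a ∈ ρ.index, a ≠ a₀ → ρ.toFun a x = 0) (e : n → ℂ) :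
    ρ.dbarForm h v e = 0 := by
  have hmem : v ∈ C a₀ := by
    obtain ⟨a, ha, hav⟩ := Finset.exists_ne_zero_of_sum_ne_zero
      ((ρ.sum_eq_one hv).trans_ne one_ne_zero)
    have haa₀ : a = a₀ := not_not.1 fun hn => hav (hρ.self_of_nhds a ha hn)
    exact haa₀ ▸ ρ.mem_of_ne_zero hv hav
  have hzero : ρ.smoothPrimitive h a₀ =ᶠ[𝓝 v] fun _ => 0 := by
    filter_upwards [hρ, (hC.isOpen a₀).mem_nhds hmem] with x hx hxC
    refine Finset.sum_eq_zero fun a ha => ?_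
    by_cases haa₀ : a = a₀
    · rw [haa₀, hh.self_eq_zero hxC, mul_zero]
    · rw [hx a ha haa₀, zero_mul]
  rw [dbarForm_eq hC hh hmem, dbar_congr hzero,
    dbar_eq_zero_of_differentiableAt (differentiableAt_const 0)]

theorem dbarForm_add_smul_eq_zero (hC : IsConicalCover C) (hh : IsHolomorphicCocycle C h) {a₀ : ι}
    {e₀ : n → ℂ} {ε : ℝ} (hρ : ∀ x ∈ ball e₀ ε, ∀ a ∈ ρ.index, a ≠ a₀ → ρ.toFun a x = 0)
    {v : n → ℂ} {ζ : ℂ} (hvζ : ‖v‖ < ε * ‖ζ‖) (hv : v + ζ • e₀ ≠ 0) (e : n → ℂ) :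
    ρ.dbarForm h (v + ζ • e₀) e = 0 := by
  have hζ : ζ ≠ 0 := by
    rintro rfl
    exact (norm_nonneg v).not_gt (by simpa using hvζ)
  have hball : ζ⁻¹ • v + e₀ ∈ ball e₀ ε := by
    rw [mem_ball, dist_eq_norm, add_sub_cancel_right, norm_smul, norm_inv, inv_mul_lt_iff₀
      (norm_pos_iff.2 hζ), mul_comm]
    exact hvζ
  have hsmul : v + ζ • e₀ = ζ • (ζ⁻¹ • v + e₀) := by rw [smul_add, smul_inv_smul₀ hζ]
  refine dbarForm_eq_zero (a₀ := a₀) hC hh hv ?_ e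
  rw [hsmul]
  exact eventually_eq_zero_smul hζ (Filter.mem_of_superset (isOpen_ball.mem_nhds hball) hρ)

theorem differentiableAt_cauchyTransform_dbarForm (hC : IsConicalCover C)
    (hh : IsHolomorphicCocycle C h) {a₀ : ι} {e₀ : n → ℂ}
    (hρ : ∀ᶠ x in 𝓝 e₀, ∀ a ∈ ρ.index, a ≠ a₀ → ρ.toFun a x = 0) {p : n → ℂ}
    (hp : p ∉ Submodule.span ℂ {e₀}) :
    DifferentiableAt ℝ (cauchyTransform (fun v => ρ.dbarForm h v e₀) e₀) p ∧
      ∀ e, dbar (cauchyTransform (fun v => ρ.dbarForm h v e₀) e₀) p e = ρ.dbarForm h p e := by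
  obtain ⟨ε, hε, hρ⟩ := Metric.eventually_nhds_iff_ball.1 hρ
  obtain ⟨δ, hδ, hδp⟩ := Metric.isOpen_iff.1
    (Submodule.span ℂ {e₀}).closed_of_finiteDimensional.isOpen_compl p hp
  have hne : ∀ v ∈ ball p δ, ∀ ζ : ℂ, v + ζ • e₀ ≠ 0 := fun v hv ζ hz =>
    hδp hv (Submodule.mem_span_singleton.2 ⟨-ζ, by rw [neg_smul, eq_neg_of_add_eq_zero_left hz]⟩)
  have hlocal := fun v hv ζ => dbarForm_locally_dbar (ρ := ρ) hC hh (hne v hv ζ)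
  have hfar : ∀ v ∈ ball p δ, ∀ ζ : ℂ, (‖p‖ + δ) / ε < ‖ζ‖ → ∀ e,
      ρ.dbarForm h (v + ζ • e₀) e = 0 := by
    intro v hv ζ hζ e
    refine dbarForm_add_smul_eq_zero hC hh hρ ?_ (hne v hv ζ) e
    calc ‖v‖ ≤ ‖p‖ + ‖v - p‖ := norm_le_norm_add_norm_sub' v p
      _ < ‖p‖ + δ := by gcongr; exact mem_ball_iff_norm.1 hv
      _ < ε * ‖ζ‖ := (div_lt_iff₀' hε).1 hζ
  exact ⟨differentiableAt_cauchyTransform hδ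
    (fun v hv ζ => contDiffAt_of_locally_dbar (hlocal v hv ζ) e₀)
    (fun v hv ζ hζ => hfar v hv ζ hζ e₀), dbar_cauchyTransform hδ hlocal hfar⟩

theorem cauchyTransform_dbarForm_smul (hC : IsConicalCover C) (hh : IsHolomorphicCocycle C h)
    {μ c : ℂ} (hμ : μ ≠ 0) (hhom : ∀ a b, ∀ v ∈ C a ∩ C b, h a b (μ • v) = c * h a b v)
    {e₀ v : n → ℂ} (hv : v ∉ Submodule.span ℂ {e₀}) :
    cauchyTransform (fun v => ρ.dbarForm h v e₀) e₀ (μ • v) =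
      c * cauchyTransform (fun v => ρ.dbarForm h v e₀) e₀ v :=
  cauchyTransform_smul hμ fun ζ => dbarForm_smul hC hh hμ hhom (fun hz => hv
    (Submodule.mem_span_singleton.2 ⟨-ζ, by rw [neg_smul, eq_neg_of_add_eq_zero_left hz]⟩)) e₀

theorem exists_holomorphic_correction [DecidableEq n] (hC : IsConicalCover C)
    (hh : IsHolomorphicCocycle C h) {a₀ : ι} {i j k : n} (hij : i ≠ j) (hik : i ≠ k) (hjk : j ≠ k)
    (hρ : ∀ᶠ x in 𝓝 (Pi.single i 1), ∀ a ∈ ρ.index, a ≠ a₀ → ρ.toFun a x = 0) (a : ι) :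
    ∃ F : (n → ℂ) → ℂ, DifferentiableOn ℂ F (C a) ∧ ∀ v ∈ C a, ¬ (v j = 0 ∧ v k = 0) →
      F v = ρ.smoothPrimitive h a v -
        cauchyTransform (fun v => ρ.dbarForm h v (Pi.single i 1)) (Pi.single i 1) v := by
  refine exists_extension_of_codim_two (hC.isOpen a) (l := ContinuousLinearMap.proj j)
    (l' := ContinuousLinearMap.proj k) (e := Pi.single j 1) (e' := Pi.single k 1) (by simp)
    (by simp [hjk.symm]) (by simp) fun v hv hv' => ?_
  obtain ⟨hdiff, hdbar⟩ :=
    differentiableAt_cauchyTransform_dbarForm hC hh hρ (notMem_span_single hij hik hv')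
  have hprim := differentiableAt_smoothPrimitive (ρ := ρ) hC hh hv
  refine differentiableAt_of_dbar_eq_zero (hprim.sub hdiff) fun e => ?_
  rw [dbar_sub hprim hdiff, hdbar, dbarForm_eq hC hh hv, sub_self]

end ConicalPartition

/-- Correcting the smooth primitive by a Cauchy transform along a line makes it holomorphic away
from that line, hence everywhere by Hartogs; the transform keeps the homogeneity of the cocycle. -/
theorem IsHolomorphicCocycle.exists_primitive (hn : 2 < Fintype.card n) (hC : IsConicalCover C)
    (hh : IsHolomorphicCocycle C h) :
    ∃ g : ι → (n → ℂ) → ℂ, (∀ a, DifferentiableOn ℂ (g a) (C a)) ∧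
      (∀ a b, ∀ v ∈ C a ∩ C b, h a b v = g b v - g a v) ∧
      ∀ μ c : ℂ, μ ≠ 0 → (∀ a b, ∀ v ∈ C a ∩ C b, h a b (μ • v) = c * h a b v) →
        ∀ a, ∀ v ∈ C a, g a (μ • v) = c * g a v := by
  classical
  obtain ⟨i, j, k, hij, hik, hjk⟩ := Fintype.two_lt_card_iff.1 hn
  obtain ⟨ρ, a₀, hρ⟩ := hC.exists_conicalPartition (e₀ := Pi.single i 1) (by simp)
  choose F hF hFeq using
    ConicalPartition.exists_holomorphic_correction (ρ := ρ) hC hh hij hik hjk hρ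
  have hFc : ∀ {a v}, v ∈ C a → ContinuousAt (F a) v := fun {a v} hv =>
    ((hF a).differentiableAt ((hC.isOpen a).mem_nhds hv)).continuousAt
  refine ⟨F, hF, fun a b v hv => ?_, fun μ c hμ hhom a v hv => ?_⟩
  · have hopen := (hC.isOpen a).inter (hC.isOpen b)
    refine eq_of_eq_off_codim_two (j := j) (k := k) (g := fun v => F b v - F a v) hopen hv
      ((hh.differentiableOn a b).differentiableAt (hopen.mem_nhds hv)).continuousAt
      ((hFc hv.2).sub (hFc hv.1)) fun x hx hx' => ?_
    rw [hFeq a x hx.1 hx', hFeq b x hx.2 hx', sub_sub_sub_cancel_right,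
      ConicalPartition.smoothPrimitive_sub hC hh hx.1 hx.2]
  · refine eq_of_eq_off_codim_two (j := j) (k := k) (f := fun v => F a (μ • v))
      (g := fun v => c * F a v) (hC.isOpen a) hv ?_ (continuousAt_const.mul (hFc hv))
      fun x hx hx' => ?_
    · exact ContinuousAt.comp (f := fun v : n → ℂ => μ • v) (hFc (hC.smul_mem hμ hv)) (by fun_prop)
    · rw [hFeq a x hx hx', hFeq a _ (hC.smul_mem hμ hx) (by simpa [hμ] using hx'), mul_sub,
        ConicalPartition.smoothPrimitive_smul hC hμ hhom hx,
        ConicalPartition.cauchyTransform_dbarForm_smul hC hh hμ hhom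
          (notMem_span_single hij hik hx')]

end ConicalCousinProblem

/-! ### The branched cover and its cone -/

section Roots

/-- The open sector on which `w ↦ w ^ b` is injective with values in the slit plane. -/
def sector (b : ℕ) : Set ℂ := {w | w ≠ 0 ∧ |w.arg| < Real.pi / b}

variable {b : ℕ}

theorem one_mem_sector (hb : b ≠ 0) : (1 : ℂ) ∈ sector b :=
  ⟨one_ne_zero, by simpa using div_pos Real.pi_pos (Nat.cast_pos.2 (Nat.pos_of_ne_zero hb))⟩

theorem sector_subset_slitPlane (hb : b ≠ 0) : sector b ⊆ Complex.slitPlane := by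
  rintro w ⟨hw, harg⟩
  have hle : Real.pi / b ≤ Real.pi :=
    div_le_self Real.pi_pos.le (by exact_mod_cast Nat.one_le_iff_ne_zero.2 hb)
  exact Complex.mem_slitPlane_iff_arg.2 ⟨((le_abs_self _).trans_lt (harg.trans_le hle)).ne, hw⟩

theorem isOpen_sector (hb : b ≠ 0) : IsOpen (sector b) := by
  have heq : sector b = Complex.slitPlane ∩ (fun w : ℂ => |w.arg|) ⁻¹' Iio (Real.pi / b) :=
    Subset.antisymm (fun w hw => ⟨sector_subset_slitPlane hb hw, hw.2⟩)
      fun w hw => ⟨Complex.slitPlane_ne_zero hw.1, hw.2⟩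
  rw [heq]
  exact ContinuousOn.isOpen_inter_preimage
    (fun w hw => (Complex.continuousAt_arg hw).abs.continuousWithinAt) Complex.isOpen_slitPlane
    isOpen_Iio

theorem exp_mem_slitPlane_of_abs_im_lt {z : ℂ} (hz : |z.im| < Real.pi) :
    Complex.exp z ∈ Complex.slitPlane := by
  obtain ⟨hlo, hhi⟩ := abs_lt.1 hz
  rw [Complex.exp_mem_slitPlane, (toIocMod_eq_self Real.two_pi_pos).2 ⟨hlo, by linarith⟩]
  exact hhi.ne

theorem pow_mem_slitPlane (hb : b ≠ 0) {w : ℂ} (hw : w ∈ sector b) :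
    w ^ b ∈ Complex.slitPlane := by
  have hb0 : (0 : ℝ) < b := Nat.cast_pos.2 (Nat.pos_of_ne_zero hb)
  rw [← Complex.exp_log hw.1, ← Complex.exp_nat_mul]
  refine exp_mem_slitPlane_of_abs_im_lt ?_
  rw [← nsmul_eq_mul, Complex.smul_im, Complex.log_im, nsmul_eq_mul, abs_mul, Nat.abs_cast]
  exact (lt_div_iff₀' hb0).1 hw.2

theorem pow_cpow_inv_of_mem_sector (hb : b ≠ 0) {w : ℂ} (hw : w ∈ sector b) :
    (w ^ b) ^ ((b : ℂ)⁻¹) = w :=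
  Complex.pow_cpow_nat_inv hb (abs_lt.1 hw.2).1 (abs_lt.1 hw.2).2.le

theorem abs_arg_lt_pi_of_mem_slitPlane {z : ℂ} (hz : z ∈ Complex.slitPlane) :
    |z.arg| < Real.pi :=
  abs_lt.2 ⟨Complex.neg_pi_lt_arg z,
    (Complex.arg_le_pi z).lt_of_ne (Complex.mem_slitPlane_iff_arg.1 hz).1⟩

theorem cpow_inv_mem_sector (hb : b ≠ 0) {z : ℂ} (hz : z ∈ Complex.slitPlane) :
    z ^ ((b : ℂ)⁻¹) ∈ sector b := by
  have hb1 : (1 : ℝ) ≤ b := by exact_mod_cast Nat.one_le_iff_ne_zero.2 hb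
  have him : (Complex.log z * (b : ℂ)⁻¹).im = z.arg / b := by
    rw [← div_eq_mul_inv, Complex.div_natCast_im, Complex.log_im]
  have hlt : |z.arg / b| < Real.pi / b := by
    rw [abs_div, Nat.abs_cast]
    have := abs_arg_lt_pi_of_mem_slitPlane hz
    gcongr
  obtain ⟨hlo, hhi⟩ := abs_lt.1 (hlt.trans_le (div_le_self Real.pi_pos.le hb1))
  rw [Complex.cpow_def_of_ne_zero (Complex.slitPlane_ne_zero hz)]
  refine ⟨Complex.exp_ne_zero _, ?_⟩
  rw [Complex.arg_exp, him, (toIocMod_eq_self Real.two_pi_pos).2 ⟨hlo, by linarith⟩]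
  exact hlt

theorem contDiffAt_cpow_inv {n : ℕ∞ω} {z : ℂ} (hz : z ∈ Complex.slitPlane) :
    ContDiffAt ℂ n (fun z : ℂ => z ^ ((b : ℂ)⁻¹)) z := by
  have hexp : ContDiffAt ℂ n (fun z => Complex.exp (Complex.log z * (b : ℂ)⁻¹)) z :=
    Complex.contDiff_exp.contDiffAt.comp z ((Complex.contDiffAt_log hz).mul contDiffAt_const)
  refine hexp.congr_of_eventuallyEq ?_
  filter_upwards [Complex.isOpen_slitPlane.mem_nhds hz] with x hx
  rw [Complex.cpow_def_of_ne_zero (Complex.slitPlane_ne_zero hx)]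

end Roots

section Surface

/-- A finite family of linear forms in general position on `ℂ³`, with branching orders `b i` that
divide `N`, such that three of the forms, indexed by `base`, have order `N`. -/
structure BranchData (ι : Type*) where
  L : ι → ℂ³ →L[ℂ] ℂ
  b : ι → ℕ
  d : ι → ℕ
  N : ℕ
  base : Fin 3 ↪ ι
  N_ne_zero : N ≠ 0
  d_mul_b : ∀ i, d i * b i = N
  d_base : ∀ k, d (base k) = 1
  independent : ∀ i j k, i ≠ j → i ≠ k → j ≠ k → ∀ v, L i v = 0 → L j v = 0 → L k v = 0 → v = 0

namespace BranchData

variable {ι : Type*}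

section Weights

variable (A : BranchData ι)

theorem b_ne_zero (i : ι) : A.b i ≠ 0 :=
  right_ne_zero_of_mul (A.d_mul_b i ▸ A.N_ne_zero)

theorem d_ne_zero (i : ι) : A.d i ≠ 0 :=
  left_ne_zero_of_mul (A.d_mul_b i ▸ A.N_ne_zero)

theorem b_eq_of_d_eq_one {k : ι} (hk : A.d k = 1) : A.b k = A.N := by
  rw [← A.d_mul_b k, hk, one_mul]

theorem exists_weight_one (i j : ι) : ∃ k, k ≠ i ∧ k ≠ j ∧ A.d k = 1 := by
  classical
  obtain ⟨_, hmem, hk⟩ := Finset.exists_mem_notMem_of_card_lt_card (s := {i, j})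
    (t := Finset.univ.map A.base) (Finset.card_le_two.trans_lt (by simp))
  obtain ⟨k, -, rfl⟩ := Finset.mem_map.1 hmem
  simp only [Finset.mem_insert, Finset.mem_singleton, not_or] at hk
  exact ⟨A.base k, hk.1, hk.2, A.d_base k⟩

theorem eq_of_forall_L {v w : ℂ³} (h : ∀ i, A.L i v = A.L i w) : v = w := by
  have hsub : ∀ i, A.L i (v - w) = 0 := fun i => by rw [map_sub, h, sub_self]
  have hbase : ∀ k l, k ≠ l → A.base k ≠ A.base l := fun _ _ => A.base.injective.ne
  exact sub_eq_zero.1 (A.independent _ _ _ (hbase 0 1 (by decide)) (hbase 0 2 (by decide))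
    (hbase 1 2 (by decide)) _ (hsub _) (hsub _) (hsub _))

/-- Three of the linear forms as coordinates on `ℂ³`. -/
noncomputable def formsEquiv {i j k : ι} (hij : i ≠ j) (hik : i ≠ k) (hjk : j ≠ k) :
    ℂ³ ≃L[ℂ] ℂ³ :=
  (LinearEquiv.ofInjectiveEndo (LinearMap.pi ![(A.L i : ℂ³ →ₗ[ℂ] ℂ), A.L j, A.L k])
    ((injective_iff_map_eq_zero _).2 fun v hv => A.independent i j k hij hik hjk v
      (congrFun hv 0) (congrFun hv 1) (congrFun hv 2))).toContinuousLinearEquiv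

theorem formsEquiv_apply {i j k : ι} (hij : i ≠ j) (hik : i ≠ k) (hjk : j ≠ k) (v : ℂ³) :
    A.formsEquiv hij hik hjk v = ![A.L i v, A.L j v, A.L k v] := by
  ext a
  fin_cases a <;> rfl

theorem exists_dual {i j k : ι} (hij : i ≠ j) (hik : i ≠ k) (hjk : j ≠ k) :
    ∃ e, A.L i e = 1 ∧ A.L j e = 0 ∧ A.L k e = 0 := by
  have happly := A.formsEquiv_apply hij hik hjk ((A.formsEquiv hij hik hjk).symm ![1, 0, 0])
  rw [ContinuousLinearEquiv.apply_symm_apply] at happly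
  exact ⟨_, (congrFun happly 0).symm, (congrFun happly 1).symm, (congrFun happly 2).symm⟩

end Weights

section Cone

/-- The affine cone over the branched cover, without its vertex: points of `ℂ³ ∖ 0` with a choice
of a `b i`-th root `y i` of each form `L i`. -/
def Cone (A : BranchData ι) : Type _ :=
  {x : ℂ³ × (ι → ℂ) // x.1 ≠ 0 ∧ ∀ i, x.2 i ^ A.b i = A.L i x.1}

variable {A : BranchData ι}

instance : TopologicalSpace A.Cone := inferInstanceAs (TopologicalSpace
  {x : ℂ³ × (ι → ℂ) // x.1 ≠ 0 ∧ ∀ i, x.2 i ^ A.b i = A.L i x.1})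

namespace Cone

/-- The point of `ℂ³` under a point of the cone. -/
def v (x : A.Cone) : ℂ³ := x.1.1

/-- The chosen roots. -/
def y (x : A.Cone) : ι → ℂ := x.1.2

/-- The `m`-th root of a point of the cone, rescaled by the action so that the `k`-th one is `1`
(when `d k = 1`). -/
noncomputable def normalizedRoot (k : ι) (x : A.Cone) (m : ι) : ℂ := x.y m / x.y k ^ A.d m

theorem v_ne_zero (x : A.Cone) : x.v ≠ 0 := x.2.1

theorem y_pow (x : A.Cone) (i : ι) : x.y i ^ A.b i = A.L i x.v := x.2.2 i

theorem ext {x x' : A.Cone} (hv : x.v = x'.v) (hy : x.y = x'.y) : x = x' :=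
  Subtype.ext (Prod.ext hv hy)

theorem continuous_v : Continuous (v : A.Cone → ℂ³) :=
  continuous_fst.comp continuous_subtype_val

theorem continuous_y_apply (i : ι) : Continuous fun x : A.Cone => x.y i :=
  (continuous_apply i).comp (continuous_snd.comp continuous_subtype_val)

def mk (v : ℂ³) (y : ι → ℂ) (hv : v ≠ 0) (hy : ∀ i, y i ^ A.b i = A.L i v) : A.Cone :=
  ⟨(v, y), hv, hy⟩

@[simp] theorem mk_v (v : ℂ³) (y : ι → ℂ) (hv : v ≠ 0) (hy : ∀ i, y i ^ A.b i = A.L i v) :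
    (mk (A := A) v y hv hy).v = v := rfl

@[simp] theorem mk_y (v : ℂ³) (y : ι → ℂ) (hv : v ≠ 0) (hy : ∀ i, y i ^ A.b i = A.L i v) :
    (mk (A := A) v y hv hy).y = y := rfl

theorem continuous_of_coords {X : Type*} [TopologicalSpace X] {f : X → A.Cone}
    (hv : Continuous fun x => (f x).v) (hy : ∀ i, Continuous fun x => (f x).y i) : Continuous f :=
  Continuous.subtype_mk (f := fun x => ((f x).v, (f x).y)) (hv.prodMk (continuous_pi hy))
    fun x => (f x).2

theorem y_eq_zero_iff (x : A.Cone) (i : ι) : x.y i = 0 ↔ A.L i x.v = 0 := by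
  rw [← x.y_pow i, pow_eq_zero_iff (A.b_ne_zero i)]

instance : MulAction ℂˣ A.Cone where
  smul c x := mk ((c : ℂ) ^ A.N • x.v) (fun i => (c : ℂ) ^ A.d i * x.y i)
    (smul_ne_zero (pow_ne_zero _ c.ne_zero) x.v_ne_zero) fun i => by
      rw [mul_pow, ← pow_mul, A.d_mul_b, x.y_pow, map_smul, smul_eq_mul]
  one_smul x := Cone.ext
    (show ((1 : ℂˣ) : ℂ) ^ A.N • x.v = x.v by simp)
    (show (fun i => ((1 : ℂˣ) : ℂ) ^ A.d i * x.y i) = x.y by simp)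
  mul_smul c c' x := Cone.ext
    (show ((c * c' : ℂˣ) : ℂ) ^ A.N • x.v = (c : ℂ) ^ A.N • ((c' : ℂ) ^ A.N • x.v) by
      rw [smul_smul, ← mul_pow, Units.val_mul])
    (show (fun i => ((c * c' : ℂˣ) : ℂ) ^ A.d i * x.y i) =
        fun i => (c : ℂ) ^ A.d i * ((c' : ℂ) ^ A.d i * x.y i) by
      ext i
      rw [← mul_assoc, ← mul_pow, Units.val_mul])

@[simp] theorem smul_v (c : ℂˣ) (x : A.Cone) : (c • x).v = (c : ℂ) ^ A.N • x.v := rfl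

@[simp] theorem smul_y (c : ℂˣ) (x : A.Cone) (i : ι) :
    (c • x).y i = (c : ℂ) ^ A.d i * x.y i := rfl

theorem normalizedRoot_smul {k : ι} (hk : A.d k = 1) (c : ℂˣ) (x : A.Cone) (m : ι) :
    normalizedRoot k (c • x) m = normalizedRoot k x m := by
  rw [normalizedRoot, smul_y, smul_y, hk, pow_one, mul_pow]
  exact mul_div_mul_left _ _ (pow_ne_zero _ c.ne_zero)

theorem continuousAt_normalizedRoot {k : ι} {x : A.Cone} (hk : x.y k ≠ 0) (m : ι) :
    ContinuousAt (fun x : A.Cone => normalizedRoot k x m) x :=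
  (continuous_y_apply m).continuousAt.div ((continuous_y_apply k).pow _).continuousAt
    (pow_ne_zero _ hk)

instance : ContinuousConstSMul ℂˣ A.Cone where
  continuous_const_smul c := continuous_of_coords
    ((continuous_const (y := (c : ℂ) ^ A.N)).smul continuous_v) fun i =>
    continuous_const.mul (continuous_y_apply i)

theorem exists_pair (x : A.Cone) : ∃ i j, i ≠ j ∧ ∀ m, m ≠ i → m ≠ j → x.y m ≠ 0 := by
  by_contra! hcon
  obtain ⟨m₁, -, -, hm₁⟩ := hcon _ _ (A.base.injective.ne zero_ne_one)
  obtain ⟨k, hk, -, -⟩ := A.exists_weight_one m₁ m₁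
  obtain ⟨m₂, h₂₁, -, hm₂⟩ := hcon m₁ k hk.symm
  obtain ⟨m₃, h₃₁, h₃₂, hm₃⟩ := hcon m₁ m₂ h₂₁.symm
  exact x.v_ne_zero (A.independent m₁ m₂ m₃ h₂₁.symm h₃₁.symm h₃₂.symm x.v
    ((x.y_eq_zero_iff _).1 hm₁) ((x.y_eq_zero_iff _).1 hm₂) ((x.y_eq_zero_iff _).1 hm₃))

theorem exists_weight_one_ne_zero (x : A.Cone) : ∃ k, A.d k = 1 ∧ x.y k ≠ 0 := by
  obtain ⟨i, j, -, hy⟩ := x.exists_pair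
  obtain ⟨k, hki, hkj, hk⟩ := A.exists_weight_one i j
  exact ⟨k, hk, hy k hki hkj⟩

theorem exists_smul_mem_sphere (x : A.Cone) : ∃ c : ℂˣ, (c • x).v ∈ sphere (0 : ℂ³) 1 := by
  have hv : ‖x.v‖ ≠ 0 := norm_ne_zero_iff.2 x.v_ne_zero
  obtain ⟨c, hc⟩ := IsAlgClosed.exists_pow_nat_eq ((‖x.v‖ : ℂ)⁻¹) (Nat.pos_of_ne_zero A.N_ne_zero)
  have hc0 : c ≠ 0 := by
    rintro rfl
    rw [zero_pow A.N_ne_zero] at hc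
    exact inv_ne_zero (by exact_mod_cast hv) hc.symm
  exact ⟨Units.mk0 c hc0, by simp [hc, norm_smul, hv]⟩

theorem isCompact_setOf_pow_eq [Finite ι] {K : Set ℂ³} (hK : IsCompact K) :
    IsCompact {q : ℂ³ × (ι → ℂ) | q.1 ∈ K ∧ ∀ i, q.2 i ^ A.b i = A.L i q.1} := by
  obtain ⟨R, hR⟩ : ∃ R, ∀ v ∈ K, ∀ i, ‖A.L i v‖ ≤ R := by
    choose R hR using fun i => hK.exists_bound_of_continuousOn (A.L i).continuous.continuousOn
    obtain ⟨B, hB⟩ := Finite.bddAbove_range R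
    exact ⟨B, fun v hv i => (hR i v hv).trans (hB (mem_range_self i))⟩
  cases nonempty_fintype ι
  have hsub : {q : ℂ³ × (ι → ℂ) | q.1 ∈ K ∧ ∀ i, q.2 i ^ A.b i = A.L i q.1} ⊆
      K ×ˢ closedBall 0 (max R 1) := by
    rintro ⟨v, y⟩ ⟨hv, hy⟩
    refine ⟨hv, mem_closedBall_zero_iff.2 ?_⟩
    refine (pi_norm_le_iff_of_nonneg (by positivity)).2 fun i => ?_
    by_contra! hlt
    have hpow : ‖y i‖ ≤ ‖y i‖ ^ A.b i :=
      le_self_pow₀ ((le_max_right R 1).trans hlt.le) (A.b_ne_zero i)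
    have hbound : ‖y i‖ ^ A.b i ≤ R := by rw [← norm_pow, hy i]; exact hR v hv i
    linarith [le_max_left R 1]
  refine IsCompact.of_isClosed_subset (hK.prod (isCompact_closedBall _ _)) ?_ hsub
  have hclosed : IsClosed {q : ℂ³ × (ι → ℂ) | ∀ i, q.2 i ^ A.b i = A.L i q.1} := by
    simp only [ofPred_forall]
    exact isClosed_iInter fun i => isClosed_eq (by fun_prop) (by fun_prop)
  exact (hK.isClosed.preimage continuous_fst).inter hclosed

theorem isCompact_preimage_v [Finite ι] {K : Set ℂ³} (hK : IsCompact K) (hK0 : (0 : ℂ³) ∉ K) :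
    IsCompact (v ⁻¹' K : Set A.Cone) := by
  have hrange : {q : ℂ³ × (ι → ℂ) | q.1 ∈ K ∧ ∀ i, q.2 i ^ A.b i = A.L i q.1} ⊆
      range (Subtype.val : A.Cone → ℂ³ × (ι → ℂ)) := fun q hq =>
    ⟨⟨q, fun hq0 => hK0 (hq0 ▸ hq.1), hq.2⟩, rfl⟩
  have hpreimage : (v ⁻¹' K : Set A.Cone) =
      Subtype.val ⁻¹' {q : ℂ³ × (ι → ℂ) | q.1 ∈ K ∧ ∀ i, q.2 i ^ A.b i = A.L i q.1} :=
    Set.ext fun x => ⟨fun hx => ⟨hx, x.2.2⟩, fun hx => hx.1⟩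
  rw [hpreimage]
  exact (IsInducing.subtypeVal.isCompact_preimage_iff hrange).2 (isCompact_setOf_pow_eq hK)

end Cone

end Cone

variable {A : BranchData ι}

variable (A) in
/-- The branched cover of the projective plane: the quotient of the cone by the weighted action of
`ℂˣ`. -/
def Surface : Type _ := MulAction.orbitRel.Quotient ℂˣ A.Cone

instance : TopologicalSpace A.Surface :=
  inferInstanceAs (TopologicalSpace (Quotient (MulAction.orbitRel ℂˣ A.Cone)))

/-- The projection from the cone to the surface. -/
def proj (x : A.Cone) : A.Surface := Quotient.mk (MulAction.orbitRel ℂˣ A.Cone) x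

theorem isOpenQuotientMap_proj : IsOpenQuotientMap (proj : A.Cone → A.Surface) :=
  MulAction.isOpenQuotientMap_quotientMk

theorem proj_surjective : Function.Surjective (proj : A.Cone → A.Surface) :=
  isOpenQuotientMap_proj.surjective

theorem continuous_proj : Continuous (proj : A.Cone → A.Surface) :=
  isOpenQuotientMap_proj.continuous

theorem proj_eq_iff {x x' : A.Cone} : proj x = proj x' ↔ ∃ c : ℂˣ, c • x' = x :=
  Quotient.eq (r := MulAction.orbitRel ℂˣ A.Cone)

theorem proj_smul (c : ℂˣ) (x : A.Cone) : proj (c • x) = proj x := proj_eq_iff.2 ⟨c, rfl⟩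

/-- Functions on the surface from invariant functions on the cone. -/
def lift {X : Type*} (f : A.Cone → X) (hf : ∀ (c : ℂˣ) x, f (c • x) = f x) : A.Surface → X :=
  Quotient.lift f fun _ x ⟨c, hc⟩ => by rw [← hc]; exact hf c x

theorem proj_eq_of_y_eq {x x' : A.Cone} {c : ℂ} (hc : c ≠ 0)
    (h : ∀ i, x'.y i = c ^ A.d i * x.y i) : proj x' = proj x := by
  refine proj_eq_iff.2 ⟨Units.mk0 c hc, (Cone.ext (A.eq_of_forall_L fun i => ?_) (funext h)).symm⟩
  rw [Cone.smul_v, map_smul, ← x'.y_pow, h, mul_pow, ← pow_mul, A.d_mul_b, x.y_pow]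
  rfl

theorem proj_eq_iff_cross {x x' : A.Cone} : proj x = proj x' ↔
    ∀ k m, A.d k = 1 → x.y m * x'.y k ^ A.d m = x'.y m * x.y k ^ A.d m := by
  constructor
  · intro h k m hk
    obtain ⟨c, rfl⟩ := proj_eq_iff.1 h
    simp only [Cone.smul_y, hk, pow_one, mul_pow]
    ring
  · intro h
    obtain ⟨k, hk, hxk⟩ := x.exists_weight_one_ne_zero
    have hx'k : x'.y k ≠ 0 := by
      intro hx'k
      obtain ⟨m, -, hx'm⟩ := x'.exists_weight_one_ne_zero
      have hcross := h k m hk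
      rw [hx'k, zero_pow (A.d_ne_zero m), mul_zero] at hcross
      exact mul_ne_zero hx'm (pow_ne_zero _ hxk) hcross.symm
    refine proj_eq_of_y_eq (c := x.y k / x'.y k) (div_ne_zero hxk hx'k) fun i => ?_
    rw [div_pow, div_mul_eq_mul_div, eq_div_iff (pow_ne_zero _ hx'k), h k i hk, mul_comm]

instance : T2Space A.Surface := by
  rw [t2Space_iff_of_isOpenQuotientMap (isOpenQuotientMap_proj (A := A))]
  simp only [proj_eq_iff_cross, ofPred_forall]
  refine isClosed_iInter fun k => isClosed_iInter fun m => isClosed_iInter fun _ => ?_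
  have hfst : ∀ i, Continuous fun q : A.Cone × A.Cone => q.1.y i := fun i =>
    (Cone.continuous_y_apply i).comp continuous_fst
  have hsnd : ∀ i, Continuous fun q : A.Cone × A.Cone => q.2.y i := fun i =>
    (Cone.continuous_y_apply i).comp continuous_snd
  exact isClosed_eq ((hfst m).mul ((hsnd k).pow _)) ((hsnd m).mul ((hfst k).pow _))

instance [Finite ι] : CompactSpace A.Surface := by
  have himage := (Cone.isCompact_preimage_v (A := A) (isCompact_sphere (0 : ℂ³) 1)
    (by simp)).image continuous_proj
  refine ⟨himage.of_isClosed_subset isClosed_univ fun q _ => ?_⟩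
  obtain ⟨x, rfl⟩ := proj_surjective q
  obtain ⟨c, hc⟩ := x.exists_smul_mem_sphere
  exact ⟨c • x, hc, proj_smul c x⟩

end BranchData

end Surface

/-! ### Charts -/

section Charts

namespace BranchData

variable {ι : Type*} {A : BranchData ι}

variable (A) in
/-- The data of a chart: the coordinates are the normalized roots with indices `i` and `j`, the
normalization is `y k = 1`, and the `c m` select branches of the other roots. -/
structure ChartIndex where
  i : ι
  j : ι
  k : ι
  i_ne_j : i ≠ j
  k_ne_i : k ≠ i
  k_ne_j : k ≠ j
  d_k : A.d k = 1
  c : ι → ℂ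
  c_ne_zero : ∀ m, c m ≠ 0

namespace ChartIndex

variable (p : A.ChartIndex)

/-- The indices whose roots are functions of the two coordinates. -/
def IsDependent (m : ι) : Prop := m ≠ p.i ∧ m ≠ p.j ∧ m ≠ p.k

theorem eq_or_isDependent (m : ι) : m = p.i ∨ m = p.j ∨ m = p.k ∨ p.IsDependent m := by
  by_cases hi : m = p.i
  · exact .inl hi
  by_cases hj : m = p.j
  · exact .inr (.inl hj)
  by_cases hk : m = p.k
  · exact .inr (.inr (.inl hk))
  exact .inr (.inr (.inr ⟨hi, hj, hk⟩))

/-- The coordinates of `ℂ³` adapted to the chart. -/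
noncomputable def frame : ℂ³ ≃L[ℂ] ℂ³ := A.formsEquiv p.k_ne_i p.k_ne_j p.i_ne_j

theorem frame_apply (v : ℂ³) : p.frame v = ![A.L p.k v, A.L p.i v, A.L p.j v] :=
  A.formsEquiv_apply _ _ _ v

/-- The powers of the chart coordinates that are the values of the forms `L k`, `L i`, `L j`. -/
noncomputable def powers (z : ℂ²) : ℂ³ := ![1, z 0 ^ A.b p.i, z 1 ^ A.b p.j]

/-- The vector of `ℂ³` under the point with given coordinates. -/
noncomputable def vec (z : ℂ²) : ℂ³ := p.frame.symm (p.powers z)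

theorem frame_vec (z : ℂ²) : p.frame (p.vec z) = p.powers z := p.frame.apply_symm_apply _

theorem L_k_vec (z : ℂ²) : A.L p.k (p.vec z) = 1 :=
  congrFun ((p.frame_apply _).symm.trans (p.frame_vec z)) 0

theorem L_i_vec (z : ℂ²) : A.L p.i (p.vec z) = z 0 ^ A.b p.i :=
  congrFun ((p.frame_apply _).symm.trans (p.frame_vec z)) 1

theorem L_j_vec (z : ℂ²) : A.L p.j (p.vec z) = z 1 ^ A.b p.j :=
  congrFun ((p.frame_apply _).symm.trans (p.frame_vec z)) 2

theorem vec_ne_zero (z : ℂ²) : p.vec z ≠ 0 := fun hvec => by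
  simpa [hvec] using p.L_k_vec z

theorem contDiff_powers {n : ℕ∞ω} : ContDiff ℂ n p.powers := by
  refine contDiff_pi.2 fun a => ?_
  fin_cases a
  · exact contDiff_const
  · exact (contDiff_apply ℂ ℂ (0 : Fin 2)).pow _
  · exact (contDiff_apply ℂ ℂ (1 : Fin 2)).pow _

theorem contDiff_vec {n : ℕ∞ω} : ContDiff ℂ n p.vec := p.frame.symm.contDiff.comp p.contDiff_powers

theorem continuous_vec : Continuous p.vec := (p.contDiff_vec (n := 0)).continuous

open Classical in
/-- The roots at the point with given coordinates. -/
noncomputable def root (z : ℂ²) (m : ι) : ℂ :=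
  if m = p.i then z 0 else if m = p.j then z 1 else if m = p.k then 1 else
    p.c m * (A.L m (p.vec z) / p.c m ^ A.b m) ^ ((A.b m : ℂ)⁻¹)

@[simp] theorem root_i (z : ℂ²) : p.root z p.i = z 0 := if_pos rfl

@[simp] theorem root_j (z : ℂ²) : p.root z p.j = z 1 := by
  rw [root, if_neg p.i_ne_j.symm, if_pos rfl]

@[simp] theorem root_k (z : ℂ²) : p.root z p.k = 1 := by
  rw [root, if_neg p.k_ne_i, if_neg p.k_ne_j, if_pos rfl]

theorem root_of_isDependent (z : ℂ²) {m : ι} (hm : p.IsDependent m) :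
    p.root z m = p.c m * (A.L m (p.vec z) / p.c m ^ A.b m) ^ ((A.b m : ℂ)⁻¹) := by
  rw [root, if_neg hm.1, if_neg hm.2.1, if_neg hm.2.2]

theorem root_pow (z : ℂ²) (m : ι) : p.root z m ^ A.b m = A.L m (p.vec z) := by
  rcases p.eq_or_isDependent m with rfl | rfl | rfl | hm
  · rw [root_i, L_i_vec]
  · rw [root_j, L_j_vec]
  · rw [root_k, L_k_vec, one_pow]
  · rw [p.root_of_isDependent z hm, mul_pow, Complex.cpow_nat_inv_pow _ (A.b_ne_zero m),
      mul_div_cancel₀ _ (pow_ne_zero _ (p.c_ne_zero m))]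

/-- The point of the cone with given coordinates. -/
noncomputable def point (z : ℂ²) : A.Cone :=
  Cone.mk (p.vec z) (p.root z) (p.vec_ne_zero z) (p.root_pow z)

@[simp] theorem point_y (z : ℂ²) : (p.point z).y = p.root z := rfl

/-- The coordinates of a point of the cone. -/
noncomputable def coord (x : A.Cone) : ℂ² :=
  ![Cone.normalizedRoot p.k x p.i, Cone.normalizedRoot p.k x p.j]

theorem coord_smul (c : ℂˣ) (x : A.Cone) : p.coord (c • x) = p.coord x := by
  rw [coord, coord, Cone.normalizedRoot_smul p.d_k, Cone.normalizedRoot_smul p.d_k]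

theorem coord_point (z : ℂ²) : p.coord (p.point z) = z := by
  ext a
  fin_cases a <;> simp [coord, Cone.normalizedRoot]

/-- The condition that a point of the cone lies over the domain of the chart. -/
def Mem (x : A.Cone) : Prop :=
  x.y p.k ≠ 0 ∧ ∀ m, p.IsDependent m → Cone.normalizedRoot p.k x m / p.c m ∈ sector (A.b m)

theorem mem_smul (c : ℂˣ) (x : A.Cone) : p.Mem (c • x) = p.Mem x := by
  simp only [Mem, Cone.normalizedRoot_smul p.d_k]
  simp [p.d_k]

/-- The domain of the chart. -/
def source : Set A.Surface := {q | lift p.Mem p.mem_smul q}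

@[simp] theorem proj_mem_source {x : A.Cone} : proj x ∈ p.source ↔ p.Mem x := Iff.rfl

/-- The range of the chart. -/
def target : Set ℂ² :=
  {z | ∀ m, p.IsDependent m → A.L m (p.vec z) / p.c m ^ A.b m ∈ Complex.slitPlane}

theorem isOpen_target [Finite ι] : IsOpen p.target := by
  simp only [target, ofPred_forall]
  refine isOpen_iInter_of_finite fun m => isOpen_iInter_of_finite fun _ => ?_
  exact Complex.isOpen_slitPlane.preimage (((A.L m).continuous.comp p.continuous_vec).div_const _)

theorem isOpen_source [Finite ι] : IsOpen p.source := by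
  refine isOpenQuotientMap_proj.isQuotientMap.isOpen_preimage.1 (isOpen_iff_mem_nhds.2 ?_)
  rintro x ⟨hk, hsector⟩
  refine ((Cone.continuous_y_apply p.k).continuousAt.eventually_ne hk).and
    (eventually_all.2 fun m => eventually_imp_distrib_left.2 fun hm => ?_)
  exact ((Cone.continuousAt_normalizedRoot hk m).div_const _).eventually_mem
    ((isOpen_sector (A.b_ne_zero m)).mem_nhds (hsector m hm))

theorem vec_coord {x : A.Cone} (hx : x.y p.k ≠ 0) :
    p.vec (p.coord x) = ((x.y p.k)⁻¹ ^ A.N) • x.v := by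
  have hpower : ∀ m, Cone.normalizedRoot p.k x m ^ A.b m = (x.y p.k)⁻¹ ^ A.N * A.L m x.v := by
    intro m
    rw [Cone.normalizedRoot, div_pow, ← pow_mul, A.d_mul_b, x.y_pow, inv_pow, inv_mul_eq_div]
  have hk : (x.y p.k)⁻¹ ^ A.N * A.L p.k x.v = 1 := by
    rw [← x.y_pow, A.b_eq_of_d_eq_one p.d_k, ← mul_pow, inv_mul_cancel₀ hx, one_pow]
  refine p.frame.injective ?_
  rw [frame_vec, map_smul, frame_apply]
  ext a
  fin_cases a
  · exact hk.symm
  · exact hpower p.i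
  · exact hpower p.j

theorem L_vec_coord {x : A.Cone} (hx : x.y p.k ≠ 0) (m : ι) :
    A.L m (p.vec (p.coord x)) / p.c m ^ A.b m =
      (Cone.normalizedRoot p.k x m / p.c m) ^ A.b m := by
  rw [p.vec_coord hx, map_smul, ← x.y_pow, div_pow, Cone.normalizedRoot, div_pow, ← pow_mul,
    A.d_mul_b, smul_eq_mul, inv_pow, inv_mul_eq_div]

theorem root_coord {x : A.Cone} (hx : p.Mem x) (m : ι) :
    p.root (p.coord x) m = (x.y p.k)⁻¹ ^ A.d m * x.y m := by
  rw [inv_pow, inv_mul_eq_div, ← Cone.normalizedRoot]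
  rcases p.eq_or_isDependent m with rfl | rfl | rfl | hm
  · rw [root_i, coord, Matrix.cons_val_zero]
  · rw [root_j, coord, Matrix.cons_val_one, Matrix.cons_val_fin_one]
  · rw [root_k, Cone.normalizedRoot, p.d_k, pow_one, div_self hx.1]
  · rw [p.root_of_isDependent _ hm, p.L_vec_coord hx.1,
      pow_cpow_inv_of_mem_sector (A.b_ne_zero m) (hx.2 m hm), mul_div_cancel₀ _ (p.c_ne_zero m)]

theorem mem_point {z : ℂ²} (hz : z ∈ p.target) : p.Mem (p.point z) := by
  refine ⟨by simp, fun m hm => ?_⟩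
  rw [Cone.normalizedRoot, point_y, root_k, one_pow, div_one, p.root_of_isDependent z hm,
    mul_div_cancel_left₀ _ (p.c_ne_zero m)]
  exact cpow_inv_mem_sector (A.b_ne_zero m) (hz m hm)

theorem contDiffAt_root {n : ℕ∞ω} {z : ℂ²} (hz : z ∈ p.target) (m : ι) :
    ContDiffAt ℂ n (fun z => p.root z m) z := by
  rcases p.eq_or_isDependent m with rfl | rfl | rfl | hm
  · simpa only [root_i] using (contDiff_apply ℂ ℂ (0 : Fin 2)).contDiffAt
  · simpa only [root_j] using (contDiff_apply ℂ ℂ (1 : Fin 2)).contDiffAt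
  · simpa only [root_k] using contDiffAt_const
  simp only [p.root_of_isDependent _ hm]
  refine contDiffAt_const.mul (ContDiffAt.comp z (g := fun w : ℂ => w ^ ((A.b m : ℂ)⁻¹))
    (contDiffAt_cpow_inv (hz m hm)) ?_)
  exact ((A.L m).contDiff.comp p.contDiff_vec).contDiffAt.div_const _

theorem continuousAt_coord {x : A.Cone} (hx : x.y p.k ≠ 0) : ContinuousAt p.coord x := by
  refine continuousAt_pi.2 fun a => ?_
  fin_cases a
  · exact Cone.continuousAt_normalizedRoot hx p.i
  · exact Cone.continuousAt_normalizedRoot hx p.j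

theorem continuousOn_point : ContinuousOn p.point p.target :=
  continuousOn_iff_continuous_domRestrict.2 <| Cone.continuous_of_coords
    (p.continuous_vec.comp continuous_subtype_val) fun m =>
    continuousOn_iff_continuous_domRestrict.1 fun _ hz =>
      (p.contDiffAt_root (n := 0) hz m).continuousAt.continuousWithinAt

theorem coord_mem_target {x : A.Cone} (hx : p.Mem x) : p.coord x ∈ p.target := fun m hm => by
  rw [p.L_vec_coord hx.1]
  exact pow_mem_slitPlane (A.b_ne_zero m) (hx.2 m hm)

theorem proj_point_coord {x : A.Cone} (hx : p.Mem x) : proj (p.point (p.coord x)) = proj x :=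
  proj_eq_of_y_eq (inv_ne_zero hx.1) fun m => p.root_coord hx m

variable [Finite ι]

/-- The chart whose coordinates are two of the normalized roots. -/
noncomputable def chart : OpenPartialHomeomorph A.Surface ℂ² where
  toFun := lift p.coord p.coord_smul
  invFun z := proj (p.point z)
  source := p.source
  target := p.target
  map_source' q hq := by
    obtain ⟨x, rfl⟩ := proj_surjective q
    exact p.coord_mem_target hq
  map_target' z hz := p.mem_point hz
  left_inv' q hq := by
    obtain ⟨x, rfl⟩ := proj_surjective q
    exact p.proj_point_coord hq
  right_inv' z _ := p.coord_point z
  open_source := p.isOpen_source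
  open_target := p.isOpen_target
  continuousOn_toFun q hq := by
    obtain ⟨x, rfl⟩ := proj_surjective q
    refine (isOpenQuotientMap_proj.continuousAt_comp_iff.1 ?_).continuousWithinAt
    exact p.continuousAt_coord hq.1
  continuousOn_invFun := continuous_proj.comp_continuousOn p.continuousOn_point

end ChartIndex

theorem exists_chartIndex_mem (x : A.Cone) : ∃ p : A.ChartIndex, p.Mem x := by
  classical
  obtain ⟨i, j, hij, hy⟩ := x.exists_pair
  obtain ⟨k, hki, hkj, hk⟩ := A.exists_weight_one i j
  have hnormalized : ∀ m, x.y m ≠ 0 → Cone.normalizedRoot k x m ≠ 0 := fun m hm =>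
    div_ne_zero hm (pow_ne_zero _ (hy k hki hkj))
  refine ⟨⟨i, j, k, hij, hki, hkj, hk, fun m => if x.y m = 0 then 1 else Cone.normalizedRoot k x m,
    fun m => ?_⟩, hy k hki hkj, fun m hm => ?_⟩
  · split_ifs with hm
    · exact one_ne_zero
    · exact hnormalized m hm
  · have hym := hy m hm.1 hm.2.1
    simp only [if_neg hym, div_self (hnormalized m hym)]
    exact one_mem_sector (A.b_ne_zero m)

theorem ChartIndex.contDiffAt_coord_comp (p : A.ChartIndex) {E : Type*} [NormedAddCommGroup E]
    [NormedSpace ℂ E] {n : ℕ∞ω} {f : E → A.Cone} {e : E}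
    (hf : ∀ m, ContDiffAt ℂ n (fun e => (f e).y m) e) (hk : (f e).y p.k ≠ 0) :
    ContDiffAt ℂ n (fun e => p.coord (f e)) e := by
  have hroot : ∀ m, ContDiffAt ℂ n (fun e => Cone.normalizedRoot p.k (f e) m) e :=
    fun m => (hf m).div ((hf p.k).pow _) (pow_ne_zero _ hk)
  refine contDiffAt_pi.2 fun a => ?_
  fin_cases a
  · exact hroot p.i
  · exact hroot p.j

theorem contDiffAt_transition {n : ℕ∞ω} (p p' : A.ChartIndex) {z : ℂ²} (hz : z ∈ p.target)
    (hz' : p'.Mem (p.point z)) : ContDiffAt ℂ n (fun z => p'.coord (p.point z)) z :=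
  p'.contDiffAt_coord_comp (fun m => p.contDiffAt_root hz m) hz'.1

variable [Finite ι]

theorem exists_mem_source_chart (q : A.Surface) : ∃ p : A.ChartIndex, q ∈ p.chart.source := by
  obtain ⟨x, rfl⟩ := proj_surjective q
  exact exists_chartIndex_mem x

noncomputable instance : ChartedSpace ℂ² A.Surface where
  atlas := range fun p : A.ChartIndex => p.chart
  chartAt q := (exists_mem_source_chart q).choose.chart
  mem_chart_source q := (exists_mem_source_chart q).choose_spec
  chart_mem_atlas _ := mem_range_self _

theorem ChartIndex.chart_mem_atlas (p : A.ChartIndex) : p.chart ∈ atlas ℂ² A.Surface :=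
  mem_range_self p

instance : IsManifold 𝓘(ℂ, ℂ²) ω A.Surface := by
  refine isManifold_of_contDiffOn _ _ _ ?_
  rintro _ _ ⟨p, rfl⟩ ⟨p', rfl⟩ z hz
  exact (contDiffAt_transition p p' hz.1.1 hz.1.2).contDiffWithinAt

instance : IsManifold 𝓘(ℂ, ℂ²) 1 A.Surface := IsManifold.of_le (n := ω) le_top

theorem mdifferentiableAt_chart (p : A.ChartIndex) {x : A.Cone} (hx : p.Mem x) :
    MDifferentiableAt 𝓘(ℂ, ℂ²) 𝓘(ℂ, ℂ²) p.chart (proj x) :=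
  mdifferentiableAt_atlas p.chart_mem_atlas hx

theorem mdifferentiableAt_chart_symm (p : A.ChartIndex) {z : ℂ²} (hz : z ∈ p.target) :
    MDifferentiableAt 𝓘(ℂ, ℂ²) 𝓘(ℂ, ℂ²) (fun z => proj (p.point z)) z :=
  mdifferentiableAt_atlas_symm p.chart_mem_atlas hz

theorem mdifferentiableAt_proj_comp {E : Type*} [NormedAddCommGroup E] [NormedSpace ℂ E]
    {f : E → A.Cone} {e : E} (hf : ContinuousAt f e)
    (hy : ∀ m, ContDiffAt ℂ 1 (fun e => (f e).y m) e) :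
    MDifferentiableAt 𝓘(ℂ, E) 𝓘(ℂ, ℂ²) (fun e => proj (f e)) e := by
  obtain ⟨p, hp⟩ := exists_chartIndex_mem (f e)
  have hcoord : MDifferentiableAt 𝓘(ℂ, E) 𝓘(ℂ, ℂ²) (fun e => p.coord (f e)) e :=
    ((p.contDiffAt_coord_comp hy hp.1).differentiableAt one_ne_zero).mdifferentiableAt
  have hcomp : MDifferentiableAt 𝓘(ℂ, E) 𝓘(ℂ, ℂ²)
      ((fun z => proj (p.point z)) ∘ fun e => p.coord (f e)) e :=
    MDifferentiableAt.comp e (mdifferentiableAt_chart_symm p (p.coord_mem_target hp)) hcoord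
  refine hcomp.congr_of_eventuallyEq ?_
  have hmem : ∀ᶠ e in 𝓝 e, p.Mem (f e) :=
    (continuous_proj.continuousAt.comp hf).eventually_mem (p.isOpen_source.mem_nhds hp)
  filter_upwards [hmem] with e he
  exact (p.proj_point_coord he).symm

theorem mdifferentiableAt_iff (p : A.ChartIndex) {f : A.Surface → ℂ} {x : A.Cone} (hx : p.Mem x) :
    MDifferentiableAt 𝓘(ℂ, ℂ²) 𝓘(ℂ, ℂ) f (proj x) ↔
      DifferentiableAt ℂ (fun z => f (proj (p.point z))) (p.coord x) := by
  rw [← mdifferentiableAt_iff_differentiableAt]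
  constructor
  · intro hf
    rw [← p.proj_point_coord hx] at hf
    exact hf.comp (p.coord x) (mdifferentiableAt_chart_symm p (p.coord_mem_target hx))
  · intro hf
    have hcomp : MDifferentiableAt 𝓘(ℂ, ℂ²) 𝓘(ℂ, ℂ)
        ((fun z => f (proj (p.point z))) ∘ p.chart) (proj x) :=
      MDifferentiableAt.comp (proj x) hf (mdifferentiableAt_chart p hx)
    refine hcomp.congr_of_eventuallyEq ?_
    filter_upwards [p.chart.open_source.mem_nhds hx] with q hq
    exact congrArg f (p.chart.left_inv hq).symm

end BranchData

end Charts

/-! ### The holomorphic two-form -/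

section HomogeneousJacobian

/-- The coefficient of the pullback under `f` of the form
`x₀ dx₁ ∧ dx₂ - x₁ dx₀ ∧ dx₂ + x₂ dx₀ ∧ dx₁`, the homogeneous two-form of degree three whose
quotients by cubic forms are the two-forms of the projective plane. -/
noncomputable def homogeneousJacobian (f : ℂ² → ℂ³) (z : ℂ²) : ℂ :=
  (Matrix.of ![f z, fderiv ℂ f z (Pi.single 0 1), fderiv ℂ f z (Pi.single 1 1)]).det

theorem det_clm_two (T : ℂ² →L[ℂ] ℂ²) : T.det =
    T (Pi.single 0 1) 0 * T (Pi.single 1 1) 1 - T (Pi.single 1 1) 0 * T (Pi.single 0 1) 1 := by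
  rw [ContinuousLinearMap.det, ← LinearMap.det_toMatrix', Matrix.det_fin_two]
  simp [LinearMap.toMatrix'_apply]

theorem homogeneousJacobian_congr {f g : ℂ² → ℂ³} {z : ℂ²} (h : f =ᶠ[𝓝 z] g) :
    homogeneousJacobian f z = homogeneousJacobian g z := by
  rw [homogeneousJacobian, homogeneousJacobian, h.fderiv_eq, h.self_of_nhds]

theorem homogeneousJacobian_smul {a : ℂ² → ℂ} {f : ℂ² → ℂ³} {z : ℂ²}
    (ha : DifferentiableAt ℂ a z) (hf : DifferentiableAt ℂ f z) :
    homogeneousJacobian (fun w => a w • f w) z = a z ^ 3 * homogeneousJacobian f z := by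
  have hderiv : fderiv ℂ (fun w => a w • f w) z = _ :=
    (ha.hasFDerivAt.smul hf.hasFDerivAt).fderiv
  simp only [homogeneousJacobian, hderiv, Matrix.det_fin_three]
  simp
  ring

theorem homogeneousJacobian_comp {f : ℂ² → ℂ³} {ψ : ℂ² → ℂ²} {z : ℂ²}
    (hf : DifferentiableAt ℂ f (ψ z)) (hψ : DifferentiableAt ℂ ψ z) :
    homogeneousJacobian (fun w => f (ψ w)) z =
      homogeneousJacobian f (ψ z) * (fderiv ℂ ψ z).det := by
  have hderiv := (hf.hasFDerivAt.comp z hψ.hasFDerivAt).fderiv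
  have hexpand : ∀ e : ℂ², fderiv ℂ f (ψ z) e = e 0 • fderiv ℂ f (ψ z) (Pi.single 0 1) +
      e 1 • fderiv ℂ f (ψ z) (Pi.single 1 1) := by
    intro e
    rw [← map_smul, ← map_smul, ← map_add]
    congr 1
    ext a
    fin_cases a <;> simp
  rw [homogeneousJacobian, show (fun w => f (ψ w)) = f ∘ ψ from rfl, hderiv]
  simp only [homogeneousJacobian, det_clm_two, Matrix.det_fin_three,
    ContinuousLinearMap.comp_apply, hexpand (fderiv ℂ ψ z _)]
  simp
  ring

theorem homogeneousJacobian_linear_comp (T : ℂ³ →L[ℂ] ℂ³) {f : ℂ² → ℂ³} {z : ℂ²}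
    (hf : DifferentiableAt ℂ f z) :
    homogeneousJacobian (fun w => T (f w)) z = T.det * homogeneousJacobian f z := by
  have hderiv := (T.hasFDerivAt.comp z hf.hasFDerivAt).fderiv
  have hbasis := (Pi.basisFun ℂ (Fin 3)).det_comp (T : ℂ³ →ₗ[ℂ] ℂ³)
    ![f z, fderiv ℂ f z (Pi.single 0 1), fderiv ℂ f z (Pi.single 1 1)]
  rw [homogeneousJacobian, show (fun w => T (f w)) = T ∘ f from rfl, hderiv, homogeneousJacobian]
  simp only [Pi.basisFun_det_apply] at hbasis
  convert hbasis using 3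
  ext a
  fin_cases a <;> rfl

end HomogeneousJacobian

section TwoForm

namespace BranchData

variable {ι : Type*} {A : BranchData ι}

namespace ChartIndex

variable (p : A.ChartIndex)

theorem root_ne_zero {z : ℂ²} (hz : z ∈ p.target) {m : ι} (hi : m ≠ p.i) (hj : m ≠ p.j) :
    p.root z m ≠ 0 := by
  rcases p.eq_or_isDependent m with rfl | rfl | rfl | hm
  · exact absurd rfl hi
  · exact absurd rfl hj
  · rw [root_k]
    exact one_ne_zero
  · intro hroot
    refine ((p.mem_point hz).2 m hm).1 ?_
    rw [Cone.normalizedRoot, point_y, hroot, zero_div, zero_div]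

theorem homogeneousJacobian_powers (z : ℂ²) : homogeneousJacobian p.powers z =
    A.b p.i * z 0 ^ (A.b p.i - 1) * (A.b p.j * z 1 ^ (A.b p.j - 1)) := by
  let dz (a : Fin 2) : ℂ² →L[ℂ] ℂ := ContinuousLinearMap.proj a
  have hpow : ∀ (a : Fin 2) (n : ℕ), HasFDerivAt (fun z : ℂ² => z a ^ n)
      ((n * z a ^ (n - 1)) • dz a) z := by
    intro a n
    refine ((dz a).hasFDerivAt.pow n).congr_fderiv ?_
    ext e
    simp [dz]
  have hderiv : HasFDerivAt p.powers (ContinuousLinearMap.pi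
      ![0, (A.b p.i * z 0 ^ (A.b p.i - 1)) • dz 0, (A.b p.j * z 1 ^ (A.b p.j - 1)) • dz 1]) z := by
    refine hasFDerivAt_pi.2 fun a => ?_
    fin_cases a
    · exact hasFDerivAt_const 1 z
    · exact hpow 0 (A.b p.i)
    · exact hpow 1 (A.b p.j)
  rw [homogeneousJacobian, hderiv.fderiv, Matrix.det_fin_three]
  simp [powers, dz]

theorem homogeneousJacobian_vec (z : ℂ²) : homogeneousJacobian p.vec z =
    (p.frame.symm : ℂ³ →L[ℂ] ℂ³).det *
      (A.b p.i * z 0 ^ (A.b p.i - 1) * (A.b p.j * z 1 ^ (A.b p.j - 1))) := by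
  rw [← p.homogeneousJacobian_powers z]
  exact homogeneousJacobian_linear_comp (p.frame.symm : ℂ³ →L[ℂ] ℂ³)
    ((p.contDiff_powers (n := 1)).differentiable one_ne_zero z)

variable [Fintype ι]

open Classical in
/-- The coefficient in the chart of the two-form of the surface, `homogeneousJacobian p.vec`
divided by `∏ m, p.root z m ^ (b m - 1)`, after cancellation of the powers of `z 0` and `z 1`. -/
noncomputable def coeff (z : ℂ²) : ℂ :=
  A.b p.i * A.b p.j * (p.frame.symm : ℂ³ →L[ℂ] ℂ³).det /
    ∏ m with m ≠ p.i ∧ m ≠ p.j, p.root z m ^ (A.b m - 1)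

open Classical in
theorem prod_root_ne_zero {z : ℂ²} (hz : z ∈ p.target) :
    ∏ m with m ≠ p.i ∧ m ≠ p.j, p.root z m ^ (A.b m - 1) ≠ 0 :=
  Finset.prod_ne_zero_iff.2 fun _ hm => pow_ne_zero _
    (p.root_ne_zero hz (Finset.mem_filter.1 hm).2.1 (Finset.mem_filter.1 hm).2.2)

theorem coeff_ne_zero {z : ℂ²} (hz : z ∈ p.target) : p.coeff z ≠ 0 :=
  div_ne_zero (mul_ne_zero (mul_ne_zero (Nat.cast_ne_zero.2 (A.b_ne_zero p.i))
    (Nat.cast_ne_zero.2 (A.b_ne_zero p.j))) p.frame.symm.toLinearEquiv.isUnit_det'.ne_zero)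
    (p.prod_root_ne_zero hz)

theorem differentiableAt_coeff {z : ℂ²} (hz : z ∈ p.target) : DifferentiableAt ℂ p.coeff z := by
  refine ContDiffAt.differentiableAt (n := 1) ?_ one_ne_zero
  exact contDiffAt_const.div (contDiffAt_prod fun m _ => (p.contDiffAt_root hz m).pow _)
    (p.prod_root_ne_zero hz)

theorem coeff_mul_prod {z : ℂ²} (hz : z ∈ p.target) :
    p.coeff z * ∏ m, p.root z m ^ (A.b m - 1) = homogeneousJacobian p.vec z := by
  classical
  have hpair : (Finset.univ.filter fun m => ¬ (m ≠ p.i ∧ m ≠ p.j)) = {p.i, p.j} := by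
    ext m
    simp
    tauto
  have hprod := p.prod_root_ne_zero hz
  rw [← Finset.prod_filter_not_mul_prod_filter Finset.univ (fun m => m ≠ p.i ∧ m ≠ p.j), hpair,
    Finset.prod_pair p.i_ne_j, root_i, root_j, coeff, homogeneousJacobian_vec]
  field_simp

end ChartIndex

theorem homogeneousJacobian_transition (p p' : A.ChartIndex) {z : ℂ²} (hz : z ∈ p.target)
    (hz' : p'.Mem (p.point z)) :
    homogeneousJacobian p'.vec (p'.coord (p.point z)) *
        (fderiv ℂ (fun z => p'.coord (p.point z)) z).det =
      ((p.root z p'.k)⁻¹ ^ A.N) ^ 3 * homogeneousJacobian p.vec z := by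
  have hvec : ∀ (p : A.ChartIndex) (z : ℂ²), DifferentiableAt ℂ p.vec z := fun p =>
    (p.contDiff_vec (n := 1)).differentiable one_ne_zero
  have hk : p.root z p'.k ≠ 0 := hz'.1
  have hroot := p.contDiffAt_root (n := 1) hz p'.k
  have heq : (fun w => p'.vec (p'.coord (p.point w))) =ᶠ[𝓝 z]
      fun w => ((p.root w p'.k)⁻¹ ^ A.N) • p.vec w :=
    (hroot.continuousAt.eventually_ne hk).mono fun w hw => p'.vec_coord (x := p.point w) hw
  rw [← homogeneousJacobian_comp (hvec p' _)
    ((contDiffAt_transition p p' hz hz' (n := 1)).differentiableAt one_ne_zero),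
    homogeneousJacobian_congr heq]
  exact homogeneousJacobian_smul (((hroot.differentiableAt one_ne_zero).inv hk).pow _) (hvec p z)

variable [Fintype ι]

theorem prod_root_transition (hsum : ∑ m, A.d m * (A.b m - 1) = 3 * A.N) (p p' : A.ChartIndex)
    {z : ℂ²} (hz' : p'.Mem (p.point z)) :
    ∏ m, p'.root (p'.coord (p.point z)) m ^ (A.b m - 1) =
      ((p.root z p'.k)⁻¹ ^ A.N) ^ 3 * ∏ m, p.root z m ^ (A.b m - 1) := by
  rw [← pow_mul, mul_comm A.N 3, ← hsum, ← Finset.prod_pow_eq_pow_sum, ← Finset.prod_mul_distrib]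
  refine Finset.prod_congr rfl fun m _ => ?_
  rw [p'.root_coord hz', mul_pow, pow_mul]
  rfl

theorem coeff_change_of_ne_zero (hsum : ∑ m, A.d m * (A.b m - 1) = 3 * A.N)
    (p p' : A.ChartIndex) {z : ℂ²} (hz : z ∈ p.target) (hz' : p'.Mem (p.point z))
    (h0 : z 0 ≠ 0) (h1 : z 1 ≠ 0) :
    p.coeff z = p'.coeff (p'.coord (p.point z)) *
      (fderiv ℂ (fun z => p'.coord (p.point z)) z).det := by
  have hprod : ∏ m, p.root z m ^ (A.b m - 1) ≠ 0 := by
    refine Finset.prod_ne_zero_iff.2 fun m _ => pow_ne_zero _ ?_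
    by_cases hi : m = p.i
    · rwa [hi, p.root_i]
    by_cases hj : m = p.j
    · rwa [hj, p.root_j]
    exact p.root_ne_zero hz hi hj
  have hscale : ((p.root z p'.k)⁻¹ ^ A.N) ^ 3 ≠ 0 :=
    pow_ne_zero _ (pow_ne_zero _ (inv_ne_zero hz'.1))
  have hjacobian := homogeneousJacobian_transition p p' hz hz'
  rw [← p.coeff_mul_prod hz, ← p'.coeff_mul_prod (p'.coord_mem_target hz'),
    prod_root_transition hsum p p' hz'] at hjacobian
  refine mul_right_cancel₀ hprod (mul_left_cancel₀ hscale ?_)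
  rw [← hjacobian]
  ring

theorem continuousAt_coeff_transition (p p' : A.ChartIndex) {z : ℂ²} (hz : z ∈ p.target)
    (hz' : p'.Mem (p.point z)) :
    ContinuousAt (fun z => p'.coeff (p'.coord (p.point z)) *
      (fderiv ℂ (fun z => p'.coord (p.point z)) z).det) z := by
  have htransition := contDiffAt_transition p p' hz hz' (n := 2)
  have hderiv : ∀ e a, ContinuousAt
      (fun w => fderiv ℂ (fun z => p'.coord (p.point z)) w e a) z := fun e a =>
    (continuous_apply a).continuousAt.comp
      ((htransition.fderiv_right (m := 0) (by norm_num)).continuousAt.clm_apply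
        continuousAt_const)
  refine ContinuousAt.mul (ContinuousAt.comp (f := fun z => p'.coord (p.point z)) (g := p'.coeff)
    (p'.differentiableAt_coeff (p'.coord_mem_target hz')).continuousAt
    htransition.continuousAt) ?_
  simp only [det_clm_two]
  exact ((hderiv _ _).mul (hderiv _ _)).sub ((hderiv _ _).mul (hderiv _ _))

theorem coeff_change (hsum : ∑ m, A.d m * (A.b m - 1) = 3 * A.N) (p p' : A.ChartIndex) {z : ℂ²}
    (hz : z ∈ p.target) (hz' : p'.Mem (p.point z)) :
    p.coeff z = p'.coeff (p'.coord (p.point z)) *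
      (fderiv ℂ (fun z => p'.coord (p.point z)) z).det := by
  have hopen : IsOpen (p.chart.target ∩ p.chart.symm ⁻¹' p'.chart.source) :=
    p.chart.isOpen_inter_preimage_symm p'.chart.open_source
  have hmem := tendsto_add_smul_nhdsNE z (1 : ℂ²) (hopen.mem_nhds (x := z) ⟨hz, hz'⟩)
  have hne : ∀ a : Fin 2, ∀ᶠ t : ℂ in 𝓝[≠] 0, (z + t • (1 : ℂ²)) a ≠ 0 := by
    intro a
    simp only [Pi.add_apply, Pi.smul_apply, Pi.one_apply, smul_eq_mul, mul_one]
    by_cases ha : z a = 0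
    · filter_upwards [self_mem_nhdsWithin] with t ht
      simpa [ha] using ht
    · refine nhdsWithin_le_nhds (ContinuousAt.eventually_ne (by fun_prop) ?_)
      simpa using ha
  refine eq_of_eventuallyEq_line (e := (1 : ℂ²)) (p.differentiableAt_coeff hz).continuousAt
    (continuousAt_coeff_transition p p' hz hz') ?_
  filter_upwards [hmem, hne 0, hne 1] with t ht h0 h1
  exact coeff_change_of_ne_zero hsum p p' ht.1 ht.2 h0 h1

/-- A chart of the surface as a member of the family of charts. -/
noncomputable def indexOfChart {e : OpenPartialHomeomorph A.Surface ℂ²}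
    (he : e ∈ atlas ℂ² A.Surface) : A.ChartIndex := Exists.choose he

theorem chart_indexOfChart {e : OpenPartialHomeomorph A.Surface ℂ²}
    (he : e ∈ atlas ℂ² A.Surface) : (indexOfChart he).chart = e := Exists.choose_spec he

open Classical in
/-- The nowhere vanishing two-form of the surface, which exists when the degrees of
`homogeneousJacobian` and of the product of the powers of the roots agree. -/
noncomputable def twoForm (hsum : ∑ m, A.d m * (A.b m - 1) = 3 * A.N) :
    HolomorphicTwoForm A.Surface where
  coeff e := if he : e ∈ atlas ℂ² A.Surface then (indexOfChart he).coeff else 0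
  holomorphic e he z hz := by
    rw [dif_pos he]
    rw [← chart_indexOfChart he] at hz
    exact ((indexOfChart he).differentiableAt_coeff hz).differentiableWithinAt
  change e he e' he' q hq := by
    rw [dif_pos he, dif_pos he']
    generalize hp : indexOfChart he = p
    generalize hp' : indexOfChart he' = p'
    obtain rfl : p.chart = e := hp ▸ chart_indexOfChart he
    obtain rfl : p'.chart = e' := hp' ▸ chart_indexOfChart he'
    obtain ⟨x, rfl⟩ := proj_surjective q
    have hproj := p.proj_point_coord hq.1
    have hmem : p'.Mem (p.point (p.coord x)) := by
      rw [← p'.proj_mem_source, hproj]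
      exact hq.2
    have hcoord : p'.coord (p.point (p.coord x)) = p'.coord x := congrArg p'.chart hproj
    have hchange := coeff_change hsum p p' (p.coord_mem_target hq.1) hmem
    rw [hcoord] at hchange
    exact hchange

theorem twoForm_nowhereVanishing (hsum : ∑ m, A.d m * (A.b m - 1) = 3 * A.N) :
    (twoForm hsum).NowhereVanishing := by
  intro e he z hz
  simp only [twoForm, dif_pos he]
  rw [← chart_indexOfChart he] at hz
  exact (indexOfChart he).coeff_ne_zero hz

end BranchData

end TwoForm

/-! ### The deck group -/

section DeckGroup

/-- The projection of `ℂ³ ∖ 0` to the projective plane. -/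
noncomputable def planeProj (v : {v : ℂ³ // v ≠ 0}) : ProjectivePlane :=
  Projectivization.mk ℂ v.1 v.2

theorem isQuotientMap_planeProj : IsQuotientMap planeProj :=
  ⟨⟨rfl⟩, fun p => p.ind fun v hv => ⟨⟨v, hv⟩, rfl⟩⟩

instance : ConnectedSpace ProjectivePlane := by
  have hfinrank : Module.finrank ℝ ℂ³ = 6 := by
    simp [Module.finrank_pi_fintype, Complex.finrank_real_complex]
  have hconnected : IsConnected ({0}ᶜ : Set ℂ³) :=
    isConnected_compl_singleton_of_one_lt_rank
      (by rw [← Module.finrank_eq_rank, hfinrank]; norm_num) 0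
  have : ConnectedSpace {v : ℂ³ // v ≠ 0} := isConnected_iff_connectedSpace.1 hconnected
  exact isQuotientMap_planeProj.surjective.connectedSpace isQuotientMap_planeProj.continuous

theorem smul_mem_connectedComponent_of_smul_eq {G X : Type*} [TopologicalSpace X] [SMul G X]
    [ContinuousConstSMul G X] {g : G} {x₀ x : X} (hx : x ∈ connectedComponent x₀)
    (hg : g • x = x) {y : X} (hy : y ∈ connectedComponent x₀) :
    g • y ∈ connectedComponent x₀ := by
  rw [connectedComponent_eq hx] at hy ⊢
  simpa only [hg] using (continuous_const_smul g).image_connectedComponent_subset x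
    (mem_image_of_mem _ hy)

namespace BranchData

variable {ι : Type*} {A : BranchData ι}

variable (A) in
/-- The group of changes of the roots. -/
abbrev Deck : Type _ := ∀ i, rootsOfUnity (A.b i) ℂ

instance (i : ι) : NeZero (A.b i) := ⟨A.b_ne_zero i⟩

theorem Deck.pow_eq_one (g : A.Deck) (i : ι) : ((g i : ℂˣ) : ℂ) ^ A.b i = 1 :=
  (mem_rootsOfUnity' _ _).1 (g i).2

instance : MulAction A.Deck A.Cone where
  smul g x := Cone.mk x.v (fun i => ((g i : ℂˣ) : ℂ) * x.y i) x.v_ne_zero fun i => by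
    rw [mul_pow, g.pow_eq_one, one_mul, x.y_pow]
  one_smul x := Cone.ext rfl (funext fun i => one_mul (x.y i))
  mul_smul g g' x := Cone.ext rfl (funext fun i => by
    change (((g * g') i : ℂˣ) : ℂ) * x.y i = ((g i : ℂˣ) : ℂ) * (((g' i : ℂˣ) : ℂ) * x.y i)
    simp [mul_assoc])

@[simp] theorem Cone.deck_smul_v (g : A.Deck) (x : A.Cone) : (g • x).v = x.v := rfl

@[simp] theorem Cone.deck_smul_y (g : A.Deck) (x : A.Cone) (i : ι) :
    (g • x).y i = ((g i : ℂˣ) : ℂ) * x.y i := rfl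

theorem deck_smul_comm (g : A.Deck) (c : ℂˣ) (x : A.Cone) : g • c • x = c • g • x :=
  Cone.ext rfl (funext fun _ => mul_left_comm _ _ _)

instance : ContinuousConstSMul A.Deck A.Cone where
  continuous_const_smul _ := Cone.continuous_of_coords Cone.continuous_v fun i =>
    continuous_const.mul (Cone.continuous_y_apply i)

instance : MulAction A.Deck A.Surface where
  smul g := lift (fun x => proj (g • x)) fun c x => by rw [deck_smul_comm, proj_smul]
  one_smul q := by
    obtain ⟨x, rfl⟩ := proj_surjective q
    exact congrArg proj (one_smul _ x)
  mul_smul g g' q := by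
    obtain ⟨x, rfl⟩ := proj_surjective q
    exact congrArg proj (mul_smul g g' x)

theorem deck_smul_proj (g : A.Deck) (x : A.Cone) : g • proj x = proj (g • x) := rfl

instance : ContinuousConstSMul A.Deck A.Surface where
  continuous_const_smul g := isOpenQuotientMap_proj.isQuotientMap.continuous_iff.2
    (continuous_proj.comp (continuous_const_smul g))

theorem exists_cone_over {v : ℂ³} (hv : v ≠ 0) : ∃ x : A.Cone, x.v = v := by
  choose y hy using fun i => IsAlgClosed.exists_pow_nat_eq (A.L i v)
    (Nat.pos_of_ne_zero (A.b_ne_zero i))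
  exact ⟨Cone.mk v y hv hy, rfl⟩

theorem exists_y_eq_zero (i : ι) : ∃ x : A.Cone, x.y i = 0 := by
  obtain ⟨j, hji, -, -⟩ := A.exists_weight_one i i
  obtain ⟨k, hki, hkj, -⟩ := A.exists_weight_one i j
  obtain ⟨e, hej, hei, -⟩ := A.exists_dual hji hkj.symm hki.symm
  obtain ⟨x, hx⟩ := exists_cone_over (A := A) (v := e) fun he => by simp [he] at hej
  exact ⟨x, (x.y_eq_zero_iff i).2 (by rw [hx, hei])⟩

theorem exists_rootsOfUnity_mul_eq {n : ℕ} (hn : n ≠ 0) {z w : ℂ} (h : z ^ n = w ^ n) :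
    ∃ ζ : rootsOfUnity n ℂ, ((ζ : ℂˣ) : ℂ) * w = z := by
  by_cases hw : w = 0
  · refine ⟨1, ?_⟩
    rw [hw, zero_pow hn, pow_eq_zero_iff hn] at h
    rw [hw, h, mul_zero]
  have hpow : (z / w) ^ n = 1 := by rw [div_pow, h, div_self (pow_ne_zero _ hw)]
  have hunit : IsUnit (z / w) := IsUnit.of_pow_eq_one hpow hn
  exact ⟨⟨hunit.unit, (mem_rootsOfUnity' _ _).2 hpow⟩, div_mul_cancel₀ _ hw⟩

theorem exists_deck_smul_eq {x x' : A.Cone} (h : x.v = x'.v) : ∃ g : A.Deck, g • x' = x := by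
  choose g hg using fun i => exists_rootsOfUnity_mul_eq (A.b_ne_zero i)
    (show x.y i ^ A.b i = x'.y i ^ A.b i by rw [x.y_pow, x'.y_pow, h])
  exact ⟨g, Cone.ext h.symm (funext hg)⟩

/-- The branched covering of the projective plane. -/
noncomputable def cover : A.Surface → ProjectivePlane :=
  lift (fun x => Projectivization.mk ℂ x.v x.v_ne_zero) fun c _ =>
    (Projectivization.mk_eq_mk_iff ℂ _ _ _ _).2 ⟨c ^ A.N, rfl⟩

@[simp] theorem cover_proj (x : A.Cone) :
    cover (proj x) = Projectivization.mk ℂ x.v x.v_ne_zero := rfl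

theorem cover_eq_iff {q q' : A.Surface} : cover q = cover q' ↔ ∃ g : A.Deck, g • q' = q := by
  constructor
  · intro hcover
    obtain ⟨x, rfl⟩ := proj_surjective q
    obtain ⟨x', rfl⟩ := proj_surjective q'
    obtain ⟨a, ha⟩ := (Projectivization.mk_eq_mk_iff ℂ _ _ _ _).1 hcover
    obtain ⟨c, hc⟩ := IsAlgClosed.exists_pow_nat_eq (a : ℂ) (Nat.pos_of_ne_zero A.N_ne_zero)
    have hc0 : c ≠ 0 := fun h0 => a.ne_zero (by rw [← hc, h0, zero_pow A.N_ne_zero])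
    obtain ⟨g, hg⟩ := exists_deck_smul_eq (x := x) (x' := Units.mk0 c hc0 • x') (by
      rw [Cone.smul_v, Units.val_mk0, hc, ← ha]
      rfl)
    refine ⟨g, ?_⟩
    rw [← proj_smul (Units.mk0 c hc0) x', deck_smul_proj, hg]
  · rintro ⟨g, rfl⟩
    obtain ⟨x, rfl⟩ := proj_surjective q'
    rfl

/-- The projection of the cone to `ℂ³ ∖ 0`. -/
def Cone.base (x : A.Cone) : {v : ℂ³ // v ≠ 0} := ⟨x.v, x.v_ne_zero⟩

theorem Cone.continuous_base : Continuous (Cone.base : A.Cone → _) :=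
  Cone.continuous_v.subtype_mk _

theorem Cone.base_surjective : Function.Surjective (Cone.base : A.Cone → _) := fun v =>
  (exists_cone_over v.2).imp fun _ hx => Subtype.ext hx

theorem planeProj_preimage_image_cover (s : Set A.Surface) :
    planeProj ⁻¹' (cover '' s) = Cone.base '' (proj ⁻¹' s : Set A.Cone) := by
  ext v
  constructor
  · rintro ⟨q, hq, hqv⟩
    obtain ⟨x, rfl⟩ := Cone.base_surjective (A := A) v
    obtain ⟨g, hg⟩ := cover_eq_iff.1 (show cover q = cover (proj x) from hqv)
    exact ⟨g • x, by rwa [mem_preimage, ← deck_smul_proj, hg], rfl⟩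
  · rintro ⟨x, hx, rfl⟩
    exact ⟨proj x, hx, rfl⟩

theorem continuous_cover : Continuous (cover : A.Surface → _) :=
  isOpenQuotientMap_proj.isQuotientMap.continuous_iff.2
    (isQuotientMap_planeProj.continuous.comp Cone.continuous_base)

theorem mulSingle_smul_eq [DecidableEq ι] {x : A.Cone} {i : ι} (hx : x.y i = 0)
    (ζ : rootsOfUnity (A.b i) ℂ) : (Pi.mulSingle i ζ : A.Deck) • x = x := by
  refine Cone.ext rfl (funext fun m => ?_)
  rw [Cone.deck_smul_y]
  obtain rfl | hm := eq_or_ne m i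
  · rw [hx, mul_zero]
  · rw [Pi.mulSingle_eq_of_ne hm, OneMemClass.coe_one, Units.val_one, one_mul]

variable [Finite ι]

theorem Cone.isClosedMap_base : IsClosedMap (Cone.base : A.Cone → _) := by
  have : LocallyCompactSpace {v : ℂ³ // v ≠ 0} := isOpen_compl_singleton.locallyCompactSpace
  refine (isProperMap_iff_isCompact_preimage.2 ⟨Cone.continuous_base, fun K hK => ?_⟩).isClosedMap
  have hpreimage : (Cone.base ⁻¹' K : Set A.Cone) = Cone.v ⁻¹' (Subtype.val '' K) := by
    ext x
    exact ⟨fun hx => ⟨_, hx, rfl⟩, fun ⟨w, hw, hwx⟩ => by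
      rwa [mem_preimage, show x.base = w from Subtype.ext hwx.symm]⟩
  rw [hpreimage]
  exact isCompact_preimage_v (hK.image continuous_subtype_val) fun ⟨v, _, hv⟩ => v.2 hv

theorem Cone.isQuotientMap_base : IsQuotientMap (Cone.base : A.Cone → _) :=
  isClosedMap_base.isQuotientMap continuous_base base_surjective

theorem Cone.isOpenMap_base : IsOpenMap (Cone.base : A.Cone → _) := fun s hs => by
  have hpreimage : base ⁻¹' (base '' s) = ⋃ g : A.Deck, (fun x : A.Cone => g • x) ⁻¹' s := by
    ext x
    simp only [mem_preimage, mem_image, mem_iUnion]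
    constructor
    · rintro ⟨x', hx', hbase⟩
      obtain ⟨g, rfl⟩ := exists_deck_smul_eq (congrArg Subtype.val hbase)
      exact ⟨g, hx'⟩
    · rintro ⟨g, hg⟩
      exact ⟨g • x, hg, rfl⟩
  rw [← isQuotientMap_base.isOpen_preimage (X := A.Cone), hpreimage]
  exact isOpen_iUnion fun g => hs.preimage (continuous_const_smul g)

theorem Cone.isOpenMap_v : IsOpenMap (Cone.v : A.Cone → _) :=
  (isOpen_compl_singleton.isOpenMap_subtype_val (X := ℂ³)).comp isOpenMap_base

theorem isQuotientMap_cover : IsQuotientMap (cover : A.Surface → _) :=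
  IsQuotientMap.of_comp continuous_proj continuous_cover
    (isQuotientMap_planeProj.comp Cone.isQuotientMap_base)

theorem isClosedMap_cover : IsClosedMap (cover : A.Surface → _) := fun s hs => by
  rw [← isQuotientMap_planeProj.isClosed_preimage, planeProj_preimage_image_cover]
  exact Cone.isClosedMap_base _ (hs.preimage continuous_proj)

theorem isOpenMap_cover : IsOpenMap (cover : A.Surface → _) := fun s hs => by
  rw [← isQuotientMap_planeProj.isOpen_preimage, planeProj_preimage_image_cover]
  exact Cone.isOpenMap_base _ (hs.preimage continuous_proj)

theorem exists_mem_connectedComponent_cover_eq (q₀ : A.Surface) (p : ProjectivePlane) :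
    ∃ q ∈ connectedComponent q₀, cover q = p := by
  have : LocallyConnectedSpace A.Surface := ChartedSpace.locallyConnectedSpace ℂ² A.Surface
  have himage : cover '' connectedComponent q₀ = univ := IsClopen.eq_univ
    ⟨isClosedMap_cover (A := A) _ isClosed_connectedComponent,
      isOpenMap_cover (A := A) _ isOpen_connectedComponent⟩
    ⟨_, q₀, mem_connectedComponent, rfl⟩
  exact himage.symm.subset (mem_univ p)

/-- Every component has a point over each line, and such a point is fixed by the corresponding
factor of the deck group. -/
theorem deck_smul_mem_connectedComponent (g : A.Deck) {q₀ : A.Surface} :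
    ∀ q ∈ connectedComponent q₀, g • q ∈ connectedComponent q₀ := by
  classical
  cases nonempty_fintype ι
  rw [← Finset.univ_prod_mulSingle g]
  refine Finset.prod_induction _
    (fun g : A.Deck => ∀ q ∈ connectedComponent q₀, g • q ∈ connectedComponent q₀)
    (fun g g' hg hg' q hq => mul_smul g g' q ▸ hg _ (hg' q hq))
    (fun q hq => (one_smul A.Deck q).symm ▸ hq) fun i _ q hq => ?_
  obtain ⟨x, hx⟩ := exists_y_eq_zero (A := A) i
  obtain ⟨q', hq', hcover⟩ := exists_mem_connectedComponent_cover_eq q₀ (cover (proj x))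
  obtain ⟨h, rfl⟩ := cover_eq_iff.1 hcover
  refine smul_mem_connectedComponent_of_smul_eq hq' ?_ hq
  rw [deck_smul_proj, deck_smul_proj, mulSingle_smul_eq (by rw [Cone.deck_smul_y, hx, mul_zero])]

instance : ConnectedSpace A.Surface := by
  obtain ⟨x₀, -⟩ := exists_y_eq_zero (A := A) (A.base 0)
  refine connectedSpace_iff_connectedComponent.2 ⟨proj x₀, eq_univ_of_forall fun q => ?_⟩
  obtain ⟨q', hq', hcover⟩ := exists_mem_connectedComponent_cover_eq (proj x₀) (cover q)
  obtain ⟨g, rfl⟩ := cover_eq_iff.1 hcover.symm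
  exact deck_smul_mem_connectedComponent g q' hq'

end BranchData

end DeckGroup

/-! ### The uniformization -/

section Uniformization

theorem isOpen_coneSet {U : Set ProjectivePlane} (hU : IsOpen U) : IsOpen (coneSet U) := by
  have himage : coneSet U = Subtype.val '' (planeProj ⁻¹' U) := by
    ext v
    constructor
    · rintro ⟨hv, hvU⟩
      exact ⟨⟨v, hv⟩, hvU, rfl⟩
    · rintro ⟨w, hw, rfl⟩
      exact ⟨w.2, hw⟩
  rw [himage]
  exact isOpen_compl_singleton.isOpenMap_subtype_val _
    (hU.preimage isQuotientMap_planeProj.continuous)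

theorem zero_notMem_coneSet (U : Set ProjectivePlane) : (0 : ℂ³) ∉ coneSet U := fun h => h.1 rfl

namespace BranchData

variable {ι : Type*} {A : BranchData ι}

theorem L_ne_zero (i : ι) : A.L i ≠ 0 := by
  obtain ⟨j, hji, -, -⟩ := A.exists_weight_one i i
  obtain ⟨k, hki, hkj, -⟩ := A.exists_weight_one i j
  obtain ⟨e, he, -⟩ := A.exists_dual hji.symm hki.symm hkj.symm
  exact fun hL => by simp [hL] at he

theorem mem_coneSet_iff {U : Set ProjectivePlane} {x : A.Cone} :
    x.v ∈ coneSet U ↔ cover (proj x) ∈ U :=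
  ⟨fun h => h.2, fun h => ⟨x.v_ne_zero, h⟩⟩

theorem coneFun_v (f : ProjectivePlane → ℂ) (x : A.Cone) :
    coneFun f x.v = f (cover (proj x)) :=
  dif_pos x.v_ne_zero

theorem Cone.exists_localSection {x : A.Cone} (hx : ∀ i, x.y i ≠ 0) :
    ∃ s : ℂ³ → A.Cone, s x.v = x ∧ (∀ᶠ v in 𝓝 x.v, (s v).v = v) ∧ ContinuousAt s x.v ∧
      ∀ i, ContDiffAt ℂ 1 (fun v => (s v).y i) x.v := by
  classical
  have hL : ∀ i, A.L i x.v ≠ 0 := fun i hi => hx i ((x.y_eq_zero_iff i).2 hi)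
  let root (v : ℂ³) (i : ι) : ℂ := x.y i * (A.L i v / A.L i x.v) ^ ((A.b i : ℂ)⁻¹)
  have hroot : ∀ v i, root v i ^ A.b i = A.L i v := fun v i => by
    rw [mul_pow, Complex.cpow_nat_inv_pow _ (A.b_ne_zero i), x.y_pow, mul_div_cancel₀ _ (hL i)]
  let s (v : ℂ³) : A.Cone := if hv : v ≠ 0 then Cone.mk v (root v) hv (hroot v) else x
  have hs : ∀ᶠ v in 𝓝 x.v, (s v).v = v ∧ (s v).y = root v := by
    filter_upwards [isOpen_compl_singleton.mem_nhds x.v_ne_zero] with v hv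
    simp only [s, dif_pos (show v ≠ 0 from hv), mk_v, mk_y, and_self]
  have hsmooth : ∀ i, ContDiffAt ℂ 1 (fun v => (s v).y i) x.v := fun i => by
    have hsmooth_root : ContDiffAt ℂ 1 (fun v => root v i) x.v := by
      refine contDiffAt_const.mul (ContDiffAt.comp x.v (g := fun w : ℂ => w ^ ((A.b i : ℂ)⁻¹))
        (contDiffAt_cpow_inv ?_) ((A.L i).contDiff.contDiffAt.div_const _))
      rw [div_self (hL i)]
      exact Complex.one_mem_slitPlane
    exact hsmooth_root.congr_of_eventuallyEq (hs.mono fun v hv => congrFun hv.2 i)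
  refine ⟨s, Cone.ext hs.self_of_nhds.1 (hs.self_of_nhds.2.trans (funext fun i => ?_)),
    hs.mono fun v hv => hv.1, ?_, hsmooth⟩
  · simp only [root, div_self (hL i), Complex.one_cpow, mul_one]
  · exact IsInducing.subtypeVal.continuousAt_iff.2
      ((continuousAt_id.congr (hs.mono fun v hv => hv.1.symm)).prodMk
        (continuousAt_pi.2 fun i => (hsmooth i).continuousAt))

section Finite

variable [Finite ι]

variable (A) in
theorem dense_L_ne_zero : Dense {v : ℂ³ | ∀ i, A.L i v ≠ 0} := by
  rw [ofPred_forall]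
  refine dense_iInter_of_isOpen (fun i => isOpen_ne_fun (A.L i).continuous continuous_const)
    fun i => interior_eq_empty_iff_dense_compl.1 (not_nonempty_iff_eq_empty.1 fun hinterior => ?_)
  exact A.L_ne_zero i (ContinuousLinearMap.coe_injective (LinearMap.ker_eq_top.1
    (Submodule.eq_top_of_nonempty_interior' (LinearMap.ker (A.L i : ℂ³ →ₗ[ℂ] ℂ)) hinterior)))

theorem dense_y_ne_zero : Dense {x : A.Cone | ∀ i, x.y i ≠ 0} := by
  simpa only [preimage_ofPred_eq, ne_eq, ← Cone.y_eq_zero_iff] using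
    A.dense_L_ne_zero.preimage (Cone.isOpenMap_v (A := A))

theorem exists_cone_ne_zero : ∃ x : A.Cone, ∀ i, x.y i ≠ 0 :=
  have : Nonempty A.Cone := (exists_y_eq_zero (A.base 0)).nonempty
  dense_y_ne_zero.nonempty

theorem mdifferentiableAt_deck_smul (g : A.Deck) (q : A.Surface) :
    MDifferentiableAt 𝓘(ℂ, ℂ²) 𝓘(ℂ, ℂ²) (fun q : A.Surface => g • q) q := by
  obtain ⟨x, rfl⟩ := proj_surjective q
  obtain ⟨p, hp⟩ := exists_chartIndex_mem x
  have hz := p.coord_mem_target hp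
  have hpoint : ContinuousAt (fun z => g • p.point z) (p.coord x) :=
    (p.continuousOn_point.continuousAt (p.isOpen_target.mem_nhds hz)).const_smul g
  have hcomp : MDifferentiableAt 𝓘(ℂ, ℂ²) 𝓘(ℂ, ℂ²)
      ((fun z => proj (g • p.point z)) ∘ p.chart) (proj x) :=
    MDifferentiableAt.comp (proj x) (mdifferentiableAt_proj_comp hpoint fun m =>
      contDiffAt_const.mul (p.contDiffAt_root hz m)) (mdifferentiableAt_chart p hp)
  refine hcomp.congr_of_eventuallyEq ?_
  filter_upwards [p.chart.open_source.mem_nhds hp] with q hq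
  exact congrArg (g • ·) (p.chart.left_inv hq).symm

theorem continuousOn_of_cone {C : Set ℂ³} (hC : IsOpen C) (h0 : (0 : ℂ³) ∉ C) {H : ℂ³ → ℂ}
    (hH : ContinuousOn (fun x : A.Cone => H x.v) {x | x.v ∈ C}) : ContinuousOn H C := by
  have hCval : IsOpen (Subtype.val ⁻¹' C : Set {v : ℂ³ // v ≠ 0}) :=
    hC.preimage continuous_subtype_val
  have hval : ContinuousOn (fun v : {v : ℂ³ // v ≠ 0} => H v) (Subtype.val ⁻¹' C) :=
    ((Cone.isQuotientMap_base (A := A)).continuousOn_isOpen_iff hCval).2 hH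
  intro v hv
  have hv0 : v ≠ 0 := fun hv0 => h0 (hv0 ▸ hv)
  exact (isOpen_compl_singleton.isOpenEmbedding_subtypeVal.continuousAt_iff.1
    ((hval ⟨v, hv0⟩ hv).continuousAt (hCval.mem_nhds hv))).continuousWithinAt

theorem differentiableOn_of_cone {C : Set ℂ³} (hC : IsOpen C) (h0 : (0 : ℂ³) ∉ C) {H : ℂ³ → ℂ}
    (hH : ContinuousOn (fun x : A.Cone => H x.v) {x | x.v ∈ C})
    (hd : ∀ x : A.Cone, x.v ∈ C → (∀ i, x.y i ≠ 0) → DifferentiableAt ℂ H x.v) :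
    DifferentiableOn ℂ H C := by
  cases nonempty_fintype ι
  refine differentiableOn_of_continuousOn_off_hyperplanes hC A.L Finset.univ
    (fun i _ => A.L_ne_zero i) (continuousOn_of_cone hC h0 hH) fun v hv hL => ?_
  obtain ⟨x, rfl⟩ := exists_cone_over (A := A) (v := v) fun hv0 => h0 (hv0 ▸ hv)
  exact hd x hv fun i hi => hL i (Finset.mem_univ i) ((x.y_eq_zero_iff i).1 hi)

theorem holomorphicOnPlane_iff {U : Set ProjectivePlane} (hU : IsOpen U)
    (f : ProjectivePlane → ℂ) :
    HolomorphicOnPlane f U ↔ MDifferentiableOn 𝓘(ℂ, ℂ²) 𝓘(ℂ, ℂ)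
      (fun q : A.Surface => f (cover q)) (cover ⁻¹' U) := by
  constructor
  · intro hf q hq
    obtain ⟨x, rfl⟩ := proj_surjective q
    obtain ⟨p, hp⟩ := exists_chartIndex_mem x
    refine ((mdifferentiableAt_iff p hp).2 ?_).mdifferentiableWithinAt
    have hcoord : cover (proj (p.point (p.coord x))) ∈ U := by rwa [p.proj_point_coord hp]
    have hdiff : DifferentiableAt ℂ (coneFun f ∘ p.vec) (p.coord x) :=
      DifferentiableAt.comp _
        (hf.differentiableAt ((isOpen_coneSet hU).mem_nhds (mem_coneSet_iff.2 hcoord)))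
        ((p.contDiff_vec (n := 1)).differentiable one_ne_zero _)
    exact hdiff.congr_of_eventuallyEq (.of_forall fun z => (coneFun_v f (p.point z)).symm)
  · intro hf
    refine differentiableOn_of_cone (A := A) (isOpen_coneSet hU) (zero_notMem_coneSet U) ?_
      fun x hx hy => ?_
    · simp only [coneFun_v]
      exact hf.continuousOn.comp continuous_proj.continuousOn fun x hx => mem_coneSet_iff.1 hx
    · obtain ⟨s, hsx, hsv, hs, hsy⟩ := Cone.exists_localSection hy
      have hfx : MDifferentiableAt 𝓘(ℂ, ℂ²) 𝓘(ℂ, ℂ) (fun q => f (cover q)) (proj (s x.v)) := by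
        rw [hsx]
        exact (hf _ (mem_coneSet_iff.1 hx)).mdifferentiableAt
          ((hU.preimage continuous_cover).mem_nhds (mem_coneSet_iff.1 hx))
      refine (hfx.comp x.v (mdifferentiableAt_proj_comp hs hsy)).differentiableAt
        |>.congr_of_eventuallyEq (hsv.mono fun v hv => ?_)
      exact (congrArg (coneFun f) hv.symm).trans (coneFun_v f (s v))

end Finite

section Isotropy

variable (A) in
/-- The group of the uniformization: the deck group does not act faithfully. -/
abbrev DeckImage : Subgroup (Equiv.Perm A.Surface) := (MulAction.toPermHom A.Deck A.Surface).range

theorem pow_d_mul_eq_of_smul_eq {c : ℂˣ} {g g' : A.Deck} {x : A.Cone} (h : c • g' • x = g • x)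
    {i : ι} (hi : x.y i ≠ 0) : (c : ℂ) ^ A.d i * ((g' i : ℂˣ) : ℂ) = ((g i : ℂˣ) : ℂ) := by
  have hy := congrFun (congrArg Cone.y h) i
  rw [Cone.smul_y, Cone.deck_smul_y, Cone.deck_smul_y, ← mul_assoc] at hy
  exact mul_right_cancel₀ hi hy

theorem deck_smul_eq_self {h : A.Deck} {x : A.Cone} (hx : ∀ i, x.y i ≠ 0 → h i = 1) :
    h • x = x :=
  Cone.ext rfl (funext fun i => by
    rw [Cone.deck_smul_y]
    by_cases hi : x.y i = 0
    · rw [hi, mul_zero]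
    · rw [hx i hi, OneMemClass.coe_one, Units.val_one, one_mul])

theorem exists_deck_fixing {g : A.Deck} {x : A.Cone} (hg : proj (g • x) = proj x) :
    ∃ h : A.Deck, (∀ i, x.y i ≠ 0 → h i = 1) ∧ ∀ q : A.Surface, h • q = g • q := by
  obtain ⟨c, hc⟩ := proj_eq_iff.1 hg
  have hcN : (c : ℂ) ^ A.N = 1 :=
    smul_left_injective ℂ x.v_ne_zero (by simpa using congrArg Cone.v hc)
  have hcb : ∀ i, c ^ A.d i ∈ rootsOfUnity (A.b i) ℂ := fun i => by
    rw [mem_rootsOfUnity', Units.val_pow_eq_pow_val, ← pow_mul, A.d_mul_b, hcN]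
  refine ⟨fun i => g i * ⟨c ^ A.d i, hcb i⟩⁻¹, fun i hi => ?_, fun q => ?_⟩
  · have hgi := pow_d_mul_eq_of_smul_eq (g' := 1) ((congrArg (c • ·) (one_smul _ x)).trans hc) hi
    refine mul_inv_eq_one.2 (Subtype.ext (Units.ext ?_))
    rw [← hgi]
    simp
  · obtain ⟨w, rfl⟩ := proj_surjective q
    refine proj_eq_of_y_eq (c := ((c⁻¹ : ℂˣ) : ℂ)) (Units.ne_zero _) fun i => ?_
    simp only [Cone.deck_smul_y, Subgroup.coe_mul, InvMemClass.coe_inv, Units.val_mul,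
      Units.val_inv_eq_inv_val, Units.val_pow_eq_pow_val, inv_pow]
    ring

theorem deck_ext_of_fixing [Finite ι] {h h' : A.Deck} {x : A.Cone}
    (hx : ∀ i, x.y i ≠ 0 → h i = 1) (hx' : ∀ i, x.y i ≠ 0 → h' i = 1)
    (heq : ∀ q : A.Surface, h • q = h' • q) : h = h' := by
  obtain ⟨x₀, hx₀⟩ := exists_cone_ne_zero (A := A)
  obtain ⟨c, hc⟩ := proj_eq_iff.1 (heq (proj x₀))
  obtain ⟨k, hk, hxk⟩ := x.exists_weight_one_ne_zero
  have hc1 : (c : ℂ) = 1 := by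
    simpa [hk, hx k hxk, hx' k hxk] using pow_d_mul_eq_of_smul_eq hc (hx₀ k)
  refine funext fun i => Subtype.ext (Units.ext ?_)
  rw [← pow_d_mul_eq_of_smul_eq hc (hx₀ i), hc1, one_pow, one_mul]

variable [Fintype ι]

theorem card_deck_fixing (x : A.Cone) : Nat.card {h : A.Deck // ∀ i, x.y i ≠ 0 → h i = 1} =
    ∏ i, if A.L i x.v = 0 then A.b i else 1 := by
  rw [Nat.card_congr (Equiv.subtypePiEquivPi (p := fun i (ζ : rootsOfUnity (A.b i) ℂ) =>
    x.y i ≠ 0 → ζ = 1)), Nat.card_pi]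
  refine Finset.prod_congr rfl fun i _ => ?_
  simp only [← x.y_eq_zero_iff]
  split_ifs with hi
  · exact (Nat.card_congr (Equiv.subtypeUnivEquiv fun ζ hi' => absurd hi hi')).trans
      (Complex.card_rootsOfUnity (A.b i))
  · exact Nat.card_eq_one_iff_unique.2
      ⟨⟨fun ζ ζ' => Subtype.ext (by rw [ζ.2 hi, ζ'.2 hi])⟩, ⟨⟨1, fun _ => rfl⟩⟩⟩

theorem card_stabilizer (x : A.Cone) : Nat.card (MulAction.stabilizer A.DeckImage (proj x)) =
    ∏ i, if A.L i x.v = 0 then A.b i else 1 := by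
  rw [← card_deck_fixing]
  let toStabilizer (h : {h : A.Deck // ∀ i, x.y i ≠ 0 → h i = 1}) :
      MulAction.stabilizer A.DeckImage (proj x) :=
    ⟨⟨MulAction.toPermHom A.Deck A.Surface h.1, h.1, rfl⟩,
      show h.1 • proj x = proj x by rw [deck_smul_proj, deck_smul_eq_self h.2]⟩
  refine (Nat.card_congr (Equiv.ofBijective toStabilizer ⟨fun h h' heq => ?_, ?_⟩)).symm
  · exact Subtype.ext (deck_ext_of_fixing h.2 h'.2 fun q =>
      congrArg (fun s : MulAction.stabilizer A.DeckImage (proj x) => s.1.1 q) heq)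
  · rintro ⟨⟨_, g, rfl⟩, hg⟩
    obtain ⟨h, hh, heq⟩ := exists_deck_fixing (show proj (g • x) = proj x from hg)
    exact ⟨⟨h, hh⟩, Subtype.ext (Subtype.ext (Equiv.ext heq))⟩

theorem isUniformization {T : ι → Set ProjectivePlane}
    (hT : ∀ i v (hv : v ≠ 0), Projectivization.mk ℂ v hv ∈ T i ↔ A.L i v = 0) :
    IsUniformization A.DeckImage (cover : A.Surface → _) (orbifoldWeight T A.b) where
  faithful := inferInstance
  properlyDiscontinuous :=
    have : Finite A.DeckImage := Finite.of_surjective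
      (MulAction.toPermHom A.Deck A.Surface).rangeRestrict (MonoidHom.rangeRestrict_surjective _)
    Finite.to_properlyDiscontinuousSMul
  holomorphic_smul := by
    rintro ⟨_, g, rfl⟩ q
    exact mdifferentiableAt_deck_smul g q
  quotientMap := isQuotientMap_cover
  fiber_eq_orbit q q' := by
    rw [cover_eq_iff]
    constructor
    · rintro ⟨g, rfl⟩
      exact ⟨⟨_, g, rfl⟩, rfl⟩
    · rintro ⟨⟨_, g, rfl⟩, hg⟩
      exact ⟨g, hg⟩
  holomorphic_iff U hU f := holomorphicOnPlane_iff hU f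
  isotropy q := by
    obtain ⟨x, rfl⟩ := proj_surjective q
    rw [card_stabilizer, orbifoldWeight]
    simp only [cover_proj, hT]

end Isotropy

end BranchData

end Uniformization

/-! ### Monomial decomposition of functions on the cone -/

section MonomialDecomposition

theorem sum_pow_eq_ite_of_pow_eq_one {R : Type*} [CommRing R] [IsDomain R] [DecidableEq R]
    {b : ℕ} {ζ : R} (hζ : ζ ^ b = 1) :
    ∑ s : Fin b, ζ ^ (s : ℕ) = if ζ = 1 then (b : R) else 0 := by
  rw [Fin.sum_univ_eq_sum_range (fun n => ζ ^ n)]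
  split_ifs with hone
  · simp [hone]
  · have hgeom : (∑ n ∈ Finset.range b, ζ ^ n) * (ζ - 1) = 0 := by
      rw [geom_sum_mul, hζ, sub_self]
    exact (mul_eq_zero.1 hgeom).resolve_right (sub_ne_zero.2 hone)

namespace BranchData

variable {ι : Type*} [Fintype ι] {A : BranchData ι}

variable (A) in
/-- The exponents `s` with `0 ≤ s i < b i`: the monomials `∏ yᵢ ^ sᵢ` form a basis of the functions
on the cone over the functions of `v`, one for each character of the deck group. -/
abbrev Exponent : Type _ := ∀ i, Fin (A.b i)

/-- The character by which the deck group acts on the monomial with exponents `s`. -/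
def character (s : A.Exponent) : A.Deck →* ℂ where
  toFun g := ∏ i, ((g i : ℂˣ) : ℂ) ^ (s i : ℕ)
  map_one' := by simp
  map_mul' g g' := by simp [mul_pow, Finset.prod_mul_distrib]

theorem character_apply (s : A.Exponent) (g : A.Deck) :
    character s g = ∏ i, ((g i : ℂˣ) : ℂ) ^ (s i : ℕ) := rfl

theorem character_injective :
    Function.Injective (character : A.Exponent → A.Deck →* ℂ) := by
  classical
  intro s t hst
  funext i
  have hprim := Complex.isPrimitiveRoot_exp (A.b i) (A.b_ne_zero i)
  let ζ : rootsOfUnity (A.b i) ℂ := hprim.toRootsOfUnity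
  have hsingle : ∀ u : A.Exponent, character u (Pi.mulSingle i ζ) = ((ζ : ℂˣ) : ℂ) ^ (u i : ℕ) :=
    fun u => by
      rw [character_apply, Finset.prod_eq_single i, Pi.mulSingle_eq_same]
      · intro j _ hj
        rw [Pi.mulSingle_eq_of_ne hj, OneMemClass.coe_one, Units.val_one, one_pow]
      · exact fun hi => absurd (Finset.mem_univ i) hi
  exact Fin.ext (hprim.pow_inj (s i).2 (t i).2
    ((hsingle s).symm.trans ((DFunLike.congr_fun hst _).trans (hsingle t))))

namespace Cone

/-- The monomial in the roots with exponents `s`. -/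
def monomial (x : A.Cone) (s : A.Exponent) : ℂ := ∏ i, x.y i ^ (s i : ℕ)

theorem continuous_monomial (s : A.Exponent) : Continuous fun x : A.Cone => x.monomial s :=
  continuous_finsetProd _ fun i _ => (continuous_y_apply i).pow _

theorem monomial_deck_smul (g : A.Deck) (x : A.Cone) (s : A.Exponent) :
    (g • x).monomial s = character s g * x.monomial s := by
  simp only [monomial, character_apply, deck_smul_y, mul_pow, Finset.prod_mul_distrib]

/-- The monomial with the exponents complementary to `s` modulo `b`: its product with
`x.monomial s` is a function of `v`. -/
def coMonomial (x : A.Cone) (s : A.Exponent) : ℂ :=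
  ∏ i with (s i : ℕ) ≠ 0, x.y i ^ (A.b i - s i)

theorem monomial_mul_coMonomial (x : A.Cone) (s : A.Exponent) :
    x.monomial s * x.coMonomial s = ∏ i with (s i : ℕ) ≠ 0, A.L i x.v := by
  rw [monomial, coMonomial, Finset.prod_filter, Finset.prod_filter, ← Finset.prod_mul_distrib]
  refine Finset.prod_congr rfl fun i _ => ?_
  split_ifs with hi
  · rw [← pow_add, Nat.add_sub_cancel' (s i).2.le, x.y_pow]
  · rw [not_not.1 hi, pow_zero, mul_one]

theorem coMonomial_deck_smul (g : A.Deck) (x : A.Cone) (s : A.Exponent) :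
    (g • x).coMonomial s = (character s g)⁻¹ * x.coMonomial s := by
  have hcomplement :
      character s g * ∏ i with (s i : ℕ) ≠ 0, ((g i : ℂˣ) : ℂ) ^ (A.b i - s i) = 1 := by
    rw [character_apply, Finset.prod_filter, ← Finset.prod_mul_distrib]
    refine Finset.prod_eq_one fun i _ => ?_
    split_ifs with hi
    · rw [← pow_add, Nat.add_sub_cancel' (s i).2.le, g.pow_eq_one]
    · rw [not_not.1 hi, pow_zero, mul_one]
  simp only [coMonomial, deck_smul_y, mul_pow, Finset.prod_mul_distrib]
  rw [eq_inv_of_mul_eq_one_right hcomplement]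

theorem coMonomial_eq_zero {x : A.Cone} {s : A.Exponent} {i : ι} (hs : (s i : ℕ) ≠ 0)
    (hi : x.y i = 0) : x.coMonomial s = 0 :=
  Finset.prod_eq_zero (Finset.mem_filter.2 ⟨Finset.mem_univ i, hs⟩)
    (by rw [hi, zero_pow (Nat.sub_ne_zero_of_lt (s i).2)])

theorem monomial_ne_zero {x : A.Cone} (hx : ∀ i, x.y i ≠ 0) (s : A.Exponent) :
    x.monomial s ≠ 0 :=
  Finset.prod_ne_zero_iff.2 fun i _ => pow_ne_zero _ (hx i)

end Cone

section Uniqueness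

variable [DecidableEq ι]

theorem eq_zero_of_sum_mul_monomial_deck_smul_eq_zero {x : A.Cone} (hx : ∀ i, x.y i ≠ 0)
    {c : A.Exponent → ℂ} (hc : ∀ g : A.Deck, ∑ s, c s * (g • x).monomial s = 0) (s : A.Exponent) :
    c s = 0 := by
  have hindep : LinearIndependent ℂ fun s : A.Exponent => (character s : A.Deck → ℂ) :=
    (linearIndependent_monoidHom A.Deck ℂ).comp _ character_injective
  refine (mul_eq_zero.1 (Fintype.linearIndependent_iff.1 hindep (fun s => c s * x.monomial s)
    (funext fun g => ?_) s)).resolve_right (x.monomial_ne_zero hx s)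
  simp only [Finset.sum_apply, Pi.smul_apply, smul_eq_mul, Pi.zero_apply]
  rw [← hc g]
  exact Finset.sum_congr rfl fun s _ => by rw [Cone.monomial_deck_smul]; ring

theorem eq_zero_of_sum_mul_monomial_eq_zero {C : Set ℂ³} (hC : IsOpen C) (h0 : (0 : ℂ³) ∉ C)
    {h : A.Exponent → ℂ³ → ℂ} (hh : ∀ s, ContinuousOn (h s) C)
    (hz : ∀ x : A.Cone, x.v ∈ C → ∑ s, h s x.v * x.monomial s = 0) (s : A.Exponent) {v : ℂ³}
    (hv : v ∈ C) : h s v = 0 := by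
  obtain ⟨x, rfl⟩ := exists_cone_over (A := A) (v := v) fun hv0 => h0 (hv0 ▸ hv)
  have hCone : IsOpen {x : A.Cone | x.v ∈ C} := hC.preimage Cone.continuous_v
  have hcont : ContinuousOn (fun x : A.Cone => h s x.v) {x | x.v ∈ C} :=
    (hh s).comp Cone.continuous_v.continuousOn fun x hx => hx
  refine EqOn.of_subset_closure (t := {x : A.Cone | x.v ∈ C})
    (s := {x : A.Cone | x.v ∈ C} ∩ {x | ∀ i, x.y i ≠ 0}) (g := fun _ => 0) (fun w hw => ?_)
    hcont continuousOn_const inter_subset_left (dense_y_ne_zero.open_subset_closure_inter hCone) hv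
  exact eq_zero_of_sum_mul_monomial_deck_smul_eq_zero (c := fun s => h s w.v) hw.2
    (fun g => hz (g • w) hw.1) s

end Uniqueness

section Trace

variable [DecidableEq ι]

noncomputable instance (i : ι) : Fintype (rootsOfUnity (A.b i) ℂ) := .ofFinite _

open Classical in
/-- The sum of the values at the points of the cone over `v`; it is set to `0` at `v = 0`, over
which the cone has no point. -/
noncomputable def trace (Φ : A.Cone → ℂ) (v : ℂ³) : ℂ :=
  if hv : v ≠ 0 then ∑ g : A.Deck, Φ (g • (exists_cone_over hv).choose) else 0

theorem trace_v (Φ : A.Cone → ℂ) (x : A.Cone) : trace Φ x.v = ∑ g : A.Deck, Φ (g • x) := by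
  rw [trace, dif_pos x.v_ne_zero]
  obtain ⟨g₀, hg₀⟩ := exists_deck_smul_eq (exists_cone_over (A := A) x.v_ne_zero).choose_spec
  rw [← hg₀, ← Equiv.sum_comp (Equiv.mulRight g₀) fun g => Φ (g • x)]
  exact Finset.sum_congr rfl fun g _ => by rw [Equiv.coe_mulRight, mul_smul]

theorem differentiableOn_trace {C : Set ℂ³} (hC : IsOpen C) (h0 : (0 : ℂ³) ∉ C)
    {F : A.Surface → ℂ}
    (hF : ∀ x : A.Cone, x.v ∈ C → MDifferentiableAt 𝓘(ℂ, ℂ²) 𝓘(ℂ, ℂ) F (proj x))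
    (T : Finset ι) (t : ι → ℕ) :
    DifferentiableOn ℂ (trace fun x : A.Cone => F (proj x) * ∏ i ∈ T, x.y i ^ t i) C := by
  refine differentiableOn_of_cone (A := A) hC h0 ?_ fun x hx hy => ?_
  · simp only [trace_v]
    refine continuousOn_finsetSum _ fun g _ x hx => ContinuousAt.continuousWithinAt ?_
    have hFg : ContinuousAt (fun x : A.Cone => F (proj (g • x))) x :=
      ContinuousAt.comp (g := F) (hF (g • x) hx).continuousAt
        (continuous_proj.comp (continuous_const_smul g)).continuousAt
    exact hFg.mul (continuous_finsetProd _ fun i _ => ((Cone.continuous_y_apply i).comp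
      (continuous_const_smul g)).pow _).continuousAt
  · obtain ⟨s, hsx, hsv, hs, hsy⟩ := Cone.exists_localSection hy
    have hgsy : ∀ (g : A.Deck) i, ContDiffAt ℂ 1 (fun v => (g • s v).y i) x.v :=
      fun g i => contDiffAt_const.mul (hsy i)
    have hdiff : DifferentiableAt ℂ (fun v => ∑ g : A.Deck,
        F (proj (g • s v)) * ∏ i ∈ T, (g • s v).y i ^ t i) x.v := by
      refine DifferentiableAt.fun_sum fun g _ => DifferentiableAt.mul ?_
        ((contDiffAt_prod fun i _ => (hgsy g i).pow _).differentiableAt one_ne_zero)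
      have hFx : MDifferentiableAt 𝓘(ℂ, ℂ²) 𝓘(ℂ, ℂ) F (proj (g • s x.v)) := by
        rw [hsx]
        exact hF (g • x) hx
      exact (hFx.comp x.v (mdifferentiableAt_proj_comp (hs.const_smul g) (hgsy g))).differentiableAt
    refine hdiff.congr_of_eventuallyEq (hsv.mono fun v hv => ?_)
    exact (congrArg (trace _) hv.symm).trans (trace_v _ (s v))

theorem exists_trace_eq_prod_mul {C : Set ℂ³} (hC : IsOpen C) (h0 : (0 : ℂ³) ∉ C)
    {F : A.Surface → ℂ}
    (hF : ∀ x : A.Cone, x.v ∈ C → MDifferentiableAt 𝓘(ℂ, ℂ²) 𝓘(ℂ, ℂ) F (proj x))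
    (s : A.Exponent) :
    ∃ K : ℂ³ → ℂ, DifferentiableOn ℂ K C ∧ ∀ v ∈ C,
      trace (fun x : A.Cone => F (proj x) * x.coMonomial s) v =
        (∏ i with (s i : ℕ) ≠ 0, A.L i v) * K v := by
  refine exists_eq_prod_mul_of_vanishing hC A.L _ (fun i _ j _ hij => ?_) (fun i _ => A.L_ne_zero i)
    (differentiableOn_trace hC h0 hF _ _) fun i hi v hv hL => ?_
  · obtain ⟨k, hki, hkj, -⟩ := A.exists_weight_one i j
    obtain ⟨e, hLi, hLj, -⟩ := A.exists_dual hij hki.symm hkj.symm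
    exact ⟨e, hLj, hLi ▸ one_ne_zero⟩
  · obtain ⟨x, rfl⟩ := exists_cone_over (A := A) (v := v) fun hv0 => h0 (hv0 ▸ hv)
    rw [trace_v]
    refine Finset.sum_eq_zero fun g _ => mul_eq_zero_of_right _
      (Cone.coMonomial_eq_zero (Finset.mem_filter.1 hi).2 ?_)
    exact ((g • x).y_eq_zero_iff i).2 hL

theorem sum_inv_character (g : A.Deck) :
    ∑ s : A.Exponent, (character s g)⁻¹ = if g = 1 then (Fintype.card A.Deck : ℂ) else 0 := by
  have hcard : (Fintype.card A.Deck : ℂ) = ∏ i, (A.b i : ℂ) := by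
    rw [Fintype.card_pi, Nat.cast_prod]
    exact Finset.prod_congr rfl fun i _ => by
      rw [← Nat.card_eq_fintype_card, Complex.card_rootsOfUnity]
  have hfactor : ∑ s : A.Exponent, (character s g)⁻¹ =
      ∏ i, if ((g i : ℂˣ) : ℂ)⁻¹ = 1 then (A.b i : ℂ) else 0 := by
    simp only [character_apply, ← Finset.prod_inv_distrib, ← inv_pow]
    rw [← Fintype.prod_sum fun i (s : Fin (A.b i)) => ((g i : ℂˣ) : ℂ)⁻¹ ^ (s : ℕ)]
    exact Finset.prod_congr rfl fun i _ =>
      sum_pow_eq_ite_of_pow_eq_one (by rw [inv_pow, g.pow_eq_one, inv_one])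
  rw [hfactor]
  split_ifs with hg
  · rw [hcard]
    simp [hg]
  · obtain ⟨i, hi⟩ := Function.ne_iff.1 hg
    exact Finset.prod_eq_zero (Finset.mem_univ i)
      (if_neg fun hone => hi (Subtype.ext (Units.ext (inv_eq_one.1 hone))))

theorem sum_mul_monomial_eq_card_mul {Φ : A.Cone → ℂ} {x : A.Cone} (hx : ∀ i, x.y i ≠ 0)
    {c : A.Exponent → ℂ}
    (hc : ∀ s, trace (fun w => Φ w * w.coMonomial s) x.v =
      (∏ i with (s i : ℕ) ≠ 0, A.L i x.v) * c s) :
    ∑ s, c s * x.monomial s = Fintype.card A.Deck * Φ x := by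
  have hcoeff : ∀ s, c s * x.monomial s = ∑ g : A.Deck, Φ (g • x) * (character s g)⁻¹ := fun s => by
    have hprod : ∏ i with (s i : ℕ) ≠ 0, A.L i x.v ≠ 0 := Finset.prod_ne_zero_iff.2 fun i _ hL =>
      hx i ((x.y_eq_zero_iff i).2 hL)
    refine mul_left_cancel₀ hprod ?_
    rw [← mul_assoc, ← hc s, trace_v, ← x.monomial_mul_coMonomial, Finset.sum_mul, Finset.mul_sum]
    refine Finset.sum_congr rfl fun g _ => ?_
    rw [Cone.coMonomial_deck_smul]
    ring
  simp only [hcoeff]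
  rw [Finset.sum_comm]
  simp only [← Finset.mul_sum, sum_inv_character, mul_ite, mul_zero, Finset.sum_ite_eq',
    Finset.mem_univ, if_true, one_smul]
  exact mul_comm _ _

theorem exists_monomial_decomposition {C : Set ℂ³} (hC : IsOpen C) (h0 : (0 : ℂ³) ∉ C)
    {F : A.Surface → ℂ}
    (hF : ∀ x : A.Cone, x.v ∈ C → MDifferentiableAt 𝓘(ℂ, ℂ²) 𝓘(ℂ, ℂ) F (proj x)) :
    ∃ h : A.Exponent → ℂ³ → ℂ, (∀ s, DifferentiableOn ℂ (h s) C) ∧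
      ∀ x : A.Cone, x.v ∈ C → F (proj x) = ∑ s, h s x.v * x.monomial s := by
  choose K hKd hK using exists_trace_eq_prod_mul hC h0 hF
  have hcard : (Fintype.card A.Deck : ℂ) ≠ 0 := Nat.cast_ne_zero.2 Fintype.card_ne_zero
  have hKcone : ∀ s, ContinuousOn (fun x : A.Cone => K s x.v) {x | x.v ∈ C} := fun s =>
    (hKd s).continuousOn.comp Cone.continuous_v.continuousOn fun x hx => hx
  have hFcone : ContinuousOn (fun x : A.Cone => F (proj x)) {x | x.v ∈ C} := fun x hx =>
    (ContinuousAt.comp (hF x hx).continuousAt continuous_proj.continuousAt).continuousWithinAt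
  have hoff : ∀ x : A.Cone, x.v ∈ C → (∀ i, x.y i ≠ 0) →
      Fintype.card A.Deck * F (proj x) = ∑ s, K s x.v * x.monomial s := fun x hx hy =>
    (sum_mul_monomial_eq_card_mul (Φ := fun x => F (proj x)) hy fun s => hK s x.v hx).symm
  have heverywhere : EqOn (fun x : A.Cone => Fintype.card A.Deck * F (proj x))
      (fun x => ∑ s, K s x.v * x.monomial s) {x | x.v ∈ C} :=
    EqOn.of_subset_closure (fun x hx => hoff x hx.1 hx.2) (continuousOn_const.mul hFcone)
      (continuousOn_finsetSum _ fun s _ =>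
        (hKcone s).mul (Cone.continuous_monomial s).continuousOn)
      inter_subset_left
      (dense_y_ne_zero.open_subset_closure_inter (hC.preimage Cone.continuous_v))
  refine ⟨fun s v => (Fintype.card A.Deck : ℂ)⁻¹ * K s v, fun s => (hKd s).const_mul _,
    fun x hx => ?_⟩
  simp only [mul_assoc, ← Finset.mul_sum]
  exact (eq_inv_mul_iff_mul_eq₀ hcard).2 (heverywhere hx)

end Trace

end BranchData

end MonomialDecomposition

/-! ### Vanishing of the irregularity -/

section Cohomology

theorem exists_locallyConst_index {X Y κ : Type*} [TopologicalSpace X] [T2Space X]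
    [TopologicalSpace Y] {f : X → Y} (hf : IsClosedMap f) {p : Y} (hp : (f ⁻¹' {p}).Finite)
    {U : κ → Set X} (hU : ∀ i, IsOpen (U i)) (hcov : ⋃ i, U i = univ) :
    ∃ (V : Set Y) (idx : X → κ), IsOpen V ∧ p ∈ V ∧
      ∀ q, f q ∈ V → q ∈ U (idx q) ∧ ∀ᶠ q' in 𝓝 q, idx q' = idx q := by
  classical
  choose a ha using fun q => mem_iUnion.1 (hcov ▸ mem_univ q : q ∈ ⋃ i, U i)
  obtain ⟨O, hO, hdisj⟩ := hp.t2_separation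
  let W (q : X) : Set X := O q ∩ U (a q)
  have hWo : ∀ q, IsOpen (W q) := fun q => (hO q).2.inter (hU _)
  let idx (x : X) : κ := if h : ∃ q ∈ f ⁻¹' {p}, x ∈ W q then a h.choose else a x
  have hidx : ∀ q ∈ f ⁻¹' {p}, ∀ x ∈ W q, idx x = a q := fun q hq x hx => by
    have hex : ∃ q ∈ f ⁻¹' {p}, x ∈ W q := ⟨q, hq, hx⟩
    have hchoose : hex.choose = q := hdisj.elim_set hex.choose_spec.1 hq x hex.choose_spec.2.1 hx.1
    simp only [idx, dif_pos hex, hchoose]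
  let B : Set X := ⋃ q ∈ f ⁻¹' {p}, W q
  have hB : IsOpen B := isOpen_biUnion fun q _ => hWo q
  refine ⟨(f '' Bᶜ)ᶜ, idx, (hf _ hB.isClosed_compl).isOpen_compl, ?_, fun x hx => ?_⟩
  · rintro ⟨q, hqB, hqp⟩
    exact hqB (mem_biUnion hqp ⟨(hO q).1, ha q⟩)
  · obtain ⟨q, hq, hxq⟩ := mem_iUnion₂.1 (not_not.1 fun hxB => hx ⟨x, hxB, rfl⟩ : x ∈ B)
    rw [hidx q hq x hxq]
    exact ⟨hxq.2, eventually_of_mem ((hWo q).mem_nhds hxq) fun x' hx' => hidx q hq x' hx'⟩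

theorem smul_mem_coneSet {V : Set ProjectivePlane} {μ : ℂ} (hμ : μ ≠ 0) {v : Fin 3 → ℂ}
    (hv : v ∈ coneSet V) : μ • v ∈ coneSet V := by
  obtain ⟨hv0, hvV⟩ := hv
  refine ⟨smul_ne_zero hμ hv0, ?_⟩
  rwa [(Projectivization.mk_eq_mk_iff ℂ (μ • v) v _ hv0).2 ⟨Units.mk0 μ hμ, rfl⟩]

theorem isConicalCover_coneSet {κ : Type*} {V : κ → Set ProjectivePlane} (hV : ∀ a, IsOpen (V a))
    (hcov : ∀ p, ∃ a, p ∈ V a) : IsConicalCover fun a => coneSet (V a) where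
  isOpen a := isOpen_coneSet (hV a)
  zero_notMem a := zero_notMem_coneSet (V a)
  smul_mem hμ hv := smul_mem_coneSet hμ hv
  exists_mem {v} hv := (hcov (Projectivization.mk ℂ v hv)).imp fun _ ha => ⟨hv, ha⟩

namespace BranchData

variable {ι : Type*} {A : BranchData ι}

theorem finite_cover_fiber [Finite ι] (p : ProjectivePlane) :
    (cover ⁻¹' {p} : Set A.Surface).Finite := by
  obtain ⟨q, rfl⟩ := isQuotientMap_cover.surjective (f := (cover : A.Surface → _)) p
  exact (finite_range fun g : A.Deck => g • q).subset fun _ hq' => cover_eq_iff.1 hq'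

section Coefficients

variable [Fintype ι]

theorem Cone.monomial_smul (c : ℂˣ) (x : A.Cone) (s : A.Exponent) :
    (c • x).monomial s = (c : ℂ) ^ (∑ i, A.d i * s i) * x.monomial s := by
  simp only [monomial, smul_y, mul_pow, Finset.prod_mul_distrib, ← pow_mul,
    Finset.prod_pow_eq_pow_sum]

variable [DecidableEq ι]

theorem eqOn_of_sum_mul_monomial_eq {C : Set ℂ³} (hC : IsOpen C) (h0 : (0 : ℂ³) ∉ C)
    {h k : A.Exponent → ℂ³ → ℂ} (hh : ∀ s, ContinuousOn (h s) C) (hk : ∀ s, ContinuousOn (k s) C)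
    (heq : ∀ x : A.Cone, x.v ∈ C → ∑ s, h s x.v * x.monomial s = ∑ s, k s x.v * x.monomial s)
    (s : A.Exponent) : EqOn (h s) (k s) C := fun v hv =>
  sub_eq_zero.1 <| eq_zero_of_sum_mul_monomial_eq_zero (A := A) hC h0
    (h := fun s v => h s v - k s v) (fun s => (hh s).sub (hk s))
    (fun x hx => by simp only [sub_mul, Finset.sum_sub_distrib, heq x hx, sub_self]) s hv

theorem coeff_smul {C : Set ℂ³} (hC : IsOpen C) (h0 : (0 : ℂ³) ∉ C)
    (hsmul : ∀ μ : ℂ, μ ≠ 0 → ∀ v ∈ C, μ • v ∈ C) {F : A.Surface → ℂ} {h : A.Exponent → ℂ³ → ℂ}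
    (hh : ∀ s, ContinuousOn (h s) C)
    (hF : ∀ x : A.Cone, x.v ∈ C → F (proj x) = ∑ s, h s x.v * x.monomial s)
    (c : ℂˣ) (s : A.Exponent) {v : ℂ³} (hv : v ∈ C) :
    h s ((c : ℂ) ^ A.N • v) = ((c : ℂ) ^ (∑ i, A.d i * s i))⁻¹ * h s v := by
  have hmem : ∀ v ∈ C, (c : ℂ) ^ A.N • v ∈ C := hsmul _ (pow_ne_zero _ c.ne_zero)
  rw [eq_inv_mul_iff_mul_eq₀ (pow_ne_zero _ c.ne_zero)]
  refine eqOn_of_sum_mul_monomial_eq (A := A) hC h0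
    (h := fun s v => (c : ℂ) ^ (∑ i, A.d i * s i) * h s ((c : ℂ) ^ A.N • v))
    (fun s => continuousOn_const.mul ((hh s).comp (continuous_const_smul _).continuousOn hmem))
    hh (fun x hx => ?_) s hv
  rw [← hF x hx, ← proj_smul c x, hF (c • x) (hmem _ hx)]
  refine Finset.sum_congr rfl fun s _ => ?_
  rw [Cone.monomial_smul, Cone.smul_v]
  ring

theorem isHolomorphicCocycle_coeff {κ : Type*} {C : κ → Set ℂ³} (hC : IsConicalCover C)
    {F : κ → κ → A.Surface → ℂ}
    (hF : ∀ a b c, ∀ x : A.Cone, x.v ∈ C a ∩ C b ∩ C c →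
      F a b (proj x) + F b c (proj x) = F a c (proj x))
    {h : κ → κ → A.Exponent → ℂ³ → ℂ} (hh : ∀ a b s, DifferentiableOn ℂ (h a b s) (C a ∩ C b))
    (hFh : ∀ a b, ∀ x : A.Cone, x.v ∈ C a ∩ C b →
      F a b (proj x) = ∑ s, h a b s x.v * x.monomial s) (s : A.Exponent) :
    IsHolomorphicCocycle C fun a b => h a b s where
  differentiableOn a b := hh a b s
  add_eq {a b c v} hva hvb hvc := by
    refine eqOn_of_sum_mul_monomial_eq (A := A) (h := fun s v => h a b s v + h b c s v)
      (((hC.isOpen a).inter (hC.isOpen b)).inter (hC.isOpen c))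
      (fun h0 => hC.zero_notMem a h0.1.1) (fun s => ?_) (fun s => ?_) (fun x hx => ?_) s
      ⟨⟨hva, hvb⟩, hvc⟩
    · exact ((hh a b s).continuousOn.mono inter_subset_left).add
        ((hh b c s).continuousOn.mono fun w hw => ⟨hw.1.2, hw.2⟩)
    · exact (hh a c s).continuousOn.mono fun w hw => ⟨hw.1.1, hw.2⟩
    · simp only [add_mul, Finset.sum_add_distrib]
      rw [← hFh a b x hx.1, ← hFh b c x ⟨hx.1.2, hx.2⟩, ← hFh a c x ⟨hx.1.1, hx.2⟩, hF a b c x hx]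

theorem exists_eq_sum_mul_monomial {C : Set ℂ³} {g : A.Exponent → ℂ³ → ℂ}
    (hg : ∀ (c : ℂˣ) s, ∀ v ∈ C,
      g s ((c : ℂ) ^ A.N • v) = ((c : ℂ) ^ (∑ i, A.d i * s i))⁻¹ * g s v) :
    ∃ G : A.Surface → ℂ, ∀ x : A.Cone, x.v ∈ C → G (proj x) = ∑ s, g s x.v * x.monomial s := by
  let lift : A.Surface → A.Cone := Function.surjInv proj_surjective
  refine ⟨fun q => ∑ s, g s (lift q).v * (lift q).monomial s, fun x hx => ?_⟩
  obtain ⟨c, hc⟩ := proj_eq_iff.1 (Function.surjInv_eq proj_surjective (proj x))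
  refine Finset.sum_congr rfl fun s _ => ?_
  have hcs : (c : ℂ) ^ (∑ i, A.d i * s i) ≠ 0 := pow_ne_zero _ c.ne_zero
  rw [show lift (proj x) = c • x from hc.symm, Cone.smul_v, hg c s x.v hx, Cone.monomial_smul]
  field_simp

theorem mdifferentiableAt_of_eq_sum_mul_monomial {V : Set ProjectivePlane} (hV : IsOpen V)
    {g : A.Exponent → ℂ³ → ℂ} (hg : ∀ s, DifferentiableOn ℂ (g s) (coneSet V)) {G : A.Surface → ℂ}
    (hG : ∀ x : A.Cone, x.v ∈ coneSet V → G (proj x) = ∑ s, g s x.v * x.monomial s)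
    {x : A.Cone} (hx : x.v ∈ coneSet V) : MDifferentiableAt 𝓘(ℂ, ℂ²) 𝓘(ℂ, ℂ) G (proj x) := by
  obtain ⟨p, hp⟩ := exists_chartIndex_mem x
  have hcone : coneSet V ∈ 𝓝 (p.vec (p.coord x)) := by
    refine (isOpen_coneSet hV).mem_nhds ((mem_coneSet_iff (x := p.point (p.coord x))).2 ?_)
    rw [p.proj_point_coord hp]
    exact mem_coneSet_iff.1 hx
  have hsum : DifferentiableAt ℂ (fun z => ∑ s : A.Exponent, g s (p.vec z) *
      ∏ i, p.root z i ^ (s i : ℕ)) (p.coord x) :=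
    DifferentiableAt.fun_sum fun s _ =>
      (((hg s).differentiableAt hcone).comp (p.coord x)
        ((p.contDiff_vec (n := 1)).differentiable one_ne_zero _)).mul
      ((contDiffAt_prod fun i _ =>
        (p.contDiffAt_root (p.coord_mem_target hp) i).pow _).differentiableAt one_ne_zero)
  refine (mdifferentiableAt_iff p hp).2 (hsum.congr_of_eventuallyEq ?_)
  exact (p.continuous_vec.continuousAt.eventually hcone).mono fun z hz => hG (p.point z) hz

end Coefficients

theorem exists_primitive_of_cocycle [Finite ι] {κ : Type*} {V : κ → Set ProjectivePlane}
    (hV : ∀ a, IsOpen (V a)) (hcov : ∀ p, ∃ a, p ∈ V a) {F : κ → κ → A.Surface → ℂ}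
    (hF : ∀ a b q, cover q ∈ V a ∩ V b → MDifferentiableAt 𝓘(ℂ, ℂ²) 𝓘(ℂ, ℂ) (F a b) q)
    (hcoc : ∀ a b c q, cover q ∈ V a ∩ V b ∩ V c → F a b q + F b c q = F a c q) :
    ∃ G : κ → A.Surface → ℂ,
      (∀ a q, cover q ∈ V a → MDifferentiableAt 𝓘(ℂ, ℂ²) 𝓘(ℂ, ℂ) (G a) q) ∧
      ∀ a b q, cover q ∈ V a ∩ V b → F a b q = G b q - G a q := by
  classical
  cases nonempty_fintype ι
  have hC := isConicalCover_coneSet hV hcov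
  have hmem : ∀ {a} {x : A.Cone}, x.v ∈ coneSet (V a) ↔ cover (proj x) ∈ V a := mem_coneSet_iff
  have hCC : ∀ a b, IsOpen (coneSet (V a) ∩ coneSet (V b)) := fun a b =>
    (hC.isOpen a).inter (hC.isOpen b)
  have hCC0 : ∀ a b, (0 : ℂ³) ∉ coneSet (V a) ∩ coneSet (V b) := fun a b h0 =>
    hC.zero_notMem a h0.1
  choose h hh hFh using fun a b => exists_monomial_decomposition (A := A) (hCC a b) (hCC0 a b)
    fun x hx => hF a b (proj x) ⟨hmem.1 hx.1, hmem.1 hx.2⟩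
  have hcoeff := isHolomorphicCocycle_coeff hC
    (fun a b c x hx => hcoc a b c (proj x) ⟨⟨hmem.1 hx.1.1, hmem.1 hx.1.2⟩, hmem.1 hx.2⟩) hh hFh
  choose g hg hhg hghom using fun s => (hcoeff s).exists_primitive (by simp) hC
  have hgweight : ∀ a (c : ℂˣ) s, ∀ v ∈ coneSet (V a),
      g s a ((c : ℂ) ^ A.N • v) = ((c : ℂ) ^ (∑ i, A.d i * s i))⁻¹ * g s a v := fun a c s =>
    hghom s _ _ (pow_ne_zero _ c.ne_zero) (fun a b _ => coeff_smul (hCC a b) (hCC0 a b)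
      (fun _ hμ _ hv => ⟨smul_mem_coneSet hμ hv.1, smul_mem_coneSet hμ hv.2⟩)
      (fun s => (hh a b s).continuousOn) (hFh a b) c s) a
  choose G hG using fun a => exists_eq_sum_mul_monomial (hgweight a)
  refine ⟨G, fun a q hq => ?_, fun a b q hq => ?_⟩ <;> obtain ⟨x, rfl⟩ := proj_surjective q
  · exact mdifferentiableAt_of_eq_sum_mul_monomial (hV a) (fun s => hg s a) (hG a)
      (hmem.2 hq)
  · have hxa := hmem.2 hq.1
    have hxb := hmem.2 hq.2
    rw [hFh a b x ⟨hxa, hxb⟩, hG a x hxa, hG b x hxb, ← Finset.sum_sub_distrib]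
    exact Finset.sum_congr rfl fun s _ => by rw [hhg s a b x.v ⟨hxa, hxb⟩, sub_mul]

theorem structureSheafH1Vanishes [Finite ι] : StructureSheafH1Vanishes A.Surface := by
  intro κ U hU hcov f hf hcoc
  choose V idx hV hpV hidx using fun p =>
    exists_locallyConst_index (isClosedMap_cover (A := A)) (finite_cover_fiber p) hU hcov
  have hmem : ∀ {p q}, cover q ∈ V p → q ∈ U (idx p q) := fun hq => (hidx _ _ hq).1
  have hconst : ∀ {p q}, cover q ∈ V p → ∀ᶠ q' in 𝓝 q, idx p q' = idx p q :=
    fun hq => (hidx _ _ hq).2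
  have hfat : ∀ {i j q}, q ∈ U i → q ∈ U j → MDifferentiableAt 𝓘(ℂ, ℂ²) 𝓘(ℂ, ℂ) (f i j) q :=
    fun hi hj => (hf _ _ _ ⟨hi, hj⟩).mdifferentiableAt (((hU _).inter (hU _)).mem_nhds ⟨hi, hj⟩)
  obtain ⟨G, hGdiff, hG⟩ := exists_primitive_of_cocycle hV (fun p => ⟨p, hpV p⟩)
    (F := fun a b q => f (idx a q) (idx b q) q)
    (fun a b q hq => (hfat (hmem hq.1) (hmem hq.2)).congr_of_eventuallyEq <| by
      filter_upwards [hconst hq.1, hconst hq.2] with q' ha hb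
      rw [ha, hb])
    (fun a b c q hq => hcoc _ _ _ q ⟨⟨hmem hq.1.1, hmem hq.1.2⟩, hmem hq.2⟩)
  have hlocal : ∀ p j q, cover q ∈ V p → q ∈ U j →
      f (idx (cover q) q) j q + G (cover q) q = f (idx p q) j q + G p q := fun p j q hq hj => by
    have hprimitive := hG (cover q) p q ⟨hpV _, hq⟩
    have hcocycle := hcoc _ _ j q ⟨⟨hmem (hpV (cover q)), hmem hq⟩, hj⟩
    linear_combination hprimitive - hcocycle
  refine ⟨fun j q => f (idx (cover q) q) j q + G (cover q) q, fun j q hq => ?_, fun i j q hq => ?_⟩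
  · have hdiff : MDifferentiableAt 𝓘(ℂ, ℂ²) 𝓘(ℂ, ℂ)
        (fun q' => f (idx (cover q) q) j q' + G (cover q) q') q :=
      (hfat (hmem (hpV _)) hq).add (hGdiff _ q (hpV _))
    refine (hdiff.congr_of_eventuallyEq ?_).mdifferentiableWithinAt
    filter_upwards [hconst (hpV (cover q)), (hU j).mem_nhds hq,
      ((hV (cover q)).preimage continuous_cover).mem_nhds (hpV (cover q))] with q' hidx' hj hq'
    rw [hlocal (cover q) j q' hq' hj, hidx']
  · linear_combination hcoc _ i j q ⟨⟨hmem (hpV (cover q)), hq.1⟩, hq.2⟩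

theorem isK3Surface [Fintype ι] (hsum : ∑ i, A.d i * (A.b i - 1) = 3 * A.N) :
    IsK3Surface A.Surface where
  t2 := inferInstance
  compact := inferInstance
  connected := inferInstance
  complexManifold := inferInstance
  canonical_trivial := ⟨twoForm hsum, twoForm_nowhereVanishing hsum⟩
  irregularity_zero := structureSheafH1Vanishes

end BranchData

end Cohomology

/-! ### Arrangements of lines -/

section Arrangement

/-- The linear form on `ℂ³` with coefficients `a`. -/
noncomputable def linearForm (a : Fin 3 → ℂ) : (Fin 3 → ℂ) →L[ℂ] ℂ :=
  ∑ m, a m • ContinuousLinearMap.proj (R := ℂ) (φ := fun _ : Fin 3 => ℂ) m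

theorem linearForm_apply (a v : Fin 3 → ℂ) : linearForm a v = ∑ m, a m * v m := by
  simp [linearForm]

theorem IsLine.exists_linearForm {L : Set ProjectivePlane} (hL : IsLine L) :
    ∃ l : (Fin 3 → ℂ) →L[ℂ] ℂ,
      ∀ v (hv : v ≠ 0), Projectivization.mk ℂ v hv ∈ L ↔ l v = 0 := by
  obtain ⟨a, -, rfl⟩ := hL
  refine ⟨linearForm a, fun v hv => ?_⟩
  obtain ⟨c, hc⟩ := Projectivization.exists_smul_eq_mk_rep ℂ v hv
  rw [mem_ofPred_eq, ← linearForm_apply, ← hc, Units.smul_def, map_smul, smul_eq_zero]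
  exact or_iff_right c.ne_zero

theorem InGeneralPosition.eq_zero {ι : Type*} {T : ι → Set ProjectivePlane}
    (hT : InGeneralPosition T) {L : ι → (Fin 3 → ℂ) →L[ℂ] ℂ}
    (hL : ∀ i v (hv : v ≠ 0), Projectivization.mk ℂ v hv ∈ T i ↔ L i v = 0)
    (i j k : ι) (hij : i ≠ j) (hik : i ≠ k) (hjk : j ≠ k) (v : Fin 3 → ℂ)
    (hi : L i v = 0) (hj : L j v = 0) (hk : L k v = 0) : v = 0 := by
  by_contra hv
  have hmem : Projectivization.mk ℂ v hv ∈ T i ∩ T j ∩ T k :=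
    ⟨⟨(hL i v hv).2 hi, (hL j v hv).2 hj⟩, (hL k v hv).2 hk⟩
  rwa [hT.2 i j k hij hik hjk] at hmem

theorem uniformizedByK3_of_weights {ι : Type} [Fintype ι] {T : ι → Set ProjectivePlane}
    (hline : ∀ i, IsLine (T i)) (hgen : InGeneralPosition T) {b d : ι → ℕ} {N : ℕ} (hN : N ≠ 0)
    (hdb : ∀ i, d i * b i = N) (base : Fin 3 ↪ ι) (hbase : ∀ k, d (base k) = 1)
    (hsum : ∑ i, d i * (b i - 1) = 3 * N) : UniformizedByK3 (orbifoldWeight T b) := by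
  choose L hL using fun i => (hline i).exists_linearForm
  let A : BranchData ι :=
    { L, b, d, N, base
      N_ne_zero := hN
      d_mul_b := hdb
      d_base := hbase
      independent := hgen.eq_zero hL }
  exact ⟨A.Surface, inferInstance, inferInstance, A.DeckImage, inferInstance, inferInstance,
    BranchData.cover, A.isK3Surface hsum, BranchData.isUniformization (A := A) hL⟩

end Arrangement

end K3Uniformization

theorem mainTheorem8 (T : Fin 6 → Set K3Uniformization.ProjectivePlane)
    (hline : ∀ i, K3Uniformization.IsLine (T i))
    (hgen : K3Uniformization.InGeneralPosition T) :
    K3Uniformization.UniformizedByK3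
        (K3Uniformization.orbifoldWeight T ![6, 6, 6, 2, 1, 1]) ∧
      K3Uniformization.UniformizedByK3
        (K3Uniformization.orbifoldWeight T ![4, 4, 4, 4, 1, 1]) ∧
      K3Uniformization.UniformizedByK3
        (K3Uniformization.orbifoldWeight T ![2, 2, 2, 2, 2, 2]) :=
  let base : Fin 3 ↪ Fin 6 := Fin.castLEEmb (by decide)
  ⟨K3Uniformization.uniformizedByK3_of_weights hline hgen (d := ![1, 1, 1, 3, 6, 6]) (N := 6)
      (by decide) (by decide) base (by decide) (by decide),
    K3Uniformization.uniformizedByK3_of_weights hline hgen (d := ![1, 1, 1, 1, 4, 4]) (N := 4)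
      (by decide) (by decide) base (by decide) (by decide),
    K3Uniformization.uniformizedByK3_of_weights hline hgen (d := ![1, 1, 1, 1, 1, 1]) (N := 2)
      (by decide) (by decide) base (by decide) (by decide)⟩
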